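/- Let $m,n\geq 1$ be integers. Let $\mathcal A$ be the complex super-polynomial algebra generated by even (commuting) variables $x_1,\dots,x_n,y_1,\dots,y_n$ and odd (anticommuting) variables $\theta_1,\dots,\theta_m,\vartheta_1,\dots,\vartheta_m$, the even variables commuting with the odd ones; $\partial_{x_i},\partial_{y_i}$ are the usual derivations killing the odd variables, and $\partial_{\theta_r},\partial_{\vartheta_r}$ are the odd derivations killing the even variables, dual to the odd variables. Then $$E_{i,j}\mapsto x_i\partial_{x_j}-y_j\partial_{y_i},\qquad E_{i,n+r}\mapsto x_i\partial_{\theta_r}-\vartheta_r\partial_{y_i},$$ $$E_{n+r,i}\mapsto \theta_r\partial_{x_i}+y_i\partial_{\vartheta_r},\qquad E_{n+r,n+s}\mapsto\theta_r\partial_{\theta_s}-\vartheta_s\partial_{\vartheta_r}$$ ($1\le i,j\le n$, $1\le r,s\le m$) defines a representation of the Lie superalgebra $gl(n|m)$ on $\mathcal A$. For $\ell,\ell'\in\mathbb N=\{0,1,2,\dots\}$ let $\mathcal A_{\ell,\ell'}$ be the span of the monomials of total degree $\ell$ in the variables $x_i,\theta_r$ and total degree $\ell'$ in the variables $y_i,\vartheta_r$.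 Put $$\Delta=\sum_{i=1}^n\partial_{x_i}\partial_{y_i}+\sum_{r=1}^m\partial_{\theta_r}\partial_{\vartheta_r},\qquad \eta=\sum_{i=1}^nx_iy_i+\sum_{r=1}^m\theta_r\vartheta_r,\qquad \mathcal H_{\ell,\ell'}=\{f\in\mathcal A_{\ell,\ell'}\mid\Delta(f)=0\}.$$ **Theorem 1.** Let $\ell,\ell'\in\mathbb N$. (a) $\mathcal H_{\ell,\ell'}$ is a $gl(n|m)$-submodule of $\mathcal A$, and it is zero if and only if $n=1$, $\ell>m$ and $\ell'>m$. Apart from that case, $\mathcal H_{\ell,\ell'}$ is irreducible if and only if $\ell>m+1-n$, or $\ell'>m+1-n$, or $\ell+\ell'\leq m+1-n$. (b) If $|\ell-\ell'|>m+1-n$ or $\ell+\ell'\leq m+1-n$, then $$\mathcal A_{\ell,\ell'}=\bigoplus_{i=0}^{\min\{\ell,\ell'\}}\eta^i\mathcal H_{\ell-i,\ell'-i},$$ and every summand is an irreducible $gl(n|m)$-submodule, except that the summands with $n=1$, $\ell-i>m$ and $\ell'-i>m$ are zero. -/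

import Mathlib

open scoped TensorProduct

noncomputable section

namespace SuperHarmonic

/-- Indices of the bosonic variables: `Sum.inl i` is `x_i`, `Sum.inr i` is `y_i`. -/
abbrev Bos (n : ℕ) : Type := Fin n ⊕ Fin n

/-- Indices of the fermionic variables: `Sum.inl r` is `θ_r`, `Sum.inr r` is `ϑ_r`. -/
abbrev Ferm (m : ℕ) : Type := Fin m ⊕ Fin m

/-- The bosonic part `ℂ[x, y]`. -/
abbrev BosPart (n : ℕ) : Type := MvPolynomial (Bos n) ℂ

/-- The fermionic part: the exterior algebra on the generators `θ_r, ϑ_r`. -/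
abbrev FermPart (m : ℕ) : Type := ExteriorAlgebra ℂ (Ferm m → ℂ)

/-- The super-polynomial algebra `𝒜`. The bosonic variables are even, so that the ordinary
tensor product of algebras makes them commute with the fermionic ones. -/
abbrev SuperPoly (n m : ℕ) : Type := BosPart n ⊗[ℂ] FermPart m

/-- The fermionic generator with index `p`, inside the exterior algebra. -/
def fermGen (m : ℕ) (p : Ferm m) : FermPart m := ExteriorAlgebra.ι ℂ (Pi.single p 1)

/-- The bosonic variables in `𝒜`. -/
def bosVar (n m : ℕ) (a : Bos n) : SuperPoly n m := MvPolynomial.X a ⊗ₜ[ℂ] 1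

/-- The fermionic variables in `𝒜`. -/
def fermVar (n m : ℕ) (p : Ferm m) : SuperPoly n m := 1 ⊗ₜ[ℂ] fermGen m p

/-- Multiplication by a bosonic variable. -/
def mulBos (n m : ℕ) (a : Bos n) : Module.End ℂ (SuperPoly n m) :=
  LinearMap.mulLeft ℂ (bosVar n m a)

/-- Left multiplication by a fermionic variable. -/
def mulFerm (n m : ℕ) (p : Ferm m) : Module.End ℂ (SuperPoly n m) :=
  LinearMap.mulLeft ℂ (fermVar n m p)

/-- The partial derivative with respect to a bosonic variable. -/
def dBos (n m : ℕ) (a : Bos n) : Module.End ℂ (SuperPoly n m) :=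
  LinearMap.rTensor (FermPart m) (MvPolynomial.pderiv a : Derivation ℂ (BosPart n) _).toLinearMap

/-- The partial derivative with respect to a fermionic variable: the odd derivation that kills
the bosonic variables and sends the fermionic variable with index `q` to `δ_{p,q}`
(on the exterior algebra this is the contraction with the `p`-th coordinate function). -/
def dFerm (n m : ℕ) (p : Ferm m) : Module.End ℂ (SuperPoly n m) :=
  LinearMap.lTensor (BosPart n)
    (CliffordAlgebra.contractLeft (Q := (0 : QuadraticForm ℂ (Ferm m → ℂ)))
      (LinearMap.proj p : Module.Dual ℂ (Ferm m → ℂ)))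

/-- The homogeneous part of parity `k` of `𝒜`. -/
def parityPart (n m : ℕ) (k : ZMod 2) : Submodule ℂ (SuperPoly n m) :=
  LinearMap.range (LinearMap.lTensor (BosPart n)
    (CliffordAlgebra.evenOdd (0 : QuadraticForm ℂ (Ferm m → ℂ)) k).subtype)

/-- The underlying space of `gl(n|m)`. -/
abbrev Gl (n m : ℕ) : Type := Matrix (Fin n ⊕ Fin m) (Fin n ⊕ Fin m) ℂ

/-- The parity of a matrix index: the first `n` are even, the last `m` are odd. -/
def idxParity (n m : ℕ) : Fin n ⊕ Fin m → ZMod 2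
  | Sum.inl _ => 0
  | Sum.inr _ => 1

/-- The homogeneous part of parity `k` of `gl(n|m)`: block diagonal matrices for `k = 0`, block
off-diagonal ones for `k = 1`. -/
def glPart (n m : ℕ) (k : ZMod 2) : Submodule ℂ (Gl n m) where
  carrier := {X | ∀ a b, X a b ≠ 0 → idxParity n m a + idxParity n m b = k}
  zero_mem' := fun _ _ h => absurd rfl h
  add_mem' := by
    intro X Y hX hY a b h
    by_cases hx : X a b = 0
    · by_cases hy : Y a b = 0
      · exact absurd (by simp [hx, hy]) h
      · exact hY a b hy
    · exact hX a b hx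
  smul_mem' := by
    intro c X hX a b h
    exact hX a b (fun h0 => h (by simp [h0]))

/-- The super-commutator `XY - (-1)^{ij} YX` of elements of parities `i` and `j`. -/
def superComm {R : Type*} [Ring R] (i j : ZMod 2) (X Y : R) : R :=
  X * Y - (-1) ^ (i.val * j.val) * (Y * X)

/-- The operator on `𝒜` by which the matrix unit `E_{a,b}` acts. -/
def unitAction (n m : ℕ) : Fin n ⊕ Fin m → Fin n ⊕ Fin m → Module.End ℂ (SuperPoly n m)
  | Sum.inl i, Sum.inl j =>
      mulBos n m (Sum.inl i) * dBos n m (Sum.inl j) - mulBos n m (Sum.inr j) * dBos n m (Sum.inr i)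
  | Sum.inl i, Sum.inr r =>
      mulBos n m (Sum.inl i) * dFerm n m (Sum.inl r) - mulFerm n m (Sum.inr r) * dBos n m (Sum.inr i)
  | Sum.inr r, Sum.inl i =>
      mulFerm n m (Sum.inl r) * dBos n m (Sum.inl i) + mulBos n m (Sum.inr i) * dFerm n m (Sum.inr r)
  | Sum.inr r, Sum.inr s =>
      mulFerm n m (Sum.inl r) * dFerm n m (Sum.inl s)
        - mulFerm n m (Sum.inr s) * dFerm n m (Sum.inr r)

/-- The linear action of `gl(n|m)` on `𝒜`. -/
def glAction (n m : ℕ) : Gl n m →ₗ[ℂ] Module.End ℂ (SuperPoly n m) :=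
  ∑ a, ∑ b, (Matrix.entryLinearMap ℂ ℂ a b).smulRight (unitAction n m a b)

/-- A linear map `ρ` from `gl(n|m)` to the operators on `𝒜` is a representation of the Lie
superalgebra: it respects parities and super-commutators. -/
structure IsSuperRepresentation {n m : ℕ} (ρ : Gl n m →ₗ[ℂ] Module.End ℂ (SuperPoly n m)) :
    Prop where
  parity : ∀ (i j : ZMod 2) (X : Gl n m) (f : SuperPoly n m),
    X ∈ glPart n m i → f ∈ parityPart n m j → ρ X f ∈ parityPart n m (i + j)
  bracket : ∀ (i j : ZMod 2) (X Y : Gl n m), X ∈ glPart n m i → Y ∈ glPart n m j →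
    ρ (superComm i j X Y) = superComm i j (ρ X) (ρ Y)

/-- `W` is a `gl(n|m)`-submodule of `𝒜`. -/
def IsGlSubmodule {n m : ℕ} (W : Submodule ℂ (SuperPoly n m)) : Prop :=
  ∀ (X : Gl n m), ∀ f ∈ W, glAction n m X f ∈ W

/-- `W` is an irreducible `gl(n|m)`-submodule of `𝒜`; in particular it is not zero. -/
def IsIrreducibleGl {n m : ℕ} (W : Submodule ℂ (SuperPoly n m)) : Prop :=
  IsGlSubmodule W ∧ W ≠ ⊥ ∧
    ∀ U : Submodule ℂ (SuperPoly n m), U ≤ W → IsGlSubmodule U → U = ⊥ ∨ U = W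

/-- The span `Θ₁` of the `θ_r`. -/
def thetaSpan (m : ℕ) : Submodule ℂ (FermPart m) :=
  Submodule.span ℂ (Set.range fun r : Fin m => fermGen m (Sum.inl r))

/-- The span `Θ₂` of the `ϑ_r`. -/
def varthetaSpan (m : ℕ) : Submodule ℂ (FermPart m) :=
  Submodule.span ℂ (Set.range fun r : Fin m => fermGen m (Sum.inr r))

/-- The bihomogeneous part `𝒜_{ℓ,ℓ'}`: the span of the `x^α y^β Θ₁^k Θ₂^{k'}` with
`|α| + k = ℓ` and `|β| + k' = ℓ'`. -/
def biHom (n m ℓ ℓ' : ℕ) : Submodule ℂ (SuperPoly n m) :=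
  Submodule.span ℂ
    {f | ∃ (γ : Bos n →₀ ℕ) (k k' : ℕ) (w : FermPart m),
      w ∈ thetaSpan m ^ k * varthetaSpan m ^ k' ∧
      (∑ i, γ (Sum.inl i)) + k = ℓ ∧ (∑ i, γ (Sum.inr i)) + k' = ℓ' ∧
      f = MvPolynomial.monomial γ 1 ⊗ₜ[ℂ] w}

/-- The super-Laplacian `Δ = ∑ ∂_{x_i} ∂_{y_i} + ∑ ∂_{θ_r} ∂_{ϑ_r}`. -/
def superLaplacian (n m : ℕ) : Module.End ℂ (SuperPoly n m) :=
  ∑ i, dBos n m (Sum.inl i) * dBos n m (Sum.inr i)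
    + ∑ r, dFerm n m (Sum.inl r) * dFerm n m (Sum.inr r)

/-- The invariant `η = ∑ x_i y_i + ∑ θ_r ϑ_r`. -/
def eta (n m : ℕ) : SuperPoly n m :=
  ∑ i, bosVar n m (Sum.inl i) * bosVar n m (Sum.inr i)
    + ∑ r, fermVar n m (Sum.inl r) * fermVar n m (Sum.inr r)

/-- The space `ℋ_{ℓ,ℓ'}` of bihomogeneous solutions of `Δ f = 0`. -/
def harm (n m ℓ ℓ' : ℕ) : Submodule ℂ (SuperPoly n m) :=
  biHom n m ℓ ℓ' ⊓ LinearMap.ker (superLaplacian n m)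

/-- The subspace `η^i ℋ_{k,k'}`. -/
def etaHarm (n m i k k' : ℕ) : Submodule ℂ (SuperPoly n m) :=
  (harm n m k k').map (LinearMap.mulLeft ℂ (eta n m ^ i))

end SuperHarmonic

end

/-! The operators of gl(n|m) commute with Δ and η, and [Δ, η] is the total degree plus the
superdimension n - m (`OscSystem.lap_unit`, `OscSystem.et_unit`, `OscSystem.lap_et`). Hence Δη^(i+1)
acts on a harmonic vector of bidegree (k, l) as (i+1)(k + l + i + n - m) η^i. Everything depends on
whether such factors vanish, that is, whether the number k + l + n - m - 1 is some N with 1 ≤ N ≤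
min(k, l). If not, the bidegree is nonsingular (`FockSystem.IsNonsingular`): Δη is then bijective
one step below, so that every vector is harmonic plus a multiple of η. If all bidegrees (k-i, l-i)
are nonsingular, the summands η^i ℋ span, and they lie in eigenspaces of ηΔ with distinct
eigenvalues.

Irreducibility rests on two ingredients. The first is a vector common to all nonzero submodules U of
ℋ. Take f in U killed by the raising operators, for a grading in which x_1 is strictly highest.
Expanding x_1 Δ f = 0 shows that a scalar multiple of ∂_{y_1} f vanishes
(`FockSystem.smul_d_inr_eq_zero`), and the scalar is not 0 if k > m + 1 - n or k + l ≤ m + 1 - n.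
Then f involves no y_1 and no x or θ variable other than x_1, and the remaining raising operators
force f to be a multiple of x_1^k y_n^l, or of x_1^k ϑ_1⋯ϑ_l if n = 1
(`FockSystem.exists_common_multidegree`). In the case n = 1 this needs l ≤ m, which is why ℋ
vanishes for k, l > m. The case l > m + 1 - n follows by exchanging x, θ with y, ϑ
(`FockSystem.swap`).

The second is a contravariant bilinear form B, nondegenerate in each bidegree, for which η is
adjoint to Δ and E_{ab} to E_{ba}, and B(v, v) ≠ 0 for every nonzero v homogeneous in each variable.
If U were proper, its orthogonal complement in ℋ would be a nonzero submodule, because ℋ meets the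
multiples of η trivially. It would contain the same v as U, contradicting B(v, v) ≠ 0
(`FockSystem.IsContravariant.isUnitIrreducible_harmonic`).

In a singular bidegree with parameter N, the space η^N ℋ_{k-N,l-N} consists of harmonic vectors. It
is nonzero when the source is, η being a sum of a regular element and a nilpotent one, and it is
proper because it is orthogonal to ℋ (`FockSystem.IsContravariant.not_isUnitIrreducible_harmonic`).

The argument uses only the commutation relations and a few properties of polynomial superalgebras,
collected in `OscSystem` and `FockSystem`; `SuperHarmonic.fockSystem` and `SuperHarmonic.superForm`
provide the concrete instance. -/

noncomputable section

/-! ### Oscillator systems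

The operators of multiplication by, and differentiation along, the variables of a polynomial
superalgebra, described by their supercommutation relations only. -/

/-- The sign `(-1)^{ij}` of the transposition of elements of parities `i` and `j`. -/
def superSign (i j : ZMod 2) : ℂ := (-1) ^ (i.val * j.val)

lemma ZMod.eq_zero_or_one_of_two (i : ZMod 2) : i = 0 ∨ i = 1 := by
  revert i; decide

@[simp] lemma superSign_zero_left (j : ZMod 2) : superSign 0 j = 1 := by simp [superSign]
@[simp] lemma superSign_zero_right (j : ZMod 2) : superSign j 0 = 1 := by simp [superSign]
@[simp] lemma superSign_one_one : superSign 1 1 = -1 := by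
  simp [superSign, ZMod.val_one]

lemma superSign_comm (i j : ZMod 2) : superSign i j = superSign j i := by
  simp [superSign, mul_comm]

lemma superSign_mul_self (i j : ZMod 2) : superSign i j * superSign i j = 1 := by
  rcases i.eq_zero_or_one_of_two with rfl | rfl <;> rcases j.eq_zero_or_one_of_two with rfl | rfl <;>
    simp

lemma superSign_add_left (i j k : ZMod 2) :
    superSign (i + j) k = superSign i k * superSign j k := by
  have : (1 + 1 : ZMod 2) = 0 := by decide
  rcases i.eq_zero_or_one_of_two with rfl | rfl <;> rcases j.eq_zero_or_one_of_two with rfl | rfl <;>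
    rcases k.eq_zero_or_one_of_two with rfl | rfl <;> simp [this]

lemma superSign_add_right (i j k : ZMod 2) :
    superSign k (i + j) = superSign k i * superSign k j := by
  rw [superSign_comm, superSign_add_left, superSign_comm i, superSign_comm j]

/-- The superdimension: the number of even indices minus the number of odd ones. -/
def superDim {α : Type*} [Fintype α] (p : α → ZMod 2) : ℂ := ∑ a, superSign (p a) (p a)

/-- The parity of a variable: `Sum.inl a` and `Sum.inr a` are a variable of parity `p a` and its
dual. -/
def varParity {α : Type*} (p : α → ZMod 2) : α ⊕ α → ZMod 2 := Sum.elim p p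

@[simp] lemma varParity_inl {α : Type*} (p : α → ZMod 2) (a : α) :
    varParity p (Sum.inl a) = p a := rfl
@[simp] lemma varParity_inr {α : Type*} (p : α → ZMod 2) (a : α) :
    varParity p (Sum.inr a) = p a := rfl

/-- Creation operators `c` and annihilation operators `d` indexed by variables of prescribed
parities, with their canonical supercommutation relations. -/
structure OscSystem {α : Type*} [DecidableEq α] (p : α → ZMod 2)
    (V : Type*) [AddCommGroup V] [Module ℂ V] where
  c : α ⊕ α → Module.End ℂ V
  d : α ⊕ α → Module.End ℂ V
  c_c : ∀ a b f, c a (c b f) = superSign (varParity p a) (varParity p b) • c b (c a f)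
  d_d : ∀ a b f, d a (d b f) = superSign (varParity p a) (varParity p b) • d b (d a f)
  d_c : ∀ a b f, d a (c b f) =
    superSign (varParity p a) (varParity p b) • c b (d a f) + if a = b then f else 0

namespace OscSystem

/-! ### Commutation relations of the bilinear operators and of the matrix units -/

section Relations

variable {α : Type*} [DecidableEq α] {p : α → ZMod 2} {V : Type*} [AddCommGroup V] [Module ℂ V]
  (S : OscSystem p V)

/-- The bilinear operator `c_a d_b`. -/
def quad (a b : α ⊕ α) : Module.End ℂ V := S.c a * S.d b

lemma quad_apply (a b : α ⊕ α) (f : V) : S.quad a b f = S.c a (S.d b f) := rfl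

/-- Normal ordering both products leaves the same quartic term c_a c_e d_b d_g up to sign, so only
the contractions survive. Thus the c_a d_b satisfy the relations of matrix units. -/
lemma quad_bracket (a b e g : α ⊕ α) (f : V) :
    S.quad a b (S.quad e g f) - superSign (varParity p a + varParity p b)
        (varParity p e + varParity p g) • S.quad e g (S.quad a b f) =
      (if b = e then S.quad a g f else 0) -
        superSign (varParity p a + varParity p b) (varParity p e + varParity p g) •
          (if g = a then S.quad e b f else 0) := by
  have key1 : S.quad a b (S.quad e g f) =
      superSign (varParity p b) (varParity p e) • S.c a (S.c e (S.d b (S.d g f))) +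
        if b = e then S.quad a g f else 0 := by
    simp only [quad_apply, S.d_c b e, map_add, map_smul]
    split_ifs <;> simp
  have key2 : S.quad e g (S.quad a b f) =
      (superSign (varParity p g) (varParity p a) * superSign (varParity p e) (varParity p a) *
        superSign (varParity p g) (varParity p b)) • S.c a (S.c e (S.d b (S.d g f))) +
        if g = a then S.quad e b f else 0 := by
    simp only [quad_apply, S.d_c g a, map_add, map_smul, S.c_c e a, S.d_d g b, smul_smul]
    split_ifs <;> simp [mul_right_comm]
  rw [key1, key2, smul_add, smul_smul, superSign_add_left, superSign_add_right,
    superSign_add_right, superSign_comm (varParity p g) (varParity p a),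
    superSign_comm (varParity p e) (varParity p a),
    superSign_comm (varParity p g) (varParity p b)]
  have h1 := superSign_mul_self (varParity p a) (varParity p e)
  have h2 := superSign_mul_self (varParity p a) (varParity p g)
  have h3 := superSign_mul_self (varParity p b) (varParity p g)
  -- The quartic terms cancel because every sign other than that of (b, e) occurs an even number of
  -- times.
  have : superSign (varParity p a) (varParity p e) * superSign (varParity p a) (varParity p g) *
      (superSign (varParity p b) (varParity p e) * superSign (varParity p b) (varParity p g)) *
      (superSign (varParity p a) (varParity p g) * superSign (varParity p a) (varParity p e) *
        superSign (varParity p b) (varParity p g)) = superSign (varParity p b) (varParity p e) := by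
    linear_combination (superSign (varParity p b) (varParity p e)) *
      (superSign (varParity p a) (varParity p g) * superSign (varParity p a) (varParity p g) *
      (superSign (varParity p b) (varParity p g) * superSign (varParity p b) (varParity p g)) * h1 +
      (superSign (varParity p b) (varParity p g) * superSign (varParity p b) (varParity p g)) * h2
      + h3)
  rw [this]
  abel

/-- The number operator `c_a d_a`. -/
def num (a : α ⊕ α) : Module.End ℂ V := S.quad a a

lemma num_apply (a : α ⊕ α) (f : V) : S.num a f = S.c a (S.d a f) := rfl

lemma num_c (a b : α ⊕ α) (f : V) :
    S.num a (S.c b f) = S.c b (S.num a f) + if a = b then S.c b f else 0 := by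
  simp only [num_apply, S.d_c a b, map_add, map_smul, S.c_c a b, smul_smul, superSign_mul_self]
  split_ifs with h
  · subst h; simp
  · simp

lemma num_d (a b : α ⊕ α) (f : V) :
    S.num a (S.d b f) = S.d b (S.num a f) - if a = b then S.d b f else 0 := by
  simp only [num_apply, S.d_c b a, S.d_d a b, map_smul,
    superSign_comm (varParity p b) (varParity p a)]
  split_ifs with h h' h'
  · subst h; simp
  · exact absurd h.symm h'
  · exact absurd h'.symm h
  · simp

lemma d_d_self (a : α ⊕ α) (h : varParity p a = 1) (f : V) : S.d a (S.d a f) = 0 := by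
  have h1 := S.d_d a a f
  rw [h, superSign_one_one, neg_one_smul, eq_neg_iff_add_eq_zero, ← two_smul ℂ] at h1
  exact (smul_eq_zero.mp h1).resolve_left two_ne_zero

lemma num_odd_idem (a : α ⊕ α) (h : varParity p a = 1) (f : V) :
    S.num a (S.num a f) = S.num a f := by
  simp [num_apply, S.d_c a a, S.d_d_self a h]

lemma d_num_odd (a : α ⊕ α) (h : varParity p a = 1) (f : V) :
    S.d a (S.num a f) = S.d a f := by
  simp [num_apply, S.d_c a a, S.d_d_self a h]

/-- The operator by which the matrix unit `E_{a,b}` acts. -/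
def unit (a b : α) : Module.End ℂ V :=
  S.quad (Sum.inl a) (Sum.inl b) -
    (superSign (p a) (p a) * superSign (p a) (p b)) • S.quad (Sum.inr b) (Sum.inr a)

lemma unit_apply (a b : α) (f : V) : S.unit a b f = S.c (Sum.inl a) (S.d (Sum.inl b) f) -
    (superSign (p a) (p a) * superSign (p a) (p b)) • S.c (Sum.inr b) (S.d (Sum.inr a) f) := rfl

lemma unit_self (a : α) (f : V) :
    S.unit a a f = S.num (Sum.inl a) f - S.num (Sum.inr a) f := by
  simp [unit_apply, superSign_mul_self, num_apply]

/-- A matrix unit acts as c_a d_b on one half of the variables and by its negative supertranspose on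
the dual half. The halves supercommute, so the bracket is computed in each separately by
`quad_bracket`. -/
lemma unit_bracket (a b e g : α) (f : V) :
    S.unit a b (S.unit e g f) - superSign (p a + p b) (p e + p g) • S.unit e g (S.unit a b f) =
      (if b = e then S.unit a g f else 0) -
        superSign (p a + p b) (p e + p g) • (if g = a then S.unit e b f else 0) := by
  have h1 := S.quad_bracket (Sum.inl a) (Sum.inl b) (Sum.inl e) (Sum.inl g) f
  have h2 := S.quad_bracket (Sum.inl a) (Sum.inl b) (Sum.inr g) (Sum.inr e) f
  have h3 := S.quad_bracket (Sum.inr b) (Sum.inr a) (Sum.inl e) (Sum.inl g) f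
  have h4 := S.quad_bracket (Sum.inr b) (Sum.inr a) (Sum.inr g) (Sum.inr e) f
  simp only [varParity_inl, varParity_inr, Sum.inl.injEq, Sum.inr.injEq, reduceCtorEq, if_false,
    smul_zero, sub_zero] at h1 h2 h3 h4
  have e1 : S.unit a b (S.unit e g f) - superSign (p a + p b) (p e + p g) •
      S.unit e g (S.unit a b f) =
      ((if b = e then S.quad (Sum.inl a) (Sum.inl g) f else 0) -
        superSign (p a + p b) (p e + p g) •
          (if g = a then S.quad (Sum.inl e) (Sum.inl b) f else 0)) +
      (superSign (p a) (p a) * superSign (p a) (p b) *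
        (superSign (p e) (p e) * superSign (p e) (p g))) •
      ((if a = g then S.quad (Sum.inr b) (Sum.inr e) f else 0) -
        superSign (p a + p b) (p e + p g) •
          (if e = b then S.quad (Sum.inr g) (Sum.inr a) f else 0)) := by
    rw [add_comm (p b) (p a), add_comm (p g) (p e)] at h4
    rw [add_comm (p b) (p a)] at h3
    rw [add_comm (p g) (p e)] at h2
    rw [← h1, ← h4]
    have h2' := sub_eq_zero.mp h2
    have h3' := sub_eq_zero.mp h3
    simp only [unit, LinearMap.sub_apply, LinearMap.smul_apply, map_sub, map_smul, h2', h3']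
    module
  rw [e1]
  have t : (1 + 1 : ZMod 2) = 0 := by decide
  by_cases hb : b = e <;> by_cases ha : g = a
  · subst hb ha
    rcases (p g).eq_zero_or_one_of_two with h | h <;>
    rcases (p b).eq_zero_or_one_of_two with h' | h' <;>
    simp [h, h', t, unit] <;> abel
  · have ha' : ¬ a = g := fun h => ha h.symm
    subst hb
    simp only [if_pos, if_neg ha, if_neg ha']
    rcases (p a).eq_zero_or_one_of_two with h | h <;>
    rcases (p b).eq_zero_or_one_of_two with h' | h' <;>
    rcases (p g).eq_zero_or_one_of_two with h'' | h'' <;>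
    simp [h, h', h'', t, unit] <;> abel
  · have hb' : ¬ e = b := fun h => hb h.symm
    subst ha
    simp only [if_pos, if_neg hb, if_neg hb']
    rcases (p g).eq_zero_or_one_of_two with h | h <;>
    rcases (p b).eq_zero_or_one_of_two with h' | h' <;>
    rcases (p e).eq_zero_or_one_of_two with h'' | h'' <;>
    simp [h, h', h'', t, unit] <;> abel
  · have ha' : ¬ a = g := fun h => ha h.symm
    have hb' : ¬ e = b := fun h => hb h.symm
    simp [ha, hb, ha', hb']

lemma unit_self_unit (a e g : α) (f : V) :
    S.unit a a (S.unit e g f) = S.unit e g (S.unit a a f) +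
      ((if a = e then 1 else 0) - (if a = g then 1 else 0) : ℂ) • S.unit e g f := by
  have t : p a + p a = 0 := by
    rcases (p a).eq_zero_or_one_of_two with h | h <;> rw [h] <;> decide
  have h := S.unit_bracket a a e g f
  rw [t] at h
  simp only [superSign_zero_left, one_smul] at h
  rw [sub_eq_iff_eq_add.mp h]
  by_cases h1 : a = e <;> by_cases h2 : a = g
  · subst h1 h2; simp
  · subst h1; simp [h2, Ne.symm h2, add_comm]
  · subst h2; simp [h1]; abel
  · simp [h1, h2, Ne.symm h2]

end Relations

/-! ### Degrees, Laplacian and invariant, and their commutation with the matrix units -/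

section Finite

variable {α : Type*} [DecidableEq α] [Fintype α] {p : α → ZMod 2}
  {V : Type*} [AddCommGroup V] [Module ℂ V] (S : OscSystem p V)

/-- The degree in the variables `Sum.inl a`. -/
def degL : Module.End ℂ V := ∑ a, S.num (Sum.inl a)

/-- The degree in the variables `Sum.inr a`. -/
def degR : Module.End ℂ V := ∑ a, S.num (Sum.inr a)

/-- The Laplacian `∑ d_a d_a'`. -/
def lap : Module.End ℂ V := ∑ a, S.d (Sum.inl a) * S.d (Sum.inr a)

/-- Multiplication by the invariant `∑ c_a c_a'`. -/
def et : Module.End ℂ V := ∑ a, S.c (Sum.inl a) * S.c (Sum.inr a)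

lemma degL_apply (f : V) : S.degL f = ∑ a, S.num (Sum.inl a) f := by
  simp [degL, LinearMap.sum_apply]

lemma degR_apply (f : V) : S.degR f = ∑ a, S.num (Sum.inr a) f := by
  simp [degR, LinearMap.sum_apply]

lemma lap_apply (f : V) : S.lap f = ∑ a, S.d (Sum.inl a) (S.d (Sum.inr a) f) := by
  simp [lap, LinearMap.sum_apply]

lemma et_apply (f : V) : S.et f = ∑ a, S.c (Sum.inl a) (S.c (Sum.inr a) f) := by
  simp [et, LinearMap.sum_apply]

lemma degL_c_inl (a : α) (f : V) :
    S.degL (S.c (Sum.inl a) f) = S.c (Sum.inl a) (S.degL f) + S.c (Sum.inl a) f := by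
  simp [degL_apply, num_c, Finset.sum_add_distrib]

lemma degL_c_inr (a : α) (f : V) : S.degL (S.c (Sum.inr a) f) = S.c (Sum.inr a) (S.degL f) := by
  simp [degL_apply, num_c]

lemma degL_d_inl (a : α) (f : V) :
    S.degL (S.d (Sum.inl a) f) = S.d (Sum.inl a) (S.degL f) - S.d (Sum.inl a) f := by
  simp [degL_apply, num_d, Finset.sum_sub_distrib]

lemma degL_d_inr (a : α) (f : V) : S.degL (S.d (Sum.inr a) f) = S.d (Sum.inr a) (S.degL f) := by
  simp [degL_apply, num_d]

lemma degR_c_inr (a : α) (f : V) :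
    S.degR (S.c (Sum.inr a) f) = S.c (Sum.inr a) (S.degR f) + S.c (Sum.inr a) f := by
  simp [degR_apply, num_c, Finset.sum_add_distrib]

lemma degR_c_inl (a : α) (f : V) : S.degR (S.c (Sum.inl a) f) = S.c (Sum.inl a) (S.degR f) := by
  simp [degR_apply, num_c]

lemma degR_d_inr (a : α) (f : V) :
    S.degR (S.d (Sum.inr a) f) = S.d (Sum.inr a) (S.degR f) - S.d (Sum.inr a) f := by
  simp [degR_apply, num_d, Finset.sum_sub_distrib]

lemma degR_d_inl (a : α) (f : V) : S.degR (S.d (Sum.inl a) f) = S.d (Sum.inl a) (S.degR f) := by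
  simp [degR_apply, num_d]

lemma lap_d (b : α ⊕ α) (f : V) : S.lap (S.d b f) = S.d b (S.lap f) := by
  simp only [lap_apply, map_sum]
  refine Finset.sum_congr rfl fun a _ => ?_
  rw [S.d_d (Sum.inr a) b, map_smul, S.d_d (Sum.inl a) b, smul_smul]
  simp [superSign_mul_self]

lemma lap_c_inl (a : α) (f : V) : S.lap (S.c (Sum.inl a) f) =
    S.c (Sum.inl a) (S.lap f) + superSign (p a) (p a) • S.d (Sum.inr a) f := by
  have : ∀ k, S.d (Sum.inl k) (S.d (Sum.inr k) (S.c (Sum.inl a) f)) =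
      S.c (Sum.inl a) (S.d (Sum.inl k) (S.d (Sum.inr k) f)) +
        if k = a then superSign (p a) (p a) • S.d (Sum.inr a) f else 0 := by
    intro k
    rw [S.d_c (Sum.inr k)]
    simp only [varParity_inr, varParity_inl, reduceCtorEq, if_false, add_zero, map_smul, S.d_c,
      smul_add, smul_smul, superSign_mul_self, one_smul, Sum.inl.injEq]
    split_ifs with h
    · subst h; rfl
    · simp
  simp [lap_apply, this, Finset.sum_add_distrib]

lemma lap_c_inr (a : α) (f : V) : S.lap (S.c (Sum.inr a) f) =
    S.c (Sum.inr a) (S.lap f) + S.d (Sum.inl a) f := by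
  have : ∀ k, S.d (Sum.inl k) (S.d (Sum.inr k) (S.c (Sum.inr a) f)) =
      S.c (Sum.inr a) (S.d (Sum.inl k) (S.d (Sum.inr k) f)) +
        if k = a then S.d (Sum.inl a) f else 0 := by
    intro k
    rw [S.d_c (Sum.inr k)]
    simp only [varParity_inr, varParity_inl, map_smul, S.d_c, map_add,
      smul_smul, superSign_mul_self, one_smul, Sum.inr.injEq, reduceCtorEq, if_false,
      add_zero]
    split_ifs with h
    · subst h; rfl
    · simp
  simp [lap_apply, this, Finset.sum_add_distrib]

lemma et_c (b : α ⊕ α) (f : V) : S.et (S.c b f) = S.c b (S.et f) := by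
  simp only [et_apply, map_sum]
  refine Finset.sum_congr rfl fun a _ => ?_
  rw [S.c_c (Sum.inr a) b, map_smul, S.c_c (Sum.inl a) b, smul_smul]
  simp [superSign_mul_self]

lemma d_inl_et (a : α) (f : V) : S.d (Sum.inl a) (S.et f) =
    S.et (S.d (Sum.inl a) f) + S.c (Sum.inr a) f := by
  have : ∀ k, S.d (Sum.inl a) (S.c (Sum.inl k) (S.c (Sum.inr k) f)) =
      S.c (Sum.inl k) (S.c (Sum.inr k) (S.d (Sum.inl a) f)) +
        if a = k then S.c (Sum.inr a) f else 0 := by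
    intro k
    rw [S.d_c (Sum.inl a)]
    simp only [varParity_inr, varParity_inl, map_smul, S.d_c,
      smul_smul, superSign_mul_self, one_smul, Sum.inl.injEq, reduceCtorEq, if_false,
      add_zero]
    split_ifs with h
    · subst h; rfl
    · simp
  simp [et_apply, this, Finset.sum_add_distrib]

lemma d_inr_et (a : α) (f : V) : S.d (Sum.inr a) (S.et f) =
    S.et (S.d (Sum.inr a) f) + superSign (p a) (p a) • S.c (Sum.inl a) f := by
  have : ∀ k, S.d (Sum.inr a) (S.c (Sum.inl k) (S.c (Sum.inr k) f)) =
      S.c (Sum.inl k) (S.c (Sum.inr k) (S.d (Sum.inr a) f)) +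
        if a = k then superSign (p a) (p a) • S.c (Sum.inl a) f else 0 := by
    intro k
    rw [S.d_c (Sum.inr a)]
    simp only [varParity_inr, varParity_inl, reduceCtorEq, if_false, add_zero, map_smul, S.d_c,
      smul_add, smul_smul, superSign_mul_self, one_smul, Sum.inr.injEq, map_add]
    split_ifs with h
    · subst h; rfl
    · simp
  simp [et_apply, this, Finset.sum_add_distrib]

lemma degL_unit (a b : α) (f : V) : S.degL (S.unit a b f) = S.unit a b (S.degL f) := by
  simp [unit_apply, degL_c_inl, degL_c_inr, degL_d_inl, degL_d_inr]

lemma degR_unit (a b : α) (f : V) : S.degR (S.unit a b f) = S.unit a b (S.degR f) := by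
  simp [unit_apply, degR_c_inl, degR_c_inr, degR_d_inl, degR_d_inr]

/-- Moving the Laplacian past either half of E_{ab} produces one extra term in d_{a'} d_b; the sign
in the definition of `unit` makes the two cancel. -/
lemma lap_unit (a b : α) (f : V) : S.lap (S.unit a b f) = S.unit a b (S.lap f) := by
  simp only [unit_apply, lap_c_inl, lap_c_inr, lap_d, map_sub, map_smul, smul_add]
  rw [S.d_d (Sum.inl b) (Sum.inr a), smul_smul]
  have : superSign (p a) (p a) * superSign (p a) (p b) * superSign (p b) (p a) =
      superSign (p a) (p a) := by
    rw [mul_assoc, superSign_comm (p b) (p a), superSign_mul_self, mul_one]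
  simp only [varParity_inl, varParity_inr, this]
  abel

lemma et_unit (a b : α) (f : V) : S.et (S.unit a b f) = S.unit a b (S.et f) := by
  simp only [unit_apply, d_inl_et, d_inr_et, map_add, map_smul, smul_add, et_c, map_sub]
  rw [S.c_c (Sum.inl a) (Sum.inr b), smul_smul]
  have : superSign (p a) (p a) * superSign (p a) (p b) * superSign (p a) (p a) =
      superSign (p a) (p b) := by
    rw [mul_comm, ← mul_assoc, superSign_mul_self, one_mul]
  simp only [varParity_inl, varParity_inr, this]
  abel

/-- The sl₂ relation behind every eigenvalue below. The superdimension collects the constants left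
when d_{a'} is moved past c_{a'}. -/
lemma lap_et (f : V) :
    S.lap (S.et f) = S.et (S.lap f) + S.degL f + S.degR f + superDim p • f := by
  have : ∀ a, S.d (Sum.inl a) (S.d (Sum.inr a) (S.et f)) =
      S.et (S.d (Sum.inl a) (S.d (Sum.inr a) f)) + S.num (Sum.inl a) f + S.num (Sum.inr a) f +
        superSign (p a) (p a) • f := by
    intro a
    rw [d_inr_et, map_add, d_inl_et, map_smul, S.d_c]
    simp only [varParity_inl, if_true, smul_add, smul_smul, superSign_mul_self, one_smul, num_apply]
    abel
  simp only [S.lap_apply (S.et f), this, Finset.sum_add_distrib]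
  rw [S.lap_apply, map_sum, degL_apply, degR_apply, superDim, Finset.sum_smul]

end Finite

end OscSystem
end

/-! ### Fock systems -/

noncomputable section

/-- An oscillator system on a space which looks like a polynomial superalgebra: even creation
operators are injective, degrees are not negative, and the vacuum is unique. -/
structure FockSystem {α : Type*} [DecidableEq α] [Fintype α] (p : α → ZMod 2)
    (V : Type*) [AddCommGroup V] [Module ℂ V] extends OscSystem p V where
  c_injective : ∀ a, varParity p a = 0 → Function.Injective (c a)
  eq_zero_of_degL : ∀ f, toOscSystem.degL f = -f → f = 0
  eq_zero_of_degR : ∀ f, toOscSystem.degR f = -f → f = 0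
  vac : V
  vac_ne_zero : vac ≠ 0
  degL_vac : toOscSystem.degL vac = 0
  degR_vac : toOscSystem.degR vac = 0
  eq_smul_vac : ∀ f, toOscSystem.degL f = 0 → toOscSystem.degR f = 0 → ∃ t : ℂ, f = t • vac

namespace FockSystem

variable {α : Type*} [DecidableEq α] [Fintype α] {p : α → ZMod 2}
  {V : Type*} [AddCommGroup V] [Module ℂ V] (S : FockSystem p V)

/-! ### Bihomogeneous parts -/

/-- The part of bidegree `(k, l)`. -/
def homog (k l : ℕ) : Submodule ℂ V :=
  Module.End.eigenspace S.degL (k : ℂ) ⊓ Module.End.eigenspace S.degR (l : ℂ)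

lemma mem_homog {k l : ℕ} {f : V} :
    f ∈ S.homog k l ↔ S.degL f = (k : ℂ) • f ∧ S.degR f = (l : ℂ) • f := by
  simp [homog]

lemma d_inl_mem {k l : ℕ} {f : V} (h : f ∈ S.homog (k + 1) l) (a : α) :
    S.d (Sum.inl a) f ∈ S.homog k l := by
  rw [mem_homog] at h ⊢
  rw [S.degL_d_inl, S.degR_d_inl, h.1, h.2]
  refine ⟨?_, by simp⟩
  push_cast
  rw [map_smul]
  module

lemma d_inr_mem {k l : ℕ} {f : V} (h : f ∈ S.homog k (l + 1)) (a : α) :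
    S.d (Sum.inr a) f ∈ S.homog k l := by
  rw [mem_homog] at h ⊢
  rw [S.degL_d_inr, S.degR_d_inr, h.1, h.2]
  refine ⟨by simp, ?_⟩
  push_cast
  rw [map_smul]
  module

lemma d_inl_eq_zero {l : ℕ} {f : V} (h : f ∈ S.homog 0 l) (a : α) : S.d (Sum.inl a) f = 0 := by
  rw [mem_homog] at h
  apply S.eq_zero_of_degL
  simp [S.degL_d_inl, h.1]

lemma d_inr_eq_zero {k : ℕ} {f : V} (h : f ∈ S.homog k 0) (a : α) : S.d (Sum.inr a) f = 0 := by
  rw [mem_homog] at h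
  apply S.eq_zero_of_degR
  simp [S.degR_d_inr, h.2]

lemma c_inl_mem {k l : ℕ} {f : V} (h : f ∈ S.homog k l) (a : α) :
    S.c (Sum.inl a) f ∈ S.homog (k + 1) l := by
  rw [mem_homog] at h ⊢
  rw [S.degL_c_inl, S.degR_c_inl, h.1, h.2]
  refine ⟨?_, by simp⟩
  push_cast
  rw [map_smul]
  module

lemma c_inr_mem {k l : ℕ} {f : V} (h : f ∈ S.homog k l) (a : α) :
    S.c (Sum.inr a) f ∈ S.homog k (l + 1) := by
  rw [mem_homog] at h ⊢
  rw [S.degL_c_inr, S.degR_c_inr, h.1, h.2]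
  refine ⟨by simp, ?_⟩
  push_cast
  rw [map_smul]
  module

lemma lap_mem {k l : ℕ} {f : V} (h : f ∈ S.homog (k + 1) (l + 1)) : S.lap f ∈ S.homog k l := by
  rw [S.lap_apply]
  exact Submodule.sum_mem _ fun a _ => S.d_inl_mem (S.d_inr_mem h a) a

lemma lap_eq_zero_left {l : ℕ} {f : V} (h : f ∈ S.homog 0 l) : S.lap f = 0 := by
  rw [S.lap_apply]
  refine Finset.sum_eq_zero fun a _ => ?_
  rw [S.d_d, S.d_inl_eq_zero h, map_zero, smul_zero]

lemma lap_eq_zero_right {k : ℕ} {f : V} (h : f ∈ S.homog k 0) : S.lap f = 0 := by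
  rw [S.lap_apply]
  refine Finset.sum_eq_zero fun a _ => ?_
  rw [S.d_inr_eq_zero h, map_zero]

lemma et_mem {k l : ℕ} {f : V} (h : f ∈ S.homog k l) : S.et f ∈ S.homog (k + 1) (l + 1) := by
  rw [S.et_apply]
  exact Submodule.sum_mem _ fun a _ => S.c_inl_mem (S.c_inr_mem h a) a

lemma unit_mem {k l : ℕ} {f : V} (h : f ∈ S.homog k l) (a b : α) :
    S.unit a b f ∈ S.homog k l := by
  rw [mem_homog] at h ⊢
  simp [S.degL_unit, S.degR_unit, h.1, h.2]

lemma eq_smul_vac_of_mem {f : V} (h : f ∈ S.homog 0 0) : ∃ t : ℂ, f = t • S.vac := by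
  rw [mem_homog] at h
  exact S.eq_smul_vac f (by simp [h.1]) (by simp [h.2])

/-- Euler's identity: the degree operators are sums of c_a d_a. This is the base of the inductions
on total degree. -/
lemma eq_zero_of_d_eq_zero {k l : ℕ} {f : V} (h : f ∈ S.homog k l) (hkl : 0 < k + l)
    (hd : ∀ a, S.d a f = 0) : f = 0 := by
  rw [mem_homog, S.degL_apply, S.degR_apply] at h
  simp only [OscSystem.num_apply, hd, map_zero, Finset.sum_const_zero] at h
  rcases Nat.eq_zero_or_pos k with hk | hk
  · have : (l : ℂ) ≠ 0 := by exact_mod_cast (by omega : l ≠ 0)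
    exact (smul_eq_zero.mp h.2.symm).resolve_left this
  · have : (k : ℂ) ≠ 0 := by exact_mod_cast (by omega : k ≠ 0)
    exact (smul_eq_zero.mp h.1.symm).resolve_left this

lemma exists_finiteDimensional_d_mem {k l : ℕ}
    (ih : ∀ k' l', k' + l' < k + l → FiniteDimensional ℂ (S.homog k' l')) (a : α ⊕ α) :
    ∃ W : Submodule ℂ V, FiniteDimensional ℂ W ∧ ∀ f ∈ S.homog k l, S.d a f ∈ W := by
  rcases a with a | a
  · rcases k with _ | k
    · exact ⟨⊥, inferInstance, fun f hf => by simp [S.d_inl_eq_zero hf]⟩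
    · exact ⟨S.homog k l, ih _ _ (by omega), fun f hf => S.d_inl_mem hf a⟩
  · rcases l with _ | l
    · exact ⟨⊥, inferInstance, fun f hf => by simp [S.d_inr_eq_zero hf]⟩
    · exact ⟨S.homog k l, ih _ _ (by omega), fun f hf => S.d_inr_mem hf a⟩

/-- In positive degree a vector is determined by all its partial derivatives, which lie in spaces of
lower degree; degree zero is the line of the vacuum. -/
instance finiteDimensional_homog (k l : ℕ) : FiniteDimensional ℂ (S.homog k l) := by
  induction hN : k + l using Nat.strong_induction_on generalizing k l with
  | _ N ih =>
    rcases Nat.eq_zero_or_pos N with h0 | h0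
    · obtain ⟨rfl, rfl⟩ : k = 0 ∧ l = 0 := by omega
      have : S.homog 0 0 ≤ Submodule.span ℂ {S.vac} := by
        intro f hf
        obtain ⟨t, rfl⟩ := S.eq_smul_vac_of_mem hf
        exact Submodule.smul_mem _ _ (Submodule.mem_span_singleton_self _)
      exact Submodule.finiteDimensional_of_le this
    · choose W hW hdW using S.exists_finiteDimensional_d_mem (k := k) (l := l)
        fun k' l' h => ih (k' + l') (by omega) k' l' rfl
      let φ : S.homog k l →ₗ[ℂ] ((a : α ⊕ α) → W a) :=
        LinearMap.pi fun a => (S.d a).restrict (hdW a)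
      have hφ : Function.Injective φ := by
        rw [injective_iff_map_eq_zero]
        rintro ⟨f, hf⟩ h
        rw [Submodule.mk_eq_zero]
        refine S.eq_zero_of_d_eq_zero hf (by omega) fun a => ?_
        have := congrArg (Subtype.val) (congrFun h a)
        simpa [φ] using this
      exact FiniteDimensional.of_injective φ hφ

/-! ### Vectors with prescribed degrees in all variables -/

/-- An even c_a is injective. An odd one is not, but there d_a c_a d_a = d_a. -/
lemma d_eq_zero_of_num {a : α ⊕ α} {f : V} (h : S.num a f = 0) : S.d a f = 0 := by
  rcases (varParity p a).eq_zero_or_one_of_two with h' | h'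
  · exact S.c_injective a h' (by rw [map_zero]; exact h)
  · rw [← S.d_num_odd a h', h, map_zero]

/-- `f` is homogeneous of degree `ν a` in the variable `a`, for all `a`. -/
def IsMultihomog (ν : α ⊕ α → ℕ) (f : V) : Prop := ∀ a, S.num a f = (ν a : ℂ) • f

lemma IsMultihomog.mem_homog {S : FockSystem p V} {ν : α ⊕ α → ℕ} {f : V}
    (h : S.IsMultihomog ν f) :
    f ∈ S.homog (∑ a, ν (Sum.inl a)) (∑ a, ν (Sum.inr a)) := by
  rw [FockSystem.mem_homog, S.degL_apply, S.degR_apply]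
  simp [h _, Finset.sum_smul]

lemma IsMultihomog.d {S : FockSystem p V} {ν : α ⊕ α → ℕ} {a : α ⊕ α} {f : V}
    (h : S.IsMultihomog (ν + Pi.single a 1) f) : S.IsMultihomog ν (S.d a f) := by
  intro b
  rw [S.num_d, h b, map_smul]
  by_cases hb : b = a
  · subst hb
    simp [add_smul]
  · simp [hb]

lemma IsMultihomog.c {S : FockSystem p V} {ν : α ⊕ α → ℕ} {f : V}
    (h : S.IsMultihomog ν f) (a : α ⊕ α) : S.IsMultihomog (ν + Pi.single a 1) (S.c a f) := by
  intro b
  rw [S.num_c, h b, map_smul]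
  by_cases hb : b = a
  · subst hb
    simp [add_smul]
  · simp [hb]

lemma IsMultihomog.d_ne_zero {S : FockSystem p V} {ν : α ⊕ α → ℕ} {a : α ⊕ α} {f : V}
    (h : S.IsMultihomog ν f) (hf : f ≠ 0) (ha : ν a ≠ 0) : S.d a f ≠ 0 := by
  intro h0
  have h1 := h a
  rw [S.num_apply, h0, map_zero] at h1
  exact hf ((smul_eq_zero.mp h1.symm).resolve_left (by exact_mod_cast ha))

/-- Induction on multidegrees, one variable at a time. -/
lemma multidegree_induction {β : Type*} [Fintype β] [DecidableEq β] {P : (β → ℕ) → Prop}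
    (zero : P 0) (add : ∀ ν a, P ν → P (ν + Pi.single a 1)) (ν : β → ℕ) : P ν := by
  induction hN : ∑ a, ν a generalizing ν with
  | zero =>
    have : ν = 0 := by
      funext a
      exact (Finset.sum_eq_zero_iff.mp hN) a (Finset.mem_univ a)
    exact this ▸ zero
  | succ N ih =>
    obtain ⟨a, ha⟩ : ∃ a, ν a ≠ 0 := by
      by_contra! h
      simp [h] at hN
    have h1 : Function.update ν a (ν a - 1) + Pi.single a 1 = ν := by
      funext b
      by_cases hb : b = a
      · subst hb; simp; omega
      · simp [hb]
    have h2 : ∑ b, (Function.update ν a (ν a - 1) + Pi.single a 1 : β → ℕ) b = N + 1 := by rw [h1, hN]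
    rw [← h1]
    refine add _ _ (ih _ ?_)
    simp only [Pi.add_apply, Finset.sum_add_distrib, Finset.sum_pi_single', Finset.mem_univ,
      if_true] at h2
    omega

lemma isMultihomog_vac : S.IsMultihomog 0 S.vac := by
  have h : S.vac ∈ S.homog 0 0 := by simp [FockSystem.mem_homog, S.degL_vac, S.degR_vac]
  rintro (a | a)
  · simp [S.num_apply, S.d_inl_eq_zero h]
  · simp [S.num_apply, S.d_inr_eq_zero h]

/-- The monomials, built up from the vacuum. If c_a f = 0 for an odd a absent from f, the relation
d_a c_a + c_a d_a = 1 would give f = 0. -/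
lemma exists_isMultihomog (ν : α ⊕ α → ℕ) (hν : ∀ a, varParity p a = 1 → ν a ≤ 1) :
    ∃ f, f ≠ 0 ∧ S.IsMultihomog ν f := by
  induction ν using multidegree_induction with
  | zero => exact ⟨S.vac, S.vac_ne_zero, S.isMultihomog_vac⟩
  | add ν a ih =>
    obtain ⟨f, hf, h⟩ := ih fun b hb => le_trans (by simp) (hν b hb)
    refine ⟨S.c a f, fun h0 => hf ?_, h.c a⟩
    rcases (varParity p a).eq_zero_or_one_of_two with h' | h'
    · exact S.c_injective a h' (by rw [h0, map_zero])
    · have h1 : ν a = 0 := by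
        have := hν a h'
        simpa using this
      have h2 : S.num a f = 0 := by simp [h a, h1]
      have h3 := S.d_c a a f
      simpa [h0, S.d_eq_zero_of_num h2] using h3.symm

/-- Multidegrees have multiplicity one: both vectors are recovered from d_a f and d_a g, which are
proportional by induction, through c_a d_a = ν_a. -/
lemma IsMultihomog.exists_eq_smul {S : FockSystem p V} {ν : α ⊕ α → ℕ} {f g : V}
    (hf : S.IsMultihomog ν f) (hf0 : f ≠ 0) (hg : S.IsMultihomog ν g) : ∃ t : ℂ, g = t • f := by
  induction ν using multidegree_induction generalizing f g with
  | zero =>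
    obtain ⟨t, ht⟩ := S.eq_smul_vac_of_mem (by simpa using hf.mem_homog)
    obtain ⟨s, hs⟩ := S.eq_smul_vac_of_mem (by simpa using hg.mem_homog)
    have : t ≠ 0 := fun h => hf0 (by simp [ht, h])
    exact ⟨s * t⁻¹, by rw [ht, smul_smul, mul_assoc, inv_mul_cancel₀ this, mul_one, hs]⟩
  | add ν a ih =>
    obtain ⟨t, ht⟩ := ih hf.d (hf.d_ne_zero hf0 (by simp)) hg.d
    refine ⟨t, ?_⟩
    have h0 : ((ν + Pi.single a 1 : α ⊕ α → ℕ) a : ℂ) ≠ 0 := by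
      simp only [Pi.add_apply, Pi.single_eq_same]
      exact_mod_cast Nat.succ_ne_zero (ν a)
    apply smul_right_injective V h0
    change _ • g = _ • (t • f)
    rw [← hg a, smul_comm, ← hf a, S.num_apply, S.num_apply, ht, map_smul]

/-! ### Contravariant forms -/

/-- A bilinear form for which annihilation operators are, up to sign, adjoint to creation
operators. -/
structure IsContravariant (B : V →ₗ[ℂ] V →ₗ[ℂ] ℂ) : Prop where
  c_inl : ∀ a f g, B (S.c (Sum.inl a) f) g = B f (S.d (Sum.inl a) g)
  c_inr : ∀ a f g, B (S.c (Sum.inr a) f) g = superSign (p a) (p a) * B f (S.d (Sum.inr a) g)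
  d_inl : ∀ a f g, B (S.d (Sum.inl a) f) g = B f (S.c (Sum.inl a) g)
  d_inr : ∀ a f g, B (S.d (Sum.inr a) f) g = superSign (p a) (p a) * B f (S.c (Sum.inr a) g)
  vac : B S.vac S.vac ≠ 0

namespace IsContravariant

variable {S} {B : V →ₗ[ℂ] V →ₗ[ℂ] ℂ} (hB : S.IsContravariant B)
include hB

/-- Taking adjoints reverses the order of the two factors; the sign attached to the dual variables
compensates for this when the variables are odd. -/
lemma lap (f g : V) : B (S.lap f) g = B f (S.et g) := by
  rw [S.lap_apply, S.et_apply]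
  simp only [map_sum, LinearMap.sum_apply]
  refine Finset.sum_congr rfl fun a _ => ?_
  rw [hB.d_inl, hB.d_inr, S.c_c (Sum.inl a)]
  simp

lemma et (f g : V) : B (S.et f) g = B f (S.lap g) := by
  rw [S.lap_apply, S.et_apply]
  simp only [map_sum, LinearMap.sum_apply]
  refine Finset.sum_congr rfl fun a _ => ?_
  rw [hB.c_inl, hB.c_inr, S.d_d (Sum.inl a)]
  simp

lemma unit (a b : α) (f g : V) : B (S.unit a b f) g = B f (S.unit b a g) := by
  rw [S.unit_apply, S.unit_apply, map_sub, map_sub, map_smul, map_smul, LinearMap.sub_apply,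
    LinearMap.smul_apply, hB.c_inl, hB.d_inl, hB.c_inr, hB.d_inr, smul_eq_mul, smul_eq_mul,
    superSign_comm (p b) (p a)]
  linear_combination (- superSign (p a) (p b) * superSign (p b) (p b) *
    B f (S.c (Sum.inr a) (S.d (Sum.inr b) g))) * superSign_mul_self (p a) (p a)

/-- Nondegeneracy in each bidegree: a vector in the radical has its derivatives in the radical one
degree lower, by adjointness. -/
lemma eq_zero_of_forall {k l : ℕ} {f : V} (hf : f ∈ S.homog k l)
    (h : ∀ g ∈ S.homog k l, B f g = 0) : f = 0 := by
  induction hN : k + l using Nat.strong_induction_on generalizing k l f with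
  | _ N ih =>
    rcases Nat.eq_zero_or_pos N with h0 | h0
    · obtain ⟨rfl, rfl⟩ : k = 0 ∧ l = 0 := by omega
      obtain ⟨t, rfl⟩ := S.eq_smul_vac_of_mem hf
      have h1 := h S.vac (by simpa using S.isMultihomog_vac.mem_homog)
      rw [map_smul, LinearMap.smul_apply] at h1
      rw [(smul_eq_zero.mp h1).resolve_right hB.vac, zero_smul]
    · refine S.eq_zero_of_d_eq_zero hf (by omega) ?_
      rintro (a | a)
      · rcases k with _ | k
        · exact S.d_inl_eq_zero hf a
        · refine ih (k + l) (by omega) (S.d_inl_mem hf a) (fun g hg => ?_) rfl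
          rw [hB.d_inl, h _ (S.c_inl_mem hg a)]
      · rcases l with _ | l
        · exact S.d_inr_eq_zero hf a
        · refine ih (k + l) (by omega) (S.d_inr_mem hf a) (fun g hg => ?_) rfl
          rw [hB.d_inr, h _ (S.c_inr_mem hg a), mul_zero]

/-- Up to sign, ν_a B(f, f) = B(c_a d_a f, f) = B(d_a f, d_a f), so induction on the multidegree
applies. The form is bilinear, so no positivity is available for general vectors. -/
lemma self_ne_zero {ν : α ⊕ α → ℕ} {f : V} (hf : S.IsMultihomog ν f) (hf0 : f ≠ 0) :
    B f f ≠ 0 := by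
  induction ν using multidegree_induction generalizing f with
  | zero =>
    obtain ⟨t, rfl⟩ := S.eq_smul_vac_of_mem (by simpa using hf.mem_homog)
    have : t ≠ 0 := fun h => hf0 (by simp [h])
    simp [this, hB.vac]
  | add ν a ih =>
    have h1 := ih hf.d (hf.d_ne_zero hf0 (by simp))
    intro h0
    have h2 : B (S.num a f) f = 0 := by rw [hf a, map_smul, LinearMap.smul_apply, h0, smul_zero]
    rw [S.num_apply] at h2
    rcases a with a | a
    · exact h1 (by rw [← hB.c_inl, h2])
    · rw [hB.c_inr] at h2
      refine h1 ((mul_eq_zero.mp h2).resolve_left fun h => ?_)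
      have := superSign_mul_self (p a) (p a)
      simp [h] at this

end IsContravariant

end FockSystem
end

/-! ### Common eigenvectors and highest weight vectors -/

noncomputable section

/-- Commuting operators have a common eigenvector in every nonzero finite-dimensional invariant
subspace. -/
lemma Module.End.exists_common_eigenvector {ι V : Type*} [AddCommGroup V] [Module ℂ V]
    (T : ι → Module.End ℂ V) (hT : ∀ i j f, T i (T j f) = T j (T i f)) (s : Finset ι)
    (W : Submodule ℂ V) [FiniteDimensional ℂ W] (hW : W ≠ ⊥) (hTW : ∀ i, ∀ f ∈ W, T i f ∈ W) :
    ∃ f ∈ W, f ≠ 0 ∧ ∀ i ∈ s, ∃ w : ℂ, T i f = w • f := by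
  classical
  induction s using Finset.induction_on generalizing W with
  | empty =>
    obtain ⟨f, hf, h0⟩ := Submodule.exists_mem_ne_zero_of_ne_bot hW
    exact ⟨f, hf, h0, by simp⟩
  | insert i s _ ih =>
    have : Nontrivial W := Submodule.nontrivial_iff_ne_bot.mpr hW
    obtain ⟨w, hw⟩ := Module.End.exists_eigenvalue ((T i).restrict (hTW i))
    obtain ⟨⟨v, hv⟩, hv'⟩ := hw.exists_hasEigenvector
    have hvw : T i v = w • v := congrArg Subtype.val hv'.apply_eq_smul
    have hv0 : v ≠ 0 := fun h => hv'.2 (by simp [h])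
    have : FiniteDimensional ℂ (W ⊓ Module.End.eigenspace (T i) w : Submodule ℂ V) :=
      Submodule.finiteDimensional_of_le inf_le_left
    obtain ⟨f, hf, hf0, hs⟩ := ih (W ⊓ Module.End.eigenspace (T i) w)
      (Submodule.ne_bot_iff _ |>.mpr ⟨v, ⟨hv, by simpa using hvw⟩, hv0⟩)
      (fun j f hf => ⟨hTW j f hf.1, by
        have := Module.End.mem_eigenspace_iff.mp hf.2
        exact Module.End.mem_eigenspace_iff.mpr (by rw [hT, this, map_smul])⟩)
    refine ⟨f, hf.1, hf0, fun j hj => ?_⟩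
    rcases Finset.mem_insert.mp hj with rfl | hj
    · exact ⟨w, Module.End.mem_eigenspace_iff.mp hf.2⟩
    · exact hs j hj

namespace FockSystem

variable {α : Type*} [DecidableEq α] [Fintype α] {p : α → ZMod 2}
  {V : Type*} [AddCommGroup V] [Module ℂ V] (S : FockSystem p V)

/-- Stability under the operators of the matrix units. -/
def IsUnitStable (U : Submodule ℂ V) : Prop := ∀ a b, ∀ f ∈ U, S.unit a b f ∈ U

/-- The bihomogeneous harmonic vectors. -/
def harmonic (k l : ℕ) : Submodule ℂ V := S.homog k l ⊓ LinearMap.ker S.lap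

lemma harmonic_le (k l : ℕ) : S.harmonic k l ≤ S.homog k l := inf_le_left

lemma lap_eq_zero {k l : ℕ} {f : V} (h : f ∈ S.harmonic k l) : S.lap f = 0 := h.2

lemma isUnitStable_harmonic (k l : ℕ) : S.IsUnitStable (S.harmonic k l) := fun a b f hf =>
  ⟨S.unit_mem hf.1 a b,
    LinearMap.mem_ker.mpr (by rw [S.lap_unit, S.lap_eq_zero hf, map_zero])⟩

/-! ### Highest weight vectors -/

/-- E_{ab} shifts the eigenvalue of T = ∑ t_a E_{aa} by t_a - t_b, so it must kill the eigenspace of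
largest real part if t_b < t_a. As t need not be injective, various choices of raising operators are
possible. -/
lemma exists_maximal_vector (U : Submodule ℂ V) [FiniteDimensional ℂ U] (hU0 : U ≠ ⊥)
    (hU : S.IsUnitStable U) (t : α → ℝ) :
    ∃ f ∈ U, f ≠ 0 ∧ (∀ a, ∃ w : ℂ, S.unit a a f = w • f) ∧
      ∀ a b, t b < t a → S.unit a b f = 0 := by
  set T : Module.End ℂ V := ∑ a, (t a : ℂ) • S.unit a a with hT
  have hTapp : ∀ f, T f = ∑ a, (t a : ℂ) • S.unit a a f := by
    intro f; simp [hT, LinearMap.sum_apply]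
  have hTU : ∀ f ∈ U, T f ∈ U := by
    intro f hf
    rw [hTapp]
    exact Submodule.sum_mem _ fun a _ => Submodule.smul_mem _ _ (hU a a f hf)
  have hTunit : ∀ a b f, T (S.unit a b f) = S.unit a b (T f) + ((t a : ℂ) - t b) • S.unit a b f := by
    intro a b f
    simp only [hTapp, S.unit_self_unit, map_sum, map_smul, smul_add, Finset.sum_add_distrib,
      smul_smul, ← Finset.sum_smul, mul_sub, mul_ite, mul_one, mul_zero, Finset.sum_sub_distrib,
      Finset.sum_ite_eq', Finset.mem_univ, if_true]
  have hcomm : ∀ a b f, S.unit a a (S.unit b b f) = S.unit b b (S.unit a a f) := by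
    intro a b f
    rw [S.unit_self_unit, sub_self, zero_smul, add_zero]
  have : Nontrivial U := Submodule.nontrivial_iff_ne_bot.mpr hU0
  obtain ⟨w0, hw0⟩ := Module.End.exists_eigenvalue (T.restrict hTU)
  obtain ⟨w, hw, hmax⟩ := Set.exists_max_image {w | Module.End.HasEigenvalue (T.restrict hTU) w} Complex.re
    (Module.End.finite_hasEigenvalue _) ⟨w0, hw0⟩
  obtain ⟨⟨v, hv⟩, hv'⟩ := Module.End.HasEigenvalue.exists_hasEigenvector hw
  have hvw : T v = w • v := congrArg Subtype.val hv'.apply_eq_smul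
  have hv0 : v ≠ 0 := fun h => hv'.2 (by simp [h])
  have : FiniteDimensional ℂ (U ⊓ Module.End.eigenspace T w : Submodule ℂ V) :=
    Submodule.finiteDimensional_of_le inf_le_left
  obtain ⟨f, hf, hf0, hs⟩ := Module.End.exists_common_eigenvector (fun a => S.unit a a) hcomm
    Finset.univ (U ⊓ Module.End.eigenspace T w)
    (Submodule.ne_bot_iff _ |>.mpr ⟨v, ⟨hv, by simpa using hvw⟩, hv0⟩)
    (fun j f hf => ⟨hU j j f hf.1, by
      have := Module.End.mem_eigenspace_iff.mp hf.2
      exact Module.End.mem_eigenspace_iff.mpr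
        (by rw [hTunit, this, map_smul, sub_self, zero_smul, add_zero])⟩)
  refine ⟨f, hf.1, hf0, fun a => hs a (Finset.mem_univ a), fun a b hab => ?_⟩
  by_contra hne
  have h1 : T f = w • f := Module.End.mem_eigenspace_iff.mp hf.2
  have h2 : T (S.unit a b f) = (w + (t a - t b)) • S.unit a b f := by
    rw [hTunit, h1, map_smul, add_smul]
  have h3 : Module.End.HasEigenvalue (T.restrict hTU) (w + (t a - t b)) :=
    Module.End.hasEigenvalue_of_hasEigenvector (x := ⟨S.unit a b f, hU a b f hf.1⟩)
      ⟨Module.End.mem_eigenspace_iff.mpr (Subtype.ext h2), fun h => hne (congrArg Subtype.val h)⟩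
  have h4 := hmax _ h3
  simp at h4
  linarith

/-- Applying d_a lowers both z and the total degree by one, and z = 0 once d_a kills the vector. -/
lemma exists_nat_of_num {k l : ℕ} {f : V} (hf : f ∈ S.homog k l) (hf0 : f ≠ 0) {a : α ⊕ α} {z : ℂ}
    (h : S.num a f = z • f) : ∃ N : ℕ, z = N := by
  induction hN : k + l using Nat.strong_induction_on generalizing k l f z with
  | _ N ih =>
    by_cases h0 : S.d a f = 0
    · rw [S.num_apply, h0, map_zero] at h
      exact ⟨0, by simpa using (smul_eq_zero.mp h.symm).resolve_right hf0⟩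
    · have h1 : S.num a (S.d a f) = (z - 1) • S.d a f := by
        rw [S.num_d, h, map_smul, sub_smul]; simp
      obtain ⟨M, hM⟩ : ∃ M : ℕ, z - 1 = M := by
        rcases a with a | a
        · rcases k with _ | k
          · exact absurd (S.d_inl_eq_zero hf a) h0
          · exact ih (k + l) (by omega) (S.d_inl_mem hf a) h0 h1 rfl
        · rcases l with _ | l
          · exact absurd (S.d_inr_eq_zero hf a) h0
          · exact ih (k + l) (by omega) (S.d_inr_mem hf a) h0 h1 rfl
      exact ⟨M + 1, by push_cast; rw [← hM]; ring⟩

/-! ### Maximal vectors relative to a highest even index -/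

section Even

variable {o : α} (ho : p o = 0)
include ho

lemma unit_d_inr {b : α} (hb : b ≠ o) (f : V) :
    S.unit o b (S.d (Sum.inr o) f) = S.d (Sum.inr o) (S.unit o b f) := by
  simp only [S.unit_apply, map_sub, map_smul, S.d_c (Sum.inr o), S.d_d (Sum.inr o) (Sum.inl b),
    varParity_inl, varParity_inr, ho, superSign_zero_left, one_smul, reduceCtorEq, if_false,
    add_zero, Sum.inr.injEq, if_neg hb.symm]

omit ho in
lemma unit_self_d_inr (f : V) :
    S.unit o o (S.d (Sum.inr o) f) = S.d (Sum.inr o) (S.unit o o f) + S.d (Sum.inr o) f := by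
  simp only [S.unit_self, S.num_d, map_sub, reduceCtorEq, if_false, if_true]
  abel

lemma d_inl_eq_zero_of_unit {f : V} {b : α} (h : S.unit o b f = 0)
    (hd : S.d (Sum.inr o) f = 0) : S.d (Sum.inl b) f = 0 := by
  rw [S.unit_apply, hd, map_zero, smul_zero, sub_zero] at h
  exact S.c_injective (Sum.inl o) ho (by rw [map_zero]; exact h)

/-- N is the largest exponent with ∂_{y_o}^N f ≠ 0. That derivative is still killed by the E_{ob},
so x_o is its only variable from the first half and its weight is k; each derivative has raised the
weight by one. -/
lemma exists_weight {k l : ℕ} {f : V} (hf : f ∈ S.homog k l) (hf0 : f ≠ 0) {w : ℂ}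
    (hw : S.unit o o f = w • f) (hE : ∀ b, b ≠ o → S.unit o b f = 0) :
    ∃ N : ℕ, N ≤ l ∧ w = k - N ∧ (S.d (Sum.inr o) f ≠ 0 → 1 ≤ N) := by
  induction l generalizing f w with
  | zero =>
    have hd := S.d_inr_eq_zero hf o
    refine ⟨0, le_rfl, ?_, fun h => absurd hd h⟩
    have h1 : S.degL f = S.num (Sum.inl o) f := by
      rw [S.degL_apply]
      exact Finset.sum_eq_single_of_mem o (Finset.mem_univ o) fun b _ hb => by
        rw [S.num_apply, S.d_inl_eq_zero_of_unit ho (hE b hb) hd, map_zero]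
    have h2 : w • f = (k : ℂ) • f := by
      rw [← hw, ← (S.mem_homog.mp hf).1, h1, S.unit_self, S.num_apply (Sum.inr o), hd, map_zero,
        sub_zero]
    simpa using smul_left_injective ℂ hf0 h2
  | succ l ih =>
    by_cases hd : S.d (Sum.inr o) f = 0
    · refine ⟨0, Nat.zero_le _, ?_, fun h => absurd hd h⟩
      have h1 : S.degL f = S.num (Sum.inl o) f := by
        rw [S.degL_apply]
        exact Finset.sum_eq_single_of_mem o (Finset.mem_univ o) fun b _ hb => by
          rw [S.num_apply, S.d_inl_eq_zero_of_unit ho (hE b hb) hd, map_zero]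
      have h2 : w • f = (k : ℂ) • f := by
        rw [← hw, ← (S.mem_homog.mp hf).1, h1, S.unit_self, S.num_apply (Sum.inr o), hd, map_zero,
          sub_zero]
      simpa using smul_left_injective ℂ hf0 h2
    · obtain ⟨N, hN, hwN, -⟩ := ih (S.d_inr_mem hf o) hd (w := w + 1)
        (by rw [unit_self_d_inr, hw, map_smul, add_smul, one_smul])
        (fun b hb => by rw [S.unit_d_inr ho hb, hE b hb, map_zero])
      exact ⟨N + 1, by omega, by push_cast; linear_combination hwN, fun _ => by omega⟩

/-- The scalar comes from expanding x_o Δ f = 0 with the relations E_{ob} f = 0, which turn each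
term into an expression in ∂_{y_o} f alone. -/
lemma smul_d_inr_eq_zero {k l : ℕ} {f : V} (hf : f ∈ S.harmonic k l) {w : ℂ}
    (hw : S.unit o o f = w • f) (hE : ∀ b, b ≠ o → S.unit o b f = 0) :
    (w + l + superDim p - 1) • S.d (Sum.inr o) f = 0 := by
  set h := S.d (Sum.inr o) f with hh
  -- For b ≠ o, E_{ob} f = 0 says x_o ∂_{x_b} f = y_b ∂_{y_o} f; for b = o the weight of ∂_{y_o} f,
  -- which is w + 1, is used instead.
  have hterm : ∀ b, S.c (Sum.inl o) (S.d (Sum.inl b) (S.d (Sum.inr b) f)) =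
      S.num (Sum.inr b) h + superSign (p b) (p b) • h + if b = o then w • h else 0 := by
    intro b
    by_cases hb : b = o
    · subst hb
      have h1 : S.unit b b h = (w + 1) • h := by
        rw [hh, unit_self_d_inr, hw, map_smul, add_smul, one_smul]
      rw [S.unit_self, sub_eq_iff_eq_add] at h1
      change S.num (Sum.inl b) h = _
      rw [h1, ho, if_pos rfl]
      simp only [superSign_zero_left]
      module
    · have h1 := hE b hb
      rw [S.unit_apply, ho] at h1
      simp only [superSign_zero_left, mul_one, one_smul, sub_eq_zero] at h1
      have h2 : ∀ g, S.c (Sum.inl o) (S.d (Sum.inr b) g) = S.d (Sum.inr b) (S.c (Sum.inl o) g) := by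
        intro g
        rw [S.d_c]
        simp [ho]
      rw [S.d_d, map_smul, h2, h1, S.d_c, if_neg hb, ← hh]
      simp only [varParity_inl, varParity_inr, if_true, smul_add, smul_smul, superSign_mul_self,
        one_smul, add_zero, S.num_apply]
  have hsum : S.c (Sum.inl o) (S.lap f) = S.degR h + superDim p • h + w • h := by
    rw [S.lap_apply, map_sum, Finset.sum_congr rfl fun b _ => hterm b]
    simp [Finset.sum_add_distrib, S.degR_apply, superDim, Finset.sum_smul]
  rw [S.lap_eq_zero hf, map_zero] at hsum
  have hdeg : S.degR h = ((l : ℂ) - 1) • h := by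
    rw [hh, S.degR_d_inr, (S.mem_homog.mp hf.1).2, map_smul, sub_smul, one_smul]
  rw [hdeg] at hsum
  rw [hsum]
  module

lemma d_inr_eq_zero_of_maximal {k l : ℕ} {f : V} (hf : f ∈ S.harmonic k l) {w : ℂ}
    (hw : S.unit o o f = w • f) (hE : ∀ b, b ≠ o → S.unit o b f = 0)
    (hkl : ∀ N : ℕ, 1 ≤ N → N ≤ l → (k + l + superDim p - 1 : ℂ) ≠ N) :
    S.d (Sum.inr o) f = 0 := by
  by_contra hd
  have hf0 : f ≠ 0 := fun h => hd (by rw [h, map_zero])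
  obtain ⟨N, hN, hwN, h1⟩ := S.exists_weight ho hf.1 hf0 hw hE
  have h2 := (smul_eq_zero.mp (S.smul_d_inr_eq_zero ho hf hw hE)).resolve_right hd
  exact hkl N (h1 hd) hN (by rw [hwN] at h2; linear_combination h2)

/-- Once ∂_{y_o} f = 0, the equations E_{ob} f = 0 remove all first-half variables except x_o. Each
E_{aa} then acts, up to sign, as a single number operator, so a weight vector is automatically
homogeneous in every variable. -/
lemma exists_isMultihomog_mem {k l : ℕ}
    (hkl : ∀ N : ℕ, 1 ≤ N → N ≤ l → (k + l + superDim p - 1 : ℂ) ≠ N) (t : α → ℝ)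
    (ht : ∀ b, b ≠ o → t b < t o) {U : Submodule ℂ V} (hUH : U ≤ S.harmonic k l)
    (hU : S.IsUnitStable U) (hU0 : U ≠ ⊥) :
    ∃ f ∈ U, f ≠ 0 ∧ ∃ ν : α ⊕ α → ℕ, S.IsMultihomog ν f ∧ (∀ b, b ≠ o → ν (Sum.inl b) = 0) ∧
      ν (Sum.inl o) = k ∧ ν (Sum.inr o) = 0 ∧ ∑ b, ν (Sum.inr b) = l ∧
      (∀ a, varParity p a = 1 → ν a ≤ 1) ∧
      ∀ a b, b ≠ o → t b < t a → ν (Sum.inr a) ≠ 0 → p b = 1 ∧ ν (Sum.inr b) = 1 := by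
  have : FiniteDimensional ℂ U :=
    Submodule.finiteDimensional_of_le (hUH.trans (S.harmonic_le k l))
  obtain ⟨f, hfU, hf0, hdiag, hE⟩ := S.exists_maximal_vector U hU0 hU t
  have hfH := hUH hfU
  obtain ⟨w, hw⟩ := hdiag o
  have hEo : ∀ b, b ≠ o → S.unit o b f = 0 := fun b hb => hE o b (ht b hb)
  have hdo := S.d_inr_eq_zero_of_maximal ho hfH hw hEo hkl
  have hdL : ∀ b, b ≠ o → S.d (Sum.inl b) f = 0 := fun b hb =>
    S.d_inl_eq_zero_of_unit ho (hEo b hb) hdo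
  have hnum : ∀ a, ∃ N : ℕ, S.num a f = (N : ℂ) • f := by
    suffices h : ∀ a, ∃ z : ℂ, S.num a f = z • f by
      intro a
      obtain ⟨z, hz⟩ := h a
      obtain ⟨N, rfl⟩ := S.exists_nat_of_num hfH.1 hf0 hz
      exact ⟨N, hz⟩
    rintro (a | a)
    · by_cases ha : a = o
      · subst ha
        exact ⟨w, by rw [← hw, S.unit_self, S.num_apply (Sum.inr a), hdo, map_zero, sub_zero]⟩
      · exact ⟨0, by rw [S.num_apply, hdL a ha, map_zero, zero_smul]⟩
    · by_cases ha : a = o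
      · subst ha
        exact ⟨0, by rw [S.num_apply, hdo, map_zero, zero_smul]⟩
      · obtain ⟨z, hz⟩ := hdiag a
        rw [S.unit_self, S.num_apply (Sum.inl a), hdL a ha, map_zero, zero_sub, neg_eq_iff_eq_neg]
          at hz
        exact ⟨-z, by rw [hz, neg_smul]⟩
  choose ν hν using hnum
  have hzero : ∀ a, S.d a f = 0 → ν a = 0 := by
    intro a ha
    have := hν a
    rw [S.num_apply, ha, map_zero] at this
    exact_mod_cast (smul_eq_zero.mp this.symm).resolve_right hf0
  have hmem := S.mem_homog.mp (IsMultihomog.mem_homog (S := S) hν)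
  rw [(S.mem_homog.mp hfH.1).1, (S.mem_homog.mp hfH.1).2] at hmem
  have hk : k = ∑ a, ν (Sum.inl a) := by exact_mod_cast smul_left_injective ℂ hf0 hmem.1
  have hl : l = ∑ a, ν (Sum.inr a) := by exact_mod_cast smul_left_injective ℂ hf0 hmem.2
  have hodd : ∀ a, varParity p a = 1 → ν a ≤ 1 := by
    intro a ha
    have h1 := S.num_odd_idem a ha f
    rw [hν, map_smul, hν, smul_smul] at h1
    have h2 : ν a * ν a = ν a := by exact_mod_cast smul_left_injective ℂ hf0 h1
    by_contra! h3
    nlinarith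
  refine ⟨f, hfU, hf0, ν, hν, fun b hb => hzero _ (hdL b hb), ?_, hzero _ hdo, hl.symm, hodd, ?_⟩
  · rw [hk]
    exact (Finset.sum_eq_single_of_mem o (Finset.mem_univ o) fun b _ hb => hzero _ (hdL b hb)).symm
  · intro a b hb hab ha
    have hda : S.d (Sum.inr a) f ≠ 0 := IsMultihomog.d_ne_zero (S := S) hν hf0 ha
    have h1 := hE a b hab
    -- Since ∂_{x_b} f = 0, only y_b ∂_{y_a} f remains of E_{ab} f. It can vanish with ∂_{y_a} f ≠ 0
    -- only if the variable is odd and already present.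
    rw [S.unit_apply, hdL b hb, map_zero, zero_sub, neg_eq_zero] at h1
    have h2 : superSign (p a) (p a) * superSign (p a) (p b) ≠ 0 := by
      intro h0
      have e1 := superSign_mul_self (p a) (p a)
      have e2 := superSign_mul_self (p a) (p b)
      rcases mul_eq_zero.mp h0 with h0 | h0
      · simp [h0] at e1
      · simp [h0] at e2
    have h3 : S.c (Sum.inr b) (S.d (Sum.inr a) f) = 0 := (smul_eq_zero.mp h1).resolve_left h2
    have hpb : p b = 1 := by
      refine (p b).eq_zero_or_one_of_two.resolve_left fun h => hda ?_
      exact S.c_injective (Sum.inr b) h (by rw [h3, map_zero])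
    refine ⟨hpb, ?_⟩
    have h4 := hodd (Sum.inr b) hpb
    by_contra h5
    have h6 : ν (Sum.inr b) = 0 := by omega
    have h7 : S.d (Sum.inr b) f = 0 := S.d_eq_zero_of_num (by rw [hν, h6]; simp)
    have h8 := S.d_c (Sum.inr b) (Sum.inr b) (S.d (Sum.inr a) f)
    rw [h3, map_zero, S.d_d, h7] at h8
    simp at h8
    exact hda h8.symm

end Even

end FockSystem
end

noncomputable section

namespace FockSystem

variable {α : Type*} [DecidableEq α] [Fintype α] {p : α → ZMod 2}
  {V : Type*} [AddCommGroup V] [Module ℂ V] (S : FockSystem p V)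

/-! ### The action of the invariant and the Laplacian -/

variable (p) in
/-- No harmonic vector of bidegree `(k, l)` can be a multiple of the invariant. -/
def IsNonsingular (k l : ℕ) : Prop :=
  ∀ N : ℕ, 1 ≤ N → N ≤ min k l → (k + l + superDim p - 1 : ℂ) ≠ N

/-- By `lap_et`, Δ^j f is an eigenvector of ηΔ for minus the number in `hz`. Since Δ^j f = 0 for j >
min(k, l), descending through nonzero eigenvalues gives f = 0. -/
lemma eq_zero_of_et_lap {k l : ℕ} {f : V} (hf : f ∈ S.homog k l) {z : ℂ}
    (hz : ∀ j : ℕ, j ≤ min k l → z + j * (k + l + superDim p - 1 - j) ≠ 0)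
    (h : S.et (S.lap f) = -z • f) : f = 0 := by
  have h0 : S.lap f = 0 → f = 0 := by
    intro h1
    rw [h1, map_zero] at h
    have := hz 0 (Nat.zero_le _)
    simp only [Nat.cast_zero, zero_mul, add_zero] at this
    exact (smul_eq_zero.mp h.symm).resolve_left (neg_ne_zero.mpr this)
  induction k generalizing l f z with
  | zero => exact h0 (S.lap_eq_zero_left hf)
  | succ k ih =>
    rcases l with _ | l
    · exact h0 (S.lap_eq_zero_right hf)
    · apply h0
      have hg := S.lap_mem hf
      have h1 := S.lap_et (S.lap f)
      rw [h, map_smul, (S.mem_homog.mp hg).1, (S.mem_homog.mp hg).2] at h1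
      have hz' : ∀ j : ℕ, j ≤ min k l →
          (z + k + l + superDim p) + j * (k + l + superDim p - 1 - j) ≠ 0 := by
        intro j hj h2
        apply hz (j + 1) (by omega)
        push_cast
        linear_combination h2
      have h3 : S.et (S.lap (S.lap f)) = -(z + k + l + superDim p) • S.lap f := by
        rw [← sub_eq_zero]
        rw [← sub_eq_zero] at h1
        rw [← neg_eq_zero, ← h1]
        module
      refine ih hg hz' h3 fun h4 => ?_
      rw [h4, map_zero] at h3
      have := hz' 0 (Nat.zero_le _)
      simp only [Nat.cast_zero, zero_mul, add_zero] at this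
      exact (smul_eq_zero.mp h3.symm).resolve_left (neg_ne_zero.mpr this)

lemma eq_zero_of_lap_et {k l : ℕ} (hkl : IsNonsingular p (k + 1) (l + 1)) {f : V}
    (hf : f ∈ S.homog k l) (h : S.lap (S.et f) = 0) : f = 0 := by
  rw [S.lap_et, (S.mem_homog.mp hf).1, (S.mem_homog.mp hf).2] at h
  -- With this z, the scalar of [Δ, η] on this bidegree, the j-th number factors as (j+1)(k + l +
  -- superDim p - j), and N = j + 1 is the matching nonsingularity condition.
  refine S.eq_zero_of_et_lap hf (z := k + l + superDim p) (fun j hj h1 => ?_) ?_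
  · have h2 : ((j : ℂ) + 1) * (k + l + superDim p - j) = 0 := by linear_combination h1
    rcases mul_eq_zero.mp h2 with h3 | h3
    · exact absurd h3 (by exact_mod_cast Nat.succ_ne_zero j)
    · apply hkl (j + 1) (by omega) (by omega)
      push_cast
      linear_combination h3
  · rw [← sub_eq_zero, ← h]
    module

/-- Δη is injective on a finite-dimensional space, hence surjective; solving Δηg = Δf makes f - ηg
harmonic. -/
lemma exists_eq_add_et {k l : ℕ} (hkl : IsNonsingular p (k + 1) (l + 1)) {f : V}
    (hf : f ∈ S.homog (k + 1) (l + 1)) :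
    ∃ h ∈ S.harmonic (k + 1) (l + 1), ∃ g ∈ S.homog k l, f = h + S.et g := by
  let T : S.homog k l →ₗ[ℂ] S.homog k l :=
    (S.lap * S.et).restrict fun g hg => S.lap_mem (S.et_mem hg)
  have hT : Function.Injective T := by
    rw [injective_iff_map_eq_zero]
    rintro ⟨g, hg⟩ h
    exact Subtype.ext (S.eq_zero_of_lap_et hkl hg (congrArg Subtype.val h))
  obtain ⟨⟨g, hg⟩, h⟩ := LinearMap.surjective_of_injective hT ⟨S.lap f, S.lap_mem hf⟩
  have h' : S.lap (S.et g) = S.lap f := congrArg Subtype.val h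
  refine ⟨f - S.et g, ⟨Submodule.sub_mem _ hf (S.et_mem hg), ?_⟩, g, hg, by simp⟩
  exact LinearMap.mem_ker.mpr (by rw [map_sub, h', sub_self])

lemma et_pow_mem {k l : ℕ} {f : V} (hf : f ∈ S.homog k l) (i : ℕ) :
    (S.et ^ i) f ∈ S.homog (k + i) (l + i) := by
  induction i with
  | zero => simpa using hf
  | succ i ih =>
    rw [pow_succ', Module.End.mul_apply]
    exact S.et_mem ih

lemma lap_et_pow_succ {k l : ℕ} {f : V} (hf : f ∈ S.harmonic k l) (i : ℕ) :
    S.lap ((S.et ^ (i + 1)) f) = ((i + 1) * (k + l + i + superDim p) : ℂ) • (S.et ^ i) f := by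
  induction i with
  | zero =>
    rw [zero_add, pow_one, S.lap_et, S.lap_eq_zero hf, (S.mem_homog.mp hf.1).1,
      (S.mem_homog.mp hf.1).2, map_zero]
    simp only [pow_zero, Module.End.one_apply, Nat.cast_zero]
    module
  | succ i ih =>
    have h := S.mem_homog.mp (S.et_pow_mem hf.1 (i + 1))
    rw [pow_succ', Module.End.mul_apply, S.lap_et, ih, h.1, h.2, map_smul, ← Module.End.mul_apply,
      ← pow_succ']
    push_cast
    module

lemma et_lap_et_pow {k l : ℕ} {f : V} (hf : f ∈ S.harmonic k l) (i : ℕ) :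
    S.et (S.lap ((S.et ^ i) f)) = (i * (k + l + i - 1 + superDim p) : ℂ) • (S.et ^ i) f := by
  rcases i with _ | i
  · simp [S.lap_eq_zero hf]
  · rw [S.lap_et_pow_succ hf, map_smul, ← Module.End.mul_apply, ← pow_succ']
    push_cast
    module

/-- The subspace `η^i ℋ_{k,l}`. -/
def etHarmonic (i k l : ℕ) : Submodule ℂ V := (S.harmonic k l).map (S.et ^ i)

lemma etHarmonic_le {i k l : ℕ} (hi : i ≤ min k l) :
    S.etHarmonic i (k - i) (l - i) ≤ S.homog k l := by
  rintro _ ⟨f, hf, rfl⟩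
  have h := S.et_pow_mem hf.1 i
  rwa [Nat.sub_add_cancel (by omega), Nat.sub_add_cancel (by omega)] at h

/-- Stated for an arbitrary W, so that the induction can replace W by its preimage under η. -/
lemma homog_le_of_etHarmonic_le {k l : ℕ} (hkl : ∀ i ≤ min k l, IsNonsingular p (k - i) (l - i))
    {W : Submodule ℂ V} (hW : ∀ i ≤ min k l, S.etHarmonic i (k - i) (l - i) ≤ W) :
    S.homog k l ≤ W := by
  have hH : S.harmonic k l ≤ W := by
    have := hW 0 (Nat.zero_le _)
    rwa [etHarmonic, pow_zero, Module.End.one_eq_id, Submodule.map_id] at this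
  induction k generalizing l W with
  | zero => exact fun f hf => hH ⟨hf, LinearMap.mem_ker.mpr (S.lap_eq_zero_left hf)⟩
  | succ k ih =>
    rcases l with _ | l
    · exact fun f hf => hH ⟨hf, LinearMap.mem_ker.mpr (S.lap_eq_zero_right hf)⟩
    · intro f hf
      obtain ⟨h, hh, g, hg, rfl⟩ := S.exists_eq_add_et (hkl 0 (Nat.zero_le _)) hf
      have h1 : ∀ i ≤ min k l, S.etHarmonic i (k - i) (l - i) ≤ W.comap S.et := by
        rintro i hi _ ⟨u, hu, rfl⟩
        have h2 := hW (i + 1) (by omega)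
        rw [Nat.add_sub_add_right, Nat.add_sub_add_right] at h2
        exact h2 ⟨u, hu, by rw [pow_succ']; rfl⟩
      refine Submodule.add_mem _ (hH hh) (ih (W := W.comap S.et) (fun i hi => ?_) h1 ?_ hg)
      · have h2 := hkl (i + 1) (by omega)
        rwa [Nat.add_sub_add_right, Nat.add_sub_add_right] at h2
      · have h2 := h1 0 (Nat.zero_le _)
        rwa [etHarmonic, pow_zero, Module.End.one_eq_id, Submodule.map_id] at h2

lemma iSup_etHarmonic {k l : ℕ} (hkl : ∀ i ≤ min k l, IsNonsingular p (k - i) (l - i)) :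
    ⨆ i : Fin (min k l + 1), S.etHarmonic i (k - i) (l - i) = S.homog k l := by
  refine le_antisymm (iSup_le fun i => S.etHarmonic_le (Nat.lt_succ_iff.mp i.2))
    (S.homog_le_of_etHarmonic_le hkl fun i hi => ?_)
  exact le_iSup (fun i : Fin (min k l + 1) => S.etHarmonic i (k - i) (l - i))
    ⟨i, Nat.lt_succ_iff.mpr hi⟩

/-- The summands lie in eigenspaces of ηΔ. Eigenvalues i < j coincide only if k + l + superDim p - 1
= i + j, which is singularity of (k-i, l-i) with N = j - i. -/
lemma iSupIndep_etHarmonic {k l : ℕ}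
    (hkl : ∀ i ≤ min k l, IsNonsingular p (k - i) (l - i)) :
    iSupIndep fun i : Fin (min k l + 1) => S.etHarmonic i (k - i) (l - i) := by
  let e : Fin (min k l + 1) → ℂ := fun i => i * (k + l - i - 1 + superDim p)
  have hlt : ∀ i j : Fin (min k l + 1), i < j → e i ≠ e j := by
    intro i j hij h
    have hi := i.2
    have hj := j.2
    have hij' : (i : ℕ) < j := hij
    have h1 : ((j : ℂ) - i) * (k + l + superDim p - 1 - i - j) = 0 := by
      simp only [e] at h
      linear_combination -h
    have h0 : (j : ℂ) - i ≠ 0 := by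
      rw [sub_ne_zero]
      exact_mod_cast hij'.ne'
    have h2 := (mul_eq_zero.mp h1).resolve_left h0
    apply hkl i (by omega) (j - i) (by omega) (by omega)
    rw [Nat.cast_sub (by omega), Nat.cast_sub (by omega), Nat.cast_sub (by omega)]
    linear_combination h2
  have he : Function.Injective e := by
    intro i j h
    rcases lt_trichotomy i j with hij | hij | hij
    · exact absurd h (hlt i j hij)
    · exact hij
    · exact absurd h.symm (hlt j i hij)
  refine ((Module.End.eigenspaces_iSupIndep (S.et * S.lap)).comp he).mono fun i => ?_
  rintro _ ⟨f, hf, rfl⟩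
  have hi := i.2
  rw [Function.comp_apply, Module.End.mem_eigenspace_iff, Module.End.mul_apply,
    S.et_lap_et_pow hf, Nat.cast_sub (by omega), Nat.cast_sub (by omega)]
  congr 1
  simp only [e]
  ring

/-! ### Irreducibility -/

/-- Irreducibility under the operators of the matrix units. -/
def IsUnitIrreducible (W : Submodule ℂ V) : Prop :=
  S.IsUnitStable W ∧ W ≠ ⊥ ∧ ∀ U ≤ W, S.IsUnitStable U → U = ⊥ ∨ U = W

lemma et_pow_unit (i : ℕ) (a b : α) (f : V) :
    (S.et ^ i) (S.unit a b f) = S.unit a b ((S.et ^ i) f) := by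
  induction i with
  | zero => simp
  | succ i ih => rw [pow_succ', Module.End.mul_apply, Module.End.mul_apply, ih, S.et_unit]

lemma IsUnitStable.map_et_pow {S : FockSystem p V} {W : Submodule ℂ V} (hW : S.IsUnitStable W)
    (i : ℕ) : S.IsUnitStable (W.map (S.et ^ i)) := by
  rintro a b _ ⟨f, hf, rfl⟩
  exact ⟨S.unit a b f, hW a b f hf, S.et_pow_unit i a b f⟩

lemma et_pow_injective (het : Function.Injective S.et) (i : ℕ) :
    Function.Injective (S.et ^ i : Module.End ℂ V) := by
  rw [Module.End.coe_pow]
  exact het.iterate i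

lemma IsUnitIrreducible.map_et_pow {S : FockSystem p V} {W : Submodule ℂ V}
    (hW : S.IsUnitIrreducible W) (het : Function.Injective S.et) (i : ℕ) :
    S.IsUnitIrreducible (W.map (S.et ^ i)) := by
  have hinj := S.et_pow_injective het i
  refine ⟨hW.1.map_et_pow i, fun h => hW.2.1 ?_, fun U hU hUs => ?_⟩
  · exact Submodule.map_injective_of_injective hinj (by rw [h, Submodule.map_bot])
  · have hUeq : (U.comap (S.et ^ i)).map (S.et ^ i) = U := by
      rw [Submodule.map_comap_eq, inf_eq_right]
      exact hU.trans (LinearMap.map_le_range)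
    rcases hW.2.2 (U.comap (S.et ^ i))
      (fun f hf => by
        obtain ⟨g, hg, hgf⟩ := hU hf
        rwa [← hinj hgf])
      (fun a b f hf => by
        rw [Submodule.mem_comap, S.et_pow_unit]
        exact hUs a b _ hf) with h | h
    · left; rw [← hUeq, h, Submodule.map_bot]
    · right; rw [← hUeq, h]

/-- The multiples of the invariant in bidegree `(k, l)`. -/
def etImage : ℕ → ℕ → Submodule ℂ V
  | k + 1, l + 1 => (S.homog k l).map S.et
  | _, _ => ⊥

lemma etImage_le (k l : ℕ) : S.etImage k l ≤ S.homog k l := by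
  rcases k with _ | k
  · simp [etImage]
  rcases l with _ | l
  · simp [etImage]
  rintro _ ⟨f, hf, rfl⟩
  exact S.et_mem hf

lemma eq_zero_of_mem_etImage {k l : ℕ} (hkl : IsNonsingular p k l) {f : V}
    (hf : f ∈ S.etImage k l) (h : S.lap f = 0) : f = 0 := by
  rcases k with _ | k
  · simpa [etImage] using hf
  rcases l with _ | l
  · simpa [etImage] using hf
  obtain ⟨g, hg, rfl⟩ := hf
  rw [S.eq_zero_of_lap_et hkl hg h, map_zero]

namespace IsContravariant

variable {S} {B : V →ₗ[ℂ] V →ₗ[ℂ] ℂ} (hB : S.IsContravariant B)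
include hB

lemma mem_harmonic_of_forall {k l : ℕ} {f : V} (hf : f ∈ S.homog k l)
    (h : ∀ g ∈ S.etImage k l, B f g = 0) : f ∈ S.harmonic k l := by
  refine ⟨hf, LinearMap.mem_ker.mpr ?_⟩
  rcases k with _ | k
  · exact S.lap_eq_zero_left hf
  rcases l with _ | l
  · exact S.lap_eq_zero_right hf
  refine hB.eq_zero_of_forall (S.lap_mem hf) fun g hg => ?_
  rw [hB.lap]
  exact h _ ⟨g, hg, rfl⟩

/-- A nonzero functional vanishing on W is represented by a vector, because B is nondegenerate on a
finite-dimensional space. -/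
lemma exists_orthogonal {k l : ℕ} {W : Submodule ℂ V} (hW : W < S.homog k l) :
    ∃ f ∈ S.homog k l, f ≠ 0 ∧ ∀ g ∈ W, B f g = 0 := by
  let Φ : S.homog k l →ₗ[ℂ] Module.Dual ℂ (S.homog k l) :=
    (B.domRestrict₁₂ (S.homog k l) (S.homog k l))
  have hΦ : Function.Injective Φ := by
    rw [injective_iff_map_eq_zero]
    rintro ⟨f, hf⟩ h
    exact Subtype.ext (hB.eq_zero_of_forall hf fun g hg => LinearMap.congr_fun h ⟨g, hg⟩)
  have hΦs : Function.Surjective Φ :=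
    (LinearMap.injective_iff_surjective_of_finrank_eq_finrank
      (Subspace.dual_finrank_eq).symm).mp hΦ
  have hW' : W.comap (S.homog k l).subtype < ⊤ := by
    rw [lt_top_iff_ne_top, Ne, Submodule.comap_subtype_eq_top]
    exact not_le_of_gt hW
  obtain ⟨φ, hφ0, hφ⟩ := Submodule.exists_le_ker_of_lt_top _ hW'
  obtain ⟨⟨f, hf⟩, rfl⟩ := hΦs φ
  refine ⟨f, hf, fun h => hφ0 ?_, fun g hg => ?_⟩
  · have : (⟨f, hf⟩ : S.homog k l) = 0 := Subtype.ext h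
    rw [this, map_zero]
  · exact hφ (show (⟨g, hW.le hg⟩ : S.homog k l) ∈ _ from hg)

/-- If all nonzero stable subspaces of the harmonic vectors share a multihomogeneous vector, then
the harmonic vectors form an irreducible representation. -/
lemma isUnitIrreducible_harmonic {k l : ℕ} (hkl : IsNonsingular p k l)
    (h0 : S.harmonic k l ≠ ⊥) {ν : α ⊕ α → ℕ}
    (hν : ∀ U ≤ S.harmonic k l, S.IsUnitStable U → U ≠ ⊥ →
      ∃ f ∈ U, f ≠ 0 ∧ S.IsMultihomog ν f) :
    S.IsUnitIrreducible (S.harmonic k l) := by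
  refine ⟨S.isUnitStable_harmonic k l, h0, fun U hU hUs => or_iff_not_imp_left.mpr fun hU0 => ?_⟩
  have hle : U ⊔ S.etImage k l ≤ S.homog k l :=
    sup_le (hU.trans (S.harmonic_le k l)) (S.etImage_le k l)
  rcases hle.eq_or_lt with heq | hlt
  -- If U and the multiples of η together span, a harmonic h differs from an element of U by a
  -- harmonic multiple of η, which is 0 by nonsingularity.
  · refine le_antisymm hU fun h hh => ?_
    obtain ⟨u, hu, e, he, hue⟩ := Submodule.mem_sup.mp (heq.ge hh.1)
    have h1 : S.lap e = 0 := by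
      rw [eq_sub_of_add_eq' hue, map_sub, S.lap_eq_zero hh, S.lap_eq_zero (hU hu), sub_zero]
    rw [S.eq_zero_of_mem_etImage hkl he h1, add_zero] at hue
    exact hue ▸ hu
  · exfalso
    obtain ⟨f, hf, hf0, hfU⟩ := hB.exists_orthogonal hlt
    have hfH := hB.mem_harmonic_of_forall hf fun g hg => hfU g (Submodule.mem_sup_right hg)
    -- The orthogonal complement of U in ℋ is stable because E_{ab} is adjoint to E_{ba}, and
    -- nonzero because f, being orthogonal to the multiples of η, is harmonic.
    let U' : Submodule ℂ V := S.harmonic k l ⊓ (U.dualAnnihilator.comap B)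
    have hmemU' : ∀ {g}, g ∈ U' ↔ g ∈ S.harmonic k l ∧ ∀ u ∈ U, B g u = 0 := by
      intro g
      simp [U', Submodule.mem_dualAnnihilator]
    obtain ⟨g, hg, hg0, hgν⟩ := hν U hU hUs hU0
    obtain ⟨g', hg', hg0', hgν'⟩ := hν U' inf_le_left
      (fun a b v hv => by
        rw [hmemU'] at hv ⊢
        refine ⟨S.isUnitStable_harmonic k l a b v hv.1, fun u hu => ?_⟩
        rw [hB.unit]
        exact hv.2 _ (hUs b a u hu))
      ((Submodule.ne_bot_iff _).mpr
        ⟨f, hmemU'.mpr ⟨hfH, fun u hu => hfU u (Submodule.mem_sup_left hu)⟩, hf0⟩)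
    -- U and its complement contain proportional vectors of multidegree ν, so such a vector would be
    -- orthogonal to itself.
    obtain ⟨t, rfl⟩ := hgν.exists_eq_smul hg0 hgν'
    have h1 := (hmemU'.mp hg').2 g hg
    rw [map_smul, LinearMap.smul_apply] at h1
    rcases smul_eq_zero.mp h1 with h2 | h2
    · exact hg0' (by rw [h2, zero_smul])
    · exact hB.self_ne_zero hgν hg0 h2

/-- The invariant subspace is η^N ℋ_{k-N,l-N}: harmonic because the scalar in `lap_et_pow_succ`
vanishes, nonzero because η is injective. -/
lemma not_isUnitIrreducible_harmonic {k l N : ℕ} (hN : 1 ≤ N) (hNkl : N ≤ min k l)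
    (hsing : (k + l + superDim p - 1 : ℂ) = N) (h0 : S.harmonic (k - N) (l - N) ≠ ⊥)
    (het : Function.Injective S.et) {ν : α ⊕ α → ℕ} {v : V} (hv : v ∈ S.harmonic k l)
    (hv0 : v ≠ 0) (hvν : S.IsMultihomog ν v) : ¬ S.IsUnitIrreducible (S.harmonic k l) := by
  intro hirr
  obtain ⟨N, rfl⟩ : ∃ M, N = M + 1 := ⟨N - 1, by omega⟩
  have hle : S.etHarmonic (N + 1) (k - (N + 1)) (l - (N + 1)) ≤ S.harmonic k l := by
    intro f hf
    refine ⟨S.etHarmonic_le hNkl hf, LinearMap.mem_ker.mpr ?_⟩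
    obtain ⟨g, hg, rfl⟩ := hf
    rw [S.lap_et_pow_succ hg, Nat.cast_sub (by omega), Nat.cast_sub (by omega)]
    push_cast at hsing ⊢
    rw [show (k - (N + 1) + (l - (N + 1)) + N + superDim p : ℂ) = 0 by linear_combination hsing,
      mul_zero, zero_smul]
  rcases hirr.2.2 _ hle ((S.isUnitStable_harmonic _ _).map_et_pow _) with h | h
  · refine h0 (Submodule.map_injective_of_injective (S.et_pow_injective het (N + 1)) ?_)
    rw [Submodule.map_bot, ← h, etHarmonic]
  · obtain ⟨g, -, hg⟩ := h.ge hv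
    apply hB.self_ne_zero hvν hv0
    -- Were the subspace all of ℋ, v would be a multiple of η, so B(v, v) would move a Δ onto the
    -- harmonic vector v.
    nth_rewrite 1 [← hg]
    rw [pow_succ', Module.End.mul_apply, hB.et, S.lap_eq_zero hv, map_zero]

end IsContravariant

/-! ### Exchanging the variables with their duals -/

/-- The Fock system in which the two halves of the variables are exchanged. -/
def swap : FockSystem p V where
  -- The sign on one half keeps the Laplacian unchanged and makes the new E_{ab} a multiple of the
  -- old E_{ba}.
  c := Sum.elim (fun a => S.c (Sum.inr a)) fun a => superSign (p a) (p a) • S.c (Sum.inl a)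
  d := Sum.elim (fun a => S.d (Sum.inr a)) fun a => superSign (p a) (p a) • S.d (Sum.inl a)
  c_c := by
    rintro (a | a) (b | b) f <;>
    simp only [Sum.elim_inl, Sum.elim_inr, LinearMap.smul_apply, map_smul] <;>
    rw [S.c_c] <;> simp only [varParity_inl, varParity_inr] <;> module
  d_d := by
    rintro (a | a) (b | b) f <;>
    simp only [Sum.elim_inl, Sum.elim_inr, LinearMap.smul_apply, map_smul] <;>
    rw [S.d_d] <;> simp only [varParity_inl, varParity_inr] <;> module
  d_c := by
    rintro (a | a) (b | b) f <;>
    simp only [Sum.elim_inl, Sum.elim_inr, LinearMap.smul_apply, map_smul] <;>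
    rw [S.d_c] <;> simp only [varParity_inl, varParity_inr, Sum.inl.injEq, Sum.inr.injEq,
      reduceCtorEq, if_false, add_zero]
    · module
    · module
    · split_ifs with h
      · subst h
        simp only [smul_add, smul_smul, superSign_mul_self, one_smul]
      · module
  c_injective := by
    rintro (a | a) h
    · exact S.c_injective _ h
    · have h' : p a = 0 := h
      simpa [h'] using S.c_injective (Sum.inl a) h
  eq_zero_of_degL := by
    intro f h
    apply S.eq_zero_of_degR
    simpa [OscSystem.degL_apply, OscSystem.degR_apply, OscSystem.num_apply] using h
  eq_zero_of_degR := by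
    intro f h
    apply S.eq_zero_of_degL
    simpa [OscSystem.degL_apply, OscSystem.degR_apply, OscSystem.num_apply, smul_smul,
      superSign_mul_self] using h
  vac := S.vac
  vac_ne_zero := S.vac_ne_zero
  degL_vac := by
    simpa [OscSystem.degL_apply, OscSystem.degR_apply, OscSystem.num_apply] using S.degR_vac
  degR_vac := by
    simpa [OscSystem.degL_apply, OscSystem.degR_apply, OscSystem.num_apply, smul_smul,
      superSign_mul_self] using S.degL_vac
  eq_smul_vac := by
    intro f h1 h2
    apply S.eq_smul_vac
    · simpa [OscSystem.degL_apply, OscSystem.degR_apply, OscSystem.num_apply, smul_smul,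
        superSign_mul_self] using h2
    · simpa [OscSystem.degL_apply, OscSystem.degR_apply, OscSystem.num_apply] using h1

lemma swap_num (a : α ⊕ α) : S.swap.num a = S.num a.swap := by
  ext f
  rcases a with a | a <;> simp [OscSystem.num_apply, swap, smul_smul, superSign_mul_self]

lemma swap_unit (a b : α) :
    S.swap.unit a b = -(superSign (p a) (p b) * superSign (p b) (p b)) • S.unit b a := by
  ext f
  simp only [OscSystem.unit_apply, swap, Sum.elim_inl, Sum.elim_inr, LinearMap.smul_apply,
    map_smul, smul_smul, smul_sub, superSign_comm (p b) (p a)]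
  have h1 := superSign_mul_self (p a) (p a)
  have h2 := superSign_mul_self (p a) (p b)
  have h3 := superSign_mul_self (p b) (p b)
  rcases (p a).eq_zero_or_one_of_two with ha | ha <;>
  rcases (p b).eq_zero_or_one_of_two with hb | hb <;>
  simp [ha, hb] <;> abel

lemma swap_harmonic (k l : ℕ) : S.swap.harmonic k l = S.harmonic l k := by
  have h1 : S.swap.degL = S.degR := by
    simp [OscSystem.degL, OscSystem.degR, swap_num]
  have h2 : S.swap.degR = S.degL := by
    simp [OscSystem.degL, OscSystem.degR, swap_num]
  have h3 : S.swap.lap = S.lap := by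
    ext f
    simp only [OscSystem.lap_apply]
    refine Finset.sum_congr rfl fun a _ => ?_
    rw [S.d_d (Sum.inl a)]
    simp [swap]
  rw [harmonic, harmonic, homog, homog, h1, h2, h3, inf_comm (Module.End.eigenspace S.degR _)]

lemma IsUnitStable.swap {S : FockSystem p V} {U : Submodule ℂ V} (hU : S.IsUnitStable U) :
    S.swap.IsUnitStable U := by
  intro a b f hf
  rw [swap_unit]
  exact Submodule.smul_mem _ _ (hU b a f hf)

lemma IsMultihomog.of_swap {S : FockSystem p V} {ν : α ⊕ α → ℕ} {f : V}
    (h : S.swap.IsMultihomog ν f) : S.IsMultihomog (ν ∘ Sum.swap) f := by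
  intro a
  rw [← Sum.swap_swap a, ← swap_num, h, Function.comp_apply, Sum.swap_swap]

/-! ### Harmonic multihomogeneous vectors -/

/-- Each term of Δ differentiates along a variable and its dual, and one of the two is absent. -/
lemma IsMultihomog.mem_harmonic {S : FockSystem p V} {ν : α ⊕ α → ℕ} {f : V}
    (h : S.IsMultihomog ν f) (hν : ∀ a, ν (Sum.inl a) = 0 ∨ ν (Sum.inr a) = 0) :
    f ∈ S.harmonic (∑ a, ν (Sum.inl a)) (∑ a, ν (Sum.inr a)) := by
  refine ⟨h.mem_homog, LinearMap.mem_ker.mpr ?_⟩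
  rw [S.lap_apply]
  refine Finset.sum_eq_zero fun a _ => ?_
  have hd : ∀ b, ν b = 0 → S.d b f = 0 := fun b hb =>
    S.d_eq_zero_of_num (by rw [h b, hb, Nat.cast_zero, zero_smul])
  rcases hν a with ha | ha
  · rw [S.d_d, hd _ ha, map_zero, smul_zero]
  · rw [hd _ ha, map_zero]

end FockSystem
end

/-! ### Explicit highest weight vectors for gl(n|m) and the irreducibility criterion -/

noncomputable section

/-- A decreasing zero-one sequence is determined by its sum. -/
lemma Fin.eq_ite_of_initial_segment {m l : ℕ} {ν : Fin m → ℕ} (h1 : ∀ r, ν r ≤ 1)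
    (hdown : ∀ r s, s < r → ν r ≠ 0 → ν s = 1) (hsum : ∑ r, ν r = l) (r : Fin m) :
    ν r = if (r : ℕ) < l then 1 else 0 := by
  by_cases hr : ν r = 0
  · have hz : ∀ s, s ∉ Finset.Iio r → ν s = 0 := by
      intro s hs
      by_contra h0
      rcases eq_or_lt_of_le (not_lt.mp (fun h => hs (Finset.mem_Iio.mpr h))) with h | h
      · exact h0 (h ▸ hr)
      · have := hdown s r h h0
        omega
    have h2 : ∑ s ∈ Finset.Iio r, ν s = l := by
      rw [← hsum]
      exact Finset.sum_subset (Finset.subset_univ _) fun s _ hs => hz s hs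
    have h3 : ∑ s ∈ Finset.Iio r, ν s ≤ ∑ s ∈ Finset.Iio r, 1 :=
      Finset.sum_le_sum fun s _ => h1 s
    rw [Finset.sum_const, Fin.card_Iio, h2] at h3
    simp only [smul_eq_mul, mul_one] at h3
    rw [hr, if_neg (by omega)]
  · have h2 : ∑ s ∈ Finset.Iic r, ν s = ∑ s ∈ Finset.Iic r, 1 := by
      refine Finset.sum_congr rfl fun s hs => ?_
      rcases eq_or_lt_of_le (Finset.mem_Iic.mp hs) with h | h
      · have := h1 s
        rw [h] at this ⊢
        omega
      · exact hdown r s h hr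
    have h3 : ∑ s ∈ Finset.Iic r, ν s ≤ ∑ s, ν s :=
      Finset.sum_le_sum_of_subset (Finset.subset_univ _)
    rw [h2, Finset.sum_const, Fin.card_Iic, hsum] at h3
    simp only [smul_eq_mul, mul_one] at h3
    have := h1 r
    rw [if_pos (by omega)]
    omega

lemma Fin.sum_ite_lt {m l : ℕ} (h : l ≤ m) : ∑ r : Fin m, (if (r : ℕ) < l then 1 else 0) = l := by
  rw [Fin.sum_univ_eq_sum_range (fun r => if r < l then 1 else 0) m, Finset.sum_ite]
  simp only [Finset.sum_const, smul_eq_mul, mul_one, mul_zero, add_zero]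
  have : (Finset.range m).filter (fun r => r < l) = Finset.range l := by
    ext r
    simp only [Finset.mem_filter, Finset.mem_range]
    omega
  rw [this, Finset.card_range]

namespace FockSystem

open SuperHarmonic

lemma superDim_idxParity (n m : ℕ) : superDim (idxParity n m) = (n : ℂ) - m := by
  simp [superDim, Fintype.sum_sum_type, idxParity, sub_eq_add_neg]

variable {n m : ℕ} {V : Type*} [AddCommGroup V] [Module ℂ V]
  (S : FockSystem (idxParity n m) V)

lemma singular_iff {k l N : ℕ} :
    (k + l + superDim (idxParity n m) - 1 : ℂ) = N ↔ (k : ℤ) + l + n - m - 1 = N := by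
  rw [superDim_idxParity]
  constructor
  · intro h
    have h' : (k : ℂ) + l + n - m - 1 = N := by linear_combination h
    exact_mod_cast h'
  · intro h
    have h' : (k : ℂ) + l + n - m - 1 = N := by exact_mod_cast h
    linear_combination h'

/-- Under `hkl`, k + l + n - m - 1 either exceeds l or is not positive, so maximal vectors do not
involve y_1. A suitable grading t then pins down the whole multidegree. For n = 1 the bound on l is
part of the conclusion, since it shows when no nonzero submodule exists. -/
lemma exists_common_multidegree (hn : 0 < n) {k l : ℕ}
    (hkl : (k : ℤ) > m + 1 - n ∨ (k : ℤ) + l ≤ m + 1 - n) :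
    ∃ ν : (Fin n ⊕ Fin m) ⊕ (Fin n ⊕ Fin m) → ℕ, ∀ U ≤ S.harmonic k l, S.IsUnitStable U → U ≠ ⊥ →
      (n = 1 → l ≤ m) ∧ ∃ f ∈ U, f ≠ 0 ∧ S.IsMultihomog ν f := by
  have hsing : ∀ N : ℕ, 1 ≤ N → N ≤ l →
      (k + l + superDim (idxParity n m) - 1 : ℂ) ≠ N := by
    intro N h1 h2 h3
    rw [singular_iff] at h3
    omega
  obtain ⟨n, rfl⟩ : ∃ n', n = n' + 1 := ⟨n - 1, by omega⟩
  rcases n with _ | n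
  -- All odd indices are ordered strictly below the even one: if ϑ_r occurs, so does every ϑ_s with
  -- s < r, hence the ϑ-part is an initial segment.
  · let t : Fin 1 ⊕ Fin m → ℝ := Sum.elim (fun _ => m) fun r => (r : ℕ)
    refine ⟨Sum.elim (Sum.elim (fun _ => k) 0)
      (Sum.elim 0 fun r => if (r : ℕ) < l then 1 else 0), fun U hUH hU hU0 => ?_⟩
    have ht : ∀ b, b ≠ Sum.inl 0 → t b < t (Sum.inl 0) := by
      rintro (b | b) hb
      · exact absurd (by rw [Subsingleton.elim b 0]) hb
      · exact Nat.cast_lt.mpr b.2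
    obtain ⟨f, hf, hf0, ν, hν, hL, hLo, hRo, hsum, hodd, hdown⟩ :=
      S.exists_isMultihomog_mem (o := Sum.inl 0) rfl hsing t ht hUH hU hU0
    have hodd' : ∀ r, ν (Sum.inr (Sum.inr r)) ≤ 1 := fun r => hodd _ rfl
    have hsum' : ∑ r, ν (Sum.inr (Sum.inr r)) = l := by
      rw [Fintype.sum_sum_type] at hsum
      simpa [hRo] using hsum
    have hseg := Fin.eq_ite_of_initial_segment hodd'
      (fun r s hsr hr => (hdown (Sum.inr r) (Sum.inr s) (by simp) (Nat.cast_lt.mpr hsr) hr).2) hsum'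
    refine ⟨fun _ => ?_, f, hf, hf0, ?_⟩
    · rw [← hsum']
      exact (Finset.sum_le_sum fun r _ => hodd' r).trans (by simp)
    · convert hν using 1
      funext a
      rcases a with (a | a) | (a | a)
      · rw [show a = 0 from Fin.fin_one_eq_zero a]; exact hLo.symm
      · exact (hL _ (by simp)).symm
      · rw [show a = 0 from Fin.fin_one_eq_zero a]; exact hRo.symm
      · exact (hseg a).symm
  -- Three levels suffice: any dual variable other than the last y would have to be lowered onto
  -- that last y, which is even and cannot annihilate.
  · let t : Fin (n + 1 + 1) ⊕ Fin m → ℝ := Sum.elim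
      (fun i => if i = 0 then 2 else if i = Fin.last (n + 1) then 0 else 1) fun _ => 1
    refine ⟨Pi.single (Sum.inl (Sum.inl 0)) k + Pi.single (Sum.inr (Sum.inl (Fin.last (n + 1)))) l,
      fun U hUH hU hU0 => ?_⟩
    have hlast : Fin.last (n + 1) ≠ 0 := Fin.last_pos.ne'
    have ht : ∀ b, b ≠ Sum.inl 0 → t b < t (Sum.inl 0) := by
      rintro (b | b) hb
      · have hb' : b ≠ 0 := fun h => hb (by rw [h])
        simp only [t, Sum.elim_inl, if_true, if_neg hb']
        split_ifs <;> norm_num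
      · simp [t]
    obtain ⟨f, hf, hf0, ν, hν, hL, hLo, hRo, hsum, -, hdown⟩ :=
      S.exists_isMultihomog_mem (o := Sum.inl 0) rfl hsing t ht hUH hU hU0
    have hR : ∀ a, a ≠ Sum.inl (Fin.last (n + 1)) → ν (Sum.inr a) = 0 := by
      intro a ha
      by_contra h0
      have ha0 : a ≠ Sum.inl 0 := fun h => h0 (h ▸ hRo)
      have hta : t (Sum.inl (Fin.last (n + 1))) < t a := by
        rcases a with a | a
        · have h1 : a ≠ 0 := fun h => ha0 (by rw [h])
          have h2 : a ≠ Fin.last (n + 1) := fun h => ha (by rw [h])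
          simp [t, hlast, h1, h2]
        · simp [t, hlast]
      have := (hdown a _ (by simp) hta h0).1
      simp [idxParity] at this
    have hRlast : ν (Sum.inr (Sum.inl (Fin.last (n + 1)))) = l := by
      rw [← hsum]
      exact (Finset.sum_eq_single_of_mem _ (Finset.mem_univ _) fun b _ hb => hR b hb).symm
    refine ⟨fun h => by omega, f, hf, hf0, ?_⟩
    convert hν using 1
    funext a
    rcases a with a | a
    · by_cases ha : a = Sum.inl 0
      · subst ha; simp [hLo]
      · simp [hL a ha, ha]
    · by_cases ha : a = Sum.inl (Fin.last (n + 1))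
      · subst ha; simp [hRlast]
      · simp [hR a ha, ha]

/-- The witnesses are x_1^k ϑ_1⋯ϑ_l for n = 1 and x_1^k y_n^l for n ≥ 2; neither contains a variable
together with its dual. -/
lemma exists_mem_harmonic_of_le (hn : 0 < n) {k l : ℕ} (h : n = 1 → l ≤ m) :
    ∃ (ν : (Fin n ⊕ Fin m) ⊕ (Fin n ⊕ Fin m) → ℕ), ∃ v ∈ S.harmonic k l,
      v ≠ 0 ∧ S.IsMultihomog ν v := by
  obtain ⟨n, rfl⟩ : ∃ n', n = n' + 1 := ⟨n - 1, by omega⟩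
  rcases n with _ | n
  · let ν : (Fin (0 + 1) ⊕ Fin m) ⊕ (Fin (0 + 1) ⊕ Fin m) → ℕ :=
      Sum.elim (Sum.elim (fun _ => k) 0) (Sum.elim 0 fun r => if (r : ℕ) < l then 1 else 0)
    obtain ⟨v, hv0, hv⟩ := S.exists_isMultihomog ν (by
      rintro ((a | a) | (a | a)) ha
      · simp [idxParity] at ha
      · simp [ν]
      · simp [ν]
      · simp only [ν, Sum.elim_inr]; split_ifs <;> omega)
    refine ⟨ν, v, ?_, hv0, hv⟩
    have hmem := hv.mem_harmonic (by rintro (a | a) <;> simp [ν])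
    have e1 : ∑ a, ν (Sum.inl a) = k := by simp [ν]
    have e2 : ∑ a, ν (Sum.inr a) = l := by
      simp only [ν, Sum.elim_inr, Fintype.sum_sum_type, Sum.elim_inl]
      rw [Fin.sum_ite_lt (h rfl)]
      simp
    rwa [e1, e2] at hmem
  · let ν : (Fin (n + 1 + 1) ⊕ Fin m) ⊕ (Fin (n + 1 + 1) ⊕ Fin m) → ℕ :=
      Sum.elim (Pi.single (Sum.inl 0) k) (Pi.single (Sum.inl (Fin.last (n + 1))) l)
    have hlast : Fin.last (n + 1) ≠ 0 := Fin.last_pos.ne'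
    obtain ⟨v, hv0, hv⟩ := S.exists_isMultihomog ν (by
      rintro ((a | a) | (a | a)) ha
      · simp [idxParity] at ha
      · simp [ν]
      · simp [idxParity] at ha
      · simp [ν])
    refine ⟨ν, v, ?_, hv0, hv⟩
    have hmem := hv.mem_harmonic (by
      intro a
      by_cases ha : a = Sum.inl 0
      · subst ha
        right
        simp [ν, hlast.symm]
      · left
        simp [ν, ha])
    have e1 : ∑ a, ν (Sum.inl a) = k := by simp [ν]
    have e2 : ∑ a, ν (Sum.inr a) = l := by simp [ν]
    rwa [e1, e2] at hmem

lemma exists_mem_harmonic (hn : 0 < n) {k l : ℕ} (h : ¬ (n = 1 ∧ m < k ∧ m < l)) :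
    ∃ (ν : (Fin n ⊕ Fin m) ⊕ (Fin n ⊕ Fin m) → ℕ), ∃ v ∈ S.harmonic k l,
      v ≠ 0 ∧ S.IsMultihomog ν v := by
  by_cases hl : n = 1 → l ≤ m
  · exact S.exists_mem_harmonic_of_le hn hl
  · obtain ⟨ν, v, hv, hv0, hν⟩ := S.swap.exists_mem_harmonic_of_le hn (k := l) (l := k)
      (by intro hn1; by_contra hk; exact h ⟨hn1, by omega, by
        by_contra hl'; exact hl fun _ => by omega⟩)
    exact ⟨_, v, by rwa [swap_harmonic] at hv, hv0, hν.of_swap⟩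

theorem harmonic_eq_bot_iff (hn : 0 < n) (k l : ℕ) :
    S.harmonic k l = ⊥ ↔ n = 1 ∧ m < k ∧ m < l := by
  constructor
  · intro h
    by_contra hne
    obtain ⟨-, v, hv, hv0, -⟩ := S.exists_mem_harmonic hn hne
    rw [h, Submodule.mem_bot] at hv
    exact hv0 hv
  · rintro ⟨rfl, hk, hl⟩
    by_contra h0
    obtain ⟨ν, hν⟩ := S.exists_common_multidegree hn (k := k) (l := l) (by left; push_cast; omega)
    have := (hν _ le_rfl (S.isUnitStable_harmonic k l) h0).1 rfl
    omega

variable {S} in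
theorem IsContravariant.isUnitIrreducible_harmonic_iff {B : V →ₗ[ℂ] V →ₗ[ℂ] ℂ}
    (hB : S.IsContravariant B) (het : Function.Injective S.et) (hn : 0 < n) {k l : ℕ}
    (h0 : ¬ (n = 1 ∧ m < k ∧ m < l)) :
    S.IsUnitIrreducible (S.harmonic k l) ↔
      ((k : ℤ) > m + 1 - n ∨ (l : ℤ) > m + 1 - n ∨ (k : ℤ) + l ≤ m + 1 - n) := by
  constructor
  · intro hirr
    by_contra! hcon
    obtain ⟨h1, h2, h3⟩ := hcon
    -- Failure of the three alternatives says exactly that this number lies between 1 and min(k, l).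
    obtain ⟨N, hN⟩ := Int.eq_ofNat_of_zero_le (a := (k : ℤ) + l + n - m - 1) (by omega)
    obtain ⟨ν, v, hv, hv0, hvν⟩ := S.exists_mem_harmonic hn h0
    refine hB.not_isUnitIrreducible_harmonic (N := N) (by omega) (by omega)
      (singular_iff.mpr hN) ?_ het hv hv0 hvν hirr
    rw [Ne, S.harmonic_eq_bot_iff hn]
    rintro ⟨rfl, h4, -⟩
    omega
  · intro h
    have hns : IsNonsingular (idxParity n m) k l := by
      intro N h1 h2 h3
      rw [singular_iff] at h3
      omega
    have hbot : S.harmonic k l ≠ ⊥ := by rwa [Ne, S.harmonic_eq_bot_iff hn]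
    by_cases hk : (k : ℤ) > m + 1 - n ∨ (k : ℤ) + l ≤ m + 1 - n
    · obtain ⟨ν, hν⟩ := S.exists_common_multidegree hn hk
      exact hB.isUnitIrreducible_harmonic hns hbot fun U hU hUs hU0 => (hν U hU hUs hU0).2
    -- Only l > m + 1 - n remains; the common vector is found after exchanging the two halves.
    · obtain ⟨ν, hν⟩ := S.swap.exists_common_multidegree hn (k := l) (l := k) (by omega)
      refine hB.isUnitIrreducible_harmonic hns hbot (ν := ν ∘ Sum.swap) fun U hU hUs hU0 => ?_
      obtain ⟨f, hf, hf0, hfν⟩ := (hν U (by rwa [swap_harmonic]) hUs.swap hU0).2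
      exact ⟨f, hf, hf0, hfν.of_swap⟩

/-- Lowering both degrees by i preserves their difference: a difference above m + 1 - n makes the
critical number exceed twice the smaller degree, while a small sum keeps it nonpositive. -/
lemma isNonsingular_sub {k l : ℕ}
    (h : |(k : ℤ) - l| > m + 1 - n ∨ (k : ℤ) + l ≤ m + 1 - n) (i : ℕ) (_ : i ≤ min k l) :
    IsNonsingular (idxParity n m) (k - i) (l - i) := by
  intro N h1 h2 h3
  rw [singular_iff] at h3
  rcases h with h | h
  · rcases lt_abs.mp h with h | h <;> omega
  · omega

end FockSystem
end

noncomputable section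

namespace SuperHarmonic

/-! ### The oscillator system of the super-polynomial algebra -/

variable {n m : ℕ}

/-- The odd partial derivatives of the exterior algebra. -/
def fermContract (m : ℕ) (p : Ferm m) : Module.End ℂ (FermPart m) :=
  CliffordAlgebra.contractLeft (Q := (0 : QuadraticForm ℂ (Ferm m → ℂ)))
    (LinearMap.proj p : Module.Dual ℂ (Ferm m → ℂ))

lemma mulBos_tmul (a : Bos n) (f : BosPart n) (w : FermPart m) :
    mulBos n m a (f ⊗ₜ w) = (MvPolynomial.X a * f) ⊗ₜ w := by
  simp [mulBos, bosVar]

lemma mulFerm_tmul (p : Ferm m) (f : BosPart n) (w : FermPart m) :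
    mulFerm n m p (f ⊗ₜ w) = f ⊗ₜ (fermGen m p * w) := by
  simp [mulFerm, fermVar]

lemma dBos_tmul (a : Bos n) (f : BosPart n) (w : FermPart m) :
    dBos n m a (f ⊗ₜ w) = MvPolynomial.pderiv a f ⊗ₜ w := by
  simp [dBos]

lemma dFerm_tmul (p : Ferm m) (f : BosPart n) (w : FermPart m) :
    dFerm n m p (f ⊗ₜ w) = f ⊗ₜ fermContract m p w := by
  simp [dFerm, fermContract]

lemma fermGen_mul_fermGen (p q : Ferm m) :
    fermGen m p * fermGen m q = -(fermGen m q * fermGen m p) :=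
  eq_neg_of_add_eq_zero_left (ExteriorAlgebra.ι_add_mul_swap _ _)

lemma fermContract_fermGen_mul (p q : Ferm m) (w : FermPart m) :
    fermContract m p (fermGen m q * w) =
      (if p = q then w else 0) - fermGen m q * fermContract m p w := by
  have h := CliffordAlgebra.contractLeft_ι_mul (Q := (0 : QuadraticForm ℂ (Ferm m → ℂ)))
    (LinearMap.proj p : Module.Dual ℂ (Ferm m → ℂ)) (Pi.single q 1) w
  have h2 : (LinearMap.proj p : Module.Dual ℂ (Ferm m → ℂ)) (Pi.single q 1) • w =
      if p = q then w else 0 := by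
    simp [Pi.single_apply, ite_smul]
  rw [h2] at h
  exact h

lemma pderiv_pderiv_comm {σ : Type*} (a b : σ) (f : MvPolynomial σ ℂ) :
    MvPolynomial.pderiv a (MvPolynomial.pderiv b f) =
      MvPolynomial.pderiv b (MvPolynomial.pderiv a f) := by
  classical
  have h : ⁅(MvPolynomial.pderiv a : Derivation ℂ (MvPolynomial σ ℂ) (MvPolynomial σ ℂ)),
      (MvPolynomial.pderiv b : Derivation ℂ (MvPolynomial σ ℂ) (MvPolynomial σ ℂ))⁆ = 0 := by
    refine MvPolynomial.derivation_ext (R := ℂ) (A := MvPolynomial σ ℂ) fun i => ?_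
    rw [Derivation.commutator_apply]
    simp only [MvPolynomial.pderiv_X, Derivation.coe_zero, Pi.zero_apply, Pi.single_apply]
    split_ifs <;> simp
  have h1 := congrArg (fun D : Derivation ℂ (MvPolynomial σ ℂ) (MvPolynomial σ ℂ) => D f) h
  simp only [Derivation.commutator_apply, Derivation.coe_zero, Pi.zero_apply] at h1
  exact sub_eq_zero.mp h1

lemma mulBos_mulBos (a b : Bos n) : mulBos n m a * mulBos n m b = mulBos n m b * mulBos n m a :=
  TensorProduct.ext' fun f w => by simp [mulBos_tmul, mul_left_comm]

lemma mulBos_mulFerm (a : Bos n) (p : Ferm m) :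
    mulBos n m a * mulFerm n m p = mulFerm n m p * mulBos n m a :=
  TensorProduct.ext' fun f w => by simp [mulBos_tmul, mulFerm_tmul]

lemma mulFerm_mulFerm (p q : Ferm m) :
    mulFerm n m p * mulFerm n m q = -(mulFerm n m q * mulFerm n m p) :=
  TensorProduct.ext' fun f w => by
    simp [mulFerm_tmul, ← mul_assoc, fermGen_mul_fermGen p q, TensorProduct.tmul_neg]

lemma dBos_dBos (a b : Bos n) : dBos n m a * dBos n m b = dBos n m b * dBos n m a :=
  TensorProduct.ext' fun f w => by simp [dBos_tmul, pderiv_pderiv_comm a b]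

lemma dBos_dFerm (a : Bos n) (p : Ferm m) : dBos n m a * dFerm n m p = dFerm n m p * dBos n m a :=
  TensorProduct.ext' fun f w => by simp [dBos_tmul, dFerm_tmul]

lemma fermContract_fermContract (p q : Ferm m) (w : FermPart m) :
    fermContract m p (fermContract m q w) = -fermContract m q (fermContract m p w) :=
  CliffordAlgebra.contractLeft_comm _ _ _

lemma dFerm_dFerm (p q : Ferm m) :
    dFerm n m p * dFerm n m q = -(dFerm n m q * dFerm n m p) :=
  TensorProduct.ext' fun f w => by
    simp [dFerm_tmul, fermContract_fermContract p q, TensorProduct.tmul_neg]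

lemma dBos_mulBos (a b : Bos n) :
    dBos n m a * mulBos n m b = mulBos n m b * dBos n m a + if a = b then 1 else 0 :=
  TensorProduct.ext' fun f w => by
    simp only [Module.End.mul_apply, mulBos_tmul, dBos_tmul, MvPolynomial.pderiv_mul,
      MvPolynomial.pderiv_X, LinearMap.add_apply, TensorProduct.add_tmul, Pi.single_apply,
      eq_comm (a := b)]
    split_ifs <;> simp [add_comm]

lemma dBos_mulFerm (a : Bos n) (p : Ferm m) :
    dBos n m a * mulFerm n m p = mulFerm n m p * dBos n m a :=
  TensorProduct.ext' fun f w => by simp [mulFerm_tmul, dBos_tmul]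

lemma dFerm_mulBos (p : Ferm m) (a : Bos n) :
    dFerm n m p * mulBos n m a = mulBos n m a * dFerm n m p :=
  TensorProduct.ext' fun f w => by simp [mulBos_tmul, dFerm_tmul]

lemma dFerm_mulFerm (p q : Ferm m) :
    dFerm n m p * mulFerm n m q = -(mulFerm n m q * dFerm n m p) + if p = q then 1 else 0 :=
  TensorProduct.ext' fun f w => by
    simp only [Module.End.mul_apply, mulFerm_tmul, dFerm_tmul, fermContract_fermGen_mul,
      LinearMap.add_apply, LinearMap.neg_apply, TensorProduct.tmul_sub]
    split_ifs <;> simp [sub_eq_neg_add]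

/-- The operators of multiplication by the variables of `𝒜`. -/
def creation (n m : ℕ) : (Fin n ⊕ Fin m) ⊕ (Fin n ⊕ Fin m) → Module.End ℂ (SuperPoly n m)
  | Sum.inl (Sum.inl i) => mulBos n m (Sum.inl i)
  | Sum.inl (Sum.inr r) => mulFerm n m (Sum.inl r)
  | Sum.inr (Sum.inl i) => mulBos n m (Sum.inr i)
  | Sum.inr (Sum.inr r) => mulFerm n m (Sum.inr r)

/-- The partial derivatives along the variables of `𝒜`. -/
def annihilation (n m : ℕ) : (Fin n ⊕ Fin m) ⊕ (Fin n ⊕ Fin m) → Module.End ℂ (SuperPoly n m)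
  | Sum.inl (Sum.inl i) => dBos n m (Sum.inl i)
  | Sum.inl (Sum.inr r) => dFerm n m (Sum.inl r)
  | Sum.inr (Sum.inl i) => dBos n m (Sum.inr i)
  | Sum.inr (Sum.inr r) => dFerm n m (Sum.inr r)

lemma apply_apply_eq_superSign_smul {V : Type*} [AddCommGroup V] [Module ℂ V]
    {A B : Module.End ℂ V} {i j : ZMod 2}
    (h : A * B = if i = 1 ∧ j = 1 then -(B * A) else B * A) (f : V) :
    A (B f) = superSign i j • B (A f) := by
  rw [← Module.End.mul_apply, h]
  rcases i.eq_zero_or_one_of_two with rfl | rfl <;>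
    rcases j.eq_zero_or_one_of_two with rfl | rfl <;> simp

lemma apply_apply_eq_superSign_smul_add {V : Type*} [AddCommGroup V] [Module ℂ V]
    {A B : Module.End ℂ V} {i j : ZMod 2} {P : Prop} [Decidable P]
    (h : A * B = (if i = 1 ∧ j = 1 then -(B * A) else B * A) + if P then 1 else 0) (f : V) :
    A (B f) = superSign i j • B (A f) + if P then f else 0 := by
  rw [← Module.End.mul_apply, h]
  rcases i.eq_zero_or_one_of_two with rfl | rfl <;>
    rcases j.eq_zero_or_one_of_two with rfl | rfl <;> by_cases hP : P <;> simp [hP]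

/-- The oscillator system of `𝒜`. -/
def oscSystem (n m : ℕ) : OscSystem (idxParity n m) (SuperPoly n m) where
  c := creation n m
  d := annihilation n m
  c_c := by
    intro a b f
    refine apply_apply_eq_superSign_smul ?_ f
    rcases a with (a | a) | (a | a) <;> rcases b with (b | b) | (b | b) <;>
      simp only [creation, varParity_inl, varParity_inr, idxParity, zero_ne_one, false_and,
        and_false, and_self, if_true, if_false] <;>
      first
        | with_reducible exact mulBos_mulBos _ _
        | with_reducible exact mulBos_mulFerm _ _
        | with_reducible exact (mulBos_mulFerm _ _).symm
        | with_reducible exact mulFerm_mulFerm _ _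
  d_d := by
    intro a b f
    refine apply_apply_eq_superSign_smul ?_ f
    rcases a with (a | a) | (a | a) <;> rcases b with (b | b) | (b | b) <;>
      simp only [annihilation, varParity_inl, varParity_inr, idxParity, zero_ne_one, false_and,
        and_false, and_self, if_true, if_false] <;>
      first
        | with_reducible exact dBos_dBos _ _
        | with_reducible exact dBos_dFerm _ _
        | with_reducible exact (dBos_dFerm _ _).symm
        | with_reducible exact dFerm_dFerm _ _
  d_c := by
    intro a b f
    refine apply_apply_eq_superSign_smul_add ?_ f
    rcases a with (a | a) | (a | a) <;> rcases b with (b | b) | (b | b) <;>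
      simp only [creation, annihilation, varParity_inl, varParity_inr, idxParity, zero_ne_one,
        false_and, and_false, and_self, if_true, if_false,
        dBos_mulBos, dBos_mulFerm, dFerm_mulBos, dFerm_mulFerm, Sum.inl.injEq, Sum.inr.injEq,
        reduceCtorEq, add_zero]

lemma _root_.OscSystem.unit_eq_ite {α : Type*} [DecidableEq α] {p : α → ZMod 2} {V : Type*}
    [AddCommGroup V] [Module ℂ V] (S : OscSystem p V) (a b : α) :
    S.unit a b = if p a = 1 ∧ p b = 0
      then S.c (Sum.inl a) * S.d (Sum.inl b) + S.c (Sum.inr b) * S.d (Sum.inr a)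
      else S.c (Sum.inl a) * S.d (Sum.inl b) - S.c (Sum.inr b) * S.d (Sum.inr a) := by
  rcases (p a).eq_zero_or_one_of_two with ha | ha <;>
    rcases (p b).eq_zero_or_one_of_two with hb | hb <;>
    simp [OscSystem.unit, OscSystem.quad, ha, hb]

lemma oscSystem_unit (a b : Fin n ⊕ Fin m) : (oscSystem n m).unit a b = unitAction n m a b := by
  rw [OscSystem.unit_eq_ite]
  rcases a with a | a <;> rcases b with b | b <;>
    simp [oscSystem, creation, annihilation, idxParity, unitAction]

lemma oscSystem_lap : (oscSystem n m).lap = superLaplacian n m := by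
  simp [OscSystem.lap, oscSystem, annihilation, superLaplacian, Fintype.sum_sum_type]

lemma oscSystem_et : (oscSystem n m).et = LinearMap.mulLeft ℂ (eta n m) := by
  refine LinearMap.ext fun f => ?_
  simp [OscSystem.et_apply, oscSystem, creation, eta, Fintype.sum_sum_type, mulBos, mulFerm,
    add_mul, Finset.sum_mul, mul_assoc]

end SuperHarmonic
end

/-! ### Bihomogeneous parts as joint eigenspaces, and the Fock system of 𝒜 -/

noncomputable section

/-- An independent family is determined by a spanning family of smaller subspaces. -/
lemma iSupIndep.eq_of_le_of_iSup_eq_top {ι R M : Type*} [Ring R] [AddCommGroup M] [Module R M]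
    {f g : ι → Submodule R M} (hg : iSupIndep g) (hfg : ∀ i, f i ≤ g i) (hf : ⨆ i, f i = ⊤)
    (i : ι) : f i = g i := by
  refine le_antisymm (hfg i) fun x hx => ?_
  have h1 : x ∈ f i ⊔ ⨆ j, ⨆ (_ : j ≠ i), f j := by
    have : (⨆ j, f j) ≤ f i ⊔ ⨆ j, ⨆ (_ : j ≠ i), f j := by
      refine iSup_le fun j => ?_
      by_cases hj : j = i
      · exact hj ▸ le_sup_left
      · exact (le_iSup₂ (f := fun j (_ : j ≠ i) => f j) j hj).trans le_sup_right
    exact this (hf ▸ Submodule.mem_top)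
  obtain ⟨y, hy, z, hz, rfl⟩ := Submodule.mem_sup.mp h1
  have hzi : z ∈ g i := by simpa using Submodule.sub_mem _ hx (hfg i hy)
  have hz' : z ∈ ⨆ j, ⨆ (_ : j ≠ i), g j := iSup₂_mono (fun j _ => hfg j) hz
  have : z = 0 := (Submodule.disjoint_def.mp (hg i)) z hzi hz'
  rw [this, add_zero]
  exact hy

namespace SuperHarmonic

variable {n m : ℕ}

/-- The joint eigenspaces of the two degree operators. -/
def degEigenspace (n m : ℕ) (k l : ℂ) : Submodule ℂ (SuperPoly n m) :=
  Module.End.eigenspace (oscSystem n m).degL k ⊓ Module.End.eigenspace (oscSystem n m).degR l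

lemma mem_degEigenspace {k l : ℂ} {f : SuperPoly n m} : f ∈ degEigenspace n m k l ↔
    (oscSystem n m).degL f = k • f ∧ (oscSystem n m).degR f = l • f := by
  simp [degEigenspace]

lemma creation_inl_mem {k l : ℂ} {f : SuperPoly n m} (hf : f ∈ degEigenspace n m k l)
    (a : Fin n ⊕ Fin m) : creation n m (Sum.inl a) f ∈ degEigenspace n m (k + 1) l := by
  rw [mem_degEigenspace] at hf ⊢
  have h1 := (oscSystem n m).degL_c_inl a f
  have h2 := (oscSystem n m).degR_c_inl a f
  rw [hf.1, map_smul] at h1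
  rw [hf.2, map_smul] at h2
  refine ⟨h1.trans ?_, h2⟩
  rw [add_smul, one_smul]
  rfl

lemma creation_inr_mem {k l : ℂ} {f : SuperPoly n m} (hf : f ∈ degEigenspace n m k l)
    (a : Fin n ⊕ Fin m) : creation n m (Sum.inr a) f ∈ degEigenspace n m k (l + 1) := by
  rw [mem_degEigenspace] at hf ⊢
  have h1 := (oscSystem n m).degL_c_inr a f
  have h2 := (oscSystem n m).degR_c_inr a f
  rw [hf.1, map_smul] at h1
  rw [hf.2, map_smul] at h2
  refine ⟨h1, h2.trans ?_⟩
  rw [add_smul, one_smul]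
  rfl

lemma annihilation_one (a : (Fin n ⊕ Fin m) ⊕ (Fin n ⊕ Fin m)) :
    annihilation n m a (1 : SuperPoly n m) = 0 := by
  rw [Algebra.TensorProduct.one_def]
  rcases a with (a | a) | (a | a) <;>
    simp [annihilation, dBos_tmul, dFerm_tmul, fermContract]

lemma one_mem_degEigenspace : (1 : SuperPoly n m) ∈ degEigenspace n m 0 0 := by
  have h : ∀ a, (oscSystem n m).num a (1 : SuperPoly n m) = 0 := fun a => by
    rw [OscSystem.num_apply]
    exact (congrArg _ (annihilation_one a)).trans (map_zero _)
  rw [mem_degEigenspace, OscSystem.degL_apply, OscSystem.degR_apply]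
  simp [h]

lemma one_tmul_mem_degEigenspace {k l : ℕ} {w : FermPart m}
    (hw : w ∈ thetaSpan m ^ k * varthetaSpan m ^ l) :
    ((1 : BosPart n) ⊗ₜ[ℂ] w : SuperPoly n m) ∈ degEigenspace n m k l := by
  have step : ∀ {k l k' l' : ℂ} {c : Fin m → Ferm m}
      (_ : ∀ r (f : SuperPoly n m), f ∈ degEigenspace n m k l →
        mulFerm n m (c r) f ∈ degEigenspace n m k' l')
      {x u : FermPart m}, x ∈ Submodule.span ℂ (Set.range fun r => fermGen m (c r)) →
      ((1 : BosPart n) ⊗ₜ[ℂ] u : SuperPoly n m) ∈ degEigenspace n m k l →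
      ((1 : BosPart n) ⊗ₜ[ℂ] (x * u) : SuperPoly n m) ∈ degEigenspace n m k' l' := by
    intro k l k' l' c hc x u hx hu
    induction hx using Submodule.span_induction with
    | mem x hx =>
      obtain ⟨r, rfl⟩ := hx
      have := hc r _ hu
      rwa [mulFerm_tmul] at this
    | zero => simp
    | add x y _ _ ihx ihy =>
      rw [add_mul, TensorProduct.tmul_add]
      exact Submodule.add_mem _ ihx ihy
    | smul t x _ ih =>
      rw [smul_mul_assoc, TensorProduct.tmul_smul]
      exact Submodule.smul_mem _ _ ih
  induction k generalizing w with
  | zero =>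
    rw [pow_zero, one_mul] at hw
    induction l generalizing w with
    | zero =>
      rw [pow_zero] at hw
      obtain ⟨t, rfl⟩ := Submodule.mem_one.mp hw
      rw [Algebra.algebraMap_eq_smul_one, TensorProduct.tmul_smul, Nat.cast_zero]
      exact Submodule.smul_mem _ t (one_mem_degEigenspace (n := n) (m := m))
    | succ l ih =>
      rw [pow_succ'] at hw
      induction hw using Submodule.mul_induction_on' with
      | mem_mul_mem x hx u hu =>
        rw [Nat.cast_succ]
        exact step (c := Sum.inr) (fun r f hf => creation_inr_mem hf (Sum.inr r)) hx (ih hu)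
      | add x _ y _ ihx ihy =>
        rw [TensorProduct.tmul_add]
        exact Submodule.add_mem _ ihx ihy
  | succ k ih =>
    rw [pow_succ', mul_assoc] at hw
    induction hw using Submodule.mul_induction_on' with
    | mem_mul_mem x hx u hu =>
      push_cast
      exact step (c := Sum.inl) (fun r f hf => creation_inl_mem hf (Sum.inr r)) hx (ih hu)
    | add x _ y _ ihx ihy =>
      rw [TensorProduct.tmul_add]
      exact Submodule.add_mem _ ihx ihy

lemma monomial_mul_mem_degEigenspace (γ : Bos n →₀ ℕ) {k l : ℂ} {f : SuperPoly n m}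
    (hf : f ∈ degEigenspace n m k l) :
    (MvPolynomial.monomial γ (1 : ℂ) ⊗ₜ[ℂ] (1 : FermPart m) : SuperPoly n m) * f ∈
      degEigenspace n m (k + (∑ i, γ (Sum.inl i) : ℕ)) (l + (∑ i, γ (Sum.inr i) : ℕ)) := by
  classical
  induction γ using Finsupp.induction_linear generalizing k l f with
  | zero =>
    have h1 : (MvPolynomial.monomial (0 : Bos n →₀ ℕ) (1 : ℂ) ⊗ₜ[ℂ] (1 : FermPart m) :
        SuperPoly n m) = 1 := rfl
    rw [h1, one_mul]
    simpa using hf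
  | add γ γ' h h' =>
    have h1 : (MvPolynomial.monomial (γ + γ') (1 : ℂ) ⊗ₜ[ℂ] (1 : FermPart m) : SuperPoly n m) =
        (MvPolynomial.monomial γ (1 : ℂ) ⊗ₜ[ℂ] (1 : FermPart m)) *
        (MvPolynomial.monomial γ' (1 : ℂ) ⊗ₜ[ℂ] (1 : FermPart m)) := by
      rw [Algebra.TensorProduct.tmul_mul_tmul, MvPolynomial.monomial_mul, one_mul, one_mul]
    have h2 := h (h' hf)
    rw [h1, mul_assoc]
    simp only [Finsupp.add_apply, Finset.sum_add_distrib, Nat.cast_add] at h2 ⊢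
    rwa [add_comm ((∑ i, γ (Sum.inl i) : ℕ) : ℂ), add_comm ((∑ i, γ (Sum.inr i) : ℕ) : ℂ),
      ← add_assoc, ← add_assoc]
  | single a j =>
    induction j with
    | zero =>
      have h1 : (MvPolynomial.monomial (Finsupp.single a 0) (1 : ℂ) ⊗ₜ[ℂ] (1 : FermPart m) :
          SuperPoly n m) = 1 := by rw [Finsupp.single_zero]; rfl
      rw [h1, one_mul]
      simpa using hf
    | succ j ih =>
      have h1 : (MvPolynomial.monomial (Finsupp.single a (j + 1)) (1 : ℂ) ⊗ₜ[ℂ] (1 : FermPart m) :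
          SuperPoly n m) * f =
          mulBos n m a ((MvPolynomial.monomial (Finsupp.single a j) (1 : ℂ) ⊗ₜ[ℂ] 1) * f) := by
        rw [mulBos, LinearMap.mulLeft_apply, bosVar, ← mul_assoc,
          Algebra.TensorProduct.tmul_mul_tmul, MvPolynomial.X, MvPolynomial.monomial_mul, one_mul,
          one_mul, ← Finsupp.single_add, add_comm 1 j]
      rw [h1]
      rcases a with a | a
      · have h2 := creation_inl_mem ih (Sum.inl a)
        simp only [Finsupp.single_apply, Sum.inl.injEq, Finset.sum_ite_eq, Finset.mem_univ,
          if_true, reduceCtorEq, if_false, Finset.sum_const_zero] at h2 ⊢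
        rwa [Nat.cast_succ, ← add_assoc]
      · have h2 := creation_inr_mem ih (Sum.inl a)
        simp only [Finsupp.single_apply, Sum.inr.injEq, Finset.sum_ite_eq, Finset.mem_univ,
          if_true, reduceCtorEq, if_false, Finset.sum_const_zero] at h2 ⊢
        rwa [Nat.cast_succ, ← add_assoc]

theorem biHom_le (k l : ℕ) : biHom n m k l ≤ degEigenspace n m k l := by
  refine Submodule.span_le.mpr ?_
  rintro f ⟨γ, i, j, w, hw, rfl, rfl, rfl⟩
  have := monomial_mul_mem_degEigenspace γ (one_tmul_mem_degEigenspace (n := n) hw)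
  rwa [Algebra.TensorProduct.tmul_mul_tmul, mul_one, one_mul, ← Nat.cast_add, ← Nat.cast_add,
    add_comm i, add_comm j] at this

/-- Anticommutation allows reordering into the normal form with all θ before all ϑ. -/
lemma varthetaSpan_mul_thetaSpan_pow_le (k : ℕ) :
    varthetaSpan m * thetaSpan m ^ k ≤ thetaSpan m ^ k * varthetaSpan m := by
  induction k with
  | zero => simp
  | succ k ih =>
    have h1 : varthetaSpan m * thetaSpan m ≤ thetaSpan m * varthetaSpan m := by
      rw [varthetaSpan, thetaSpan, Submodule.span_mul_span, Submodule.span_le]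
      rintro _ ⟨_, ⟨r, rfl⟩, _, ⟨s, rfl⟩, rfl⟩
      change fermGen m (Sum.inr r) * fermGen m (Sum.inl s) ∈ _
      rw [fermGen_mul_fermGen]
      exact Submodule.neg_mem _ (Submodule.mul_mem_mul
        (Submodule.subset_span ⟨s, rfl⟩) (Submodule.subset_span ⟨r, rfl⟩))
    calc varthetaSpan m * thetaSpan m ^ (k + 1)
        = (varthetaSpan m * thetaSpan m ^ k) * thetaSpan m := by rw [pow_succ, mul_assoc]
      _ ≤ (thetaSpan m ^ k * varthetaSpan m) * thetaSpan m := mul_le_mul' ih le_rfl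
      _ = thetaSpan m ^ k * (varthetaSpan m * thetaSpan m) := by rw [mul_assoc]
      _ ≤ thetaSpan m ^ k * (thetaSpan m * varthetaSpan m) := mul_le_mul' le_rfl h1
      _ = thetaSpan m ^ (k + 1) * varthetaSpan m := by rw [pow_succ, mul_assoc]

lemma fermGen_mul_mem {k l : ℕ} {w : FermPart m}
    (hw : w ∈ thetaSpan m ^ k * varthetaSpan m ^ l) (p : Ferm m) :
    fermGen m p * w ∈ ⨆ kl : ℕ × ℕ, thetaSpan m ^ kl.1 * varthetaSpan m ^ kl.2 := by
  rcases p with r | r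
  · refine Submodule.mem_iSup_of_mem (k + 1, l) ?_
    rw [pow_succ', mul_assoc]
    exact Submodule.mul_mem_mul (Submodule.subset_span ⟨r, rfl⟩) hw
  · refine Submodule.mem_iSup_of_mem (k, l + 1) ?_
    rw [pow_succ', ← mul_assoc]
    have h1 : fermGen m (Sum.inr r) * w ∈ varthetaSpan m * (thetaSpan m ^ k * varthetaSpan m ^ l) :=
      Submodule.mul_mem_mul (Submodule.subset_span ⟨r, rfl⟩) hw
    rw [← mul_assoc] at h1
    exact mul_le_mul' (varthetaSpan_mul_thetaSpan_pow_le k) le_rfl h1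

lemma ι_eq_sum (v : Ferm m → ℂ) :
    ExteriorAlgebra.ι ℂ v = ∑ p, v p • fermGen m p := by
  conv_lhs => rw [← Finset.univ_sum_single v, map_sum]
  refine Finset.sum_congr rfl fun p _ => ?_
  rw [fermGen, ← map_smul, ← Pi.single_smul, smul_eq_mul, mul_one]

lemma iSup_thetaSpan_mul_varthetaSpan :
    ⨆ kl : ℕ × ℕ, thetaSpan m ^ kl.1 * varthetaSpan m ^ kl.2 = ⊤ := by
  rw [eq_top_iff]
  rintro w -
  induction w using CliffordAlgebra.left_induction with
  | algebraMap t =>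
    refine Submodule.mem_iSup_of_mem (0, 0) ?_
    rw [pow_zero, pow_zero, one_mul]
    exact Submodule.mem_one.mpr ⟨t, rfl⟩
  | add x y hx hy => exact Submodule.add_mem _ hx hy
  | ι_mul x v hx =>
    have hv : (CliffordAlgebra.ι (0 : QuadraticForm ℂ (Ferm m → ℂ)) v : FermPart m) =
      ∑ p, v p • fermGen m p := ι_eq_sum v
    rw [hv, Finset.sum_mul]
    refine Submodule.sum_mem _ fun p _ => ?_
    rw [smul_mul_assoc]
    refine Submodule.smul_mem _ _ ?_
    induction hx using Submodule.iSup_induction' with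
    | mem kl x hx => exact fermGen_mul_mem hx p
    | zero => simp
    | add x y _ _ ihx ihy => rw [mul_add]; exact Submodule.add_mem _ ihx ihy

lemma iSup_biHom : ⨆ kl : ℕ × ℕ, biHom n m kl.1 kl.2 = ⊤ := by
  rw [eq_top_iff]
  rintro f -
  induction f using TensorProduct.induction_on with
  | zero => exact Submodule.zero_mem _
  | add x y hx hy => exact Submodule.add_mem _ hx hy
  | tmul f w =>
    induction f using MvPolynomial.induction_on' with
    | add p q hp hq => rw [TensorProduct.add_tmul]; exact Submodule.add_mem _ hp hq
    | monomial γ t =>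
      have h1 : MvPolynomial.monomial γ t = t • MvPolynomial.monomial γ (1 : ℂ) := by
        rw [MvPolynomial.smul_monomial, smul_eq_mul, mul_one]
      rw [h1, ← TensorProduct.smul_tmul']
      refine Submodule.smul_mem _ _ ?_
      have hw : w ∈ ⨆ kl : ℕ × ℕ, thetaSpan m ^ kl.1 * varthetaSpan m ^ kl.2 := by
        rw [iSup_thetaSpan_mul_varthetaSpan]; exact Submodule.mem_top
      induction hw using Submodule.iSup_induction' with
      | mem kl w hw =>
        exact Submodule.mem_iSup_of_mem (_, _) (Submodule.subset_span
          ⟨γ, kl.1, kl.2, w, hw, rfl, rfl, rfl⟩)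
      | zero => simp
      | add x y _ _ ihx ihy => rw [TensorProduct.tmul_add]; exact Submodule.add_mem _ ihx ihy

/-- The bihomogeneous parts span and lie in independent joint eigenspaces, so each fills its
eigenspace. -/
theorem biHom_eq (k l : ℕ) : biHom n m k l = degEigenspace n m k l := by
  -- One operator separates all bidegrees, since k + il determines (k, l).
  let T := (oscSystem n m).degL + Complex.I • (oscSystem n m).degR
  let e : ℕ × ℕ → ℂ := fun kl => kl.1 + Complex.I * kl.2
  have he : Function.Injective e := by
    rintro ⟨a, b⟩ ⟨c, d⟩ h
    have h1 := congrArg Complex.re h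
    have h2 := congrArg Complex.im h
    simp [e] at h1 h2
    rw [h1, h2]
  have hle : ∀ kl : ℕ × ℕ,
      degEigenspace n m kl.1 kl.2 ≤ Module.End.eigenspace T (e kl) := by
    intro kl f hf
    rw [mem_degEigenspace] at hf
    rw [Module.End.mem_eigenspace_iff]
    simp only [T, e, LinearMap.add_apply, LinearMap.smul_apply, hf.1, hf.2]
    module
  have hind : iSupIndep fun kl : ℕ × ℕ => degEigenspace n m kl.1 kl.2 :=
    ((Module.End.eigenspaces_iSupIndep T).comp he).mono hle
  exact hind.eq_of_le_of_iSup_eq_top (fun kl => biHom_le kl.1 kl.2) iSup_biHom (k, l)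

/-- Eigenspaces for natural eigenvalues already span, leaving no room for the eigenvalue -1. -/
lemma eq_zero_of_eigenvalue_neg_one {T : Module.End ℂ (SuperPoly n m)} (e : ℕ × ℕ → ℕ)
    (hT : ∀ kl : ℕ × ℕ, degEigenspace n m kl.1 kl.2 ≤ Module.End.eigenspace T (e kl : ℂ))
    {f : SuperPoly n m} (h : T f = -f) : f = 0 := by
  have hdisj := Module.End.eigenspaces_iSupIndep T (-1)
  have htop : ⨆ j, ⨆ (_ : j ≠ (-1 : ℂ)), Module.End.eigenspace T j = ⊤ := by
    rw [eq_top_iff, ← iSup_biHom (n := n) (m := m)]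
    refine iSup_le fun kl => ?_
    rw [biHom_eq]
    refine (hT kl).trans ?_
    refine le_iSup₂ (f := fun (j : ℂ) (_ : j ≠ -1) => Module.End.eigenspace T j) (e kl : ℂ) ?_
    intro h
    have := congrArg Complex.re h
    simp at this
    have h0 : (0 : ℝ) ≤ (e kl : ℝ) := Nat.cast_nonneg _
    linarith
  rw [htop, disjoint_top] at hdisj
  have : f ∈ Module.End.eigenspace T (-1) := by
    rw [Module.End.mem_eigenspace_iff, h, neg_smul, one_smul]
  rwa [hdisj, Submodule.mem_bot] at this

lemma mulBos_injective (a : Bos n) : Function.Injective (mulBos n m a) := by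
  have h : mulBos n m a = LinearMap.rTensor (FermPart m)
      (LinearMap.mulLeft ℂ (MvPolynomial.X a : BosPart n)) :=
    TensorProduct.ext' fun f w => by simp [mulBos_tmul]
  rw [h]
  refine Module.Flat.rTensor_preserves_injective_linearMap _ ?_
  exact mul_right_injective₀ (MvPolynomial.X_ne_zero a)

lemma mem_biHom_zero {f : SuperPoly n m} (hf : f ∈ biHom n m 0 0) : ∃ t : ℂ, f = t • 1 := by
  induction hf using Submodule.span_induction with
  | mem f hf =>
    obtain ⟨γ, i, j, w, hw, h1, h2, rfl⟩ := hf
    have hγ : γ = 0 := by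
      ext a
      rcases a with a | a
      · exact Finset.sum_eq_zero_iff.mp (by omega : ∑ i, γ (Sum.inl i) = 0) a (Finset.mem_univ a)
      · exact Finset.sum_eq_zero_iff.mp (by omega : ∑ i, γ (Sum.inr i) = 0) a (Finset.mem_univ a)
    obtain ⟨rfl, rfl⟩ : i = 0 ∧ j = 0 := by omega
    rw [pow_zero, pow_zero, one_mul] at hw
    obtain ⟨t, rfl⟩ := Submodule.mem_one.mp hw
    refine ⟨t, ?_⟩
    rw [hγ, Algebra.algebraMap_eq_smul_one, TensorProduct.tmul_smul,
      Algebra.TensorProduct.one_def]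
    rfl
  | zero => exact ⟨0, by simp⟩
  | add x y _ _ hx hy =>
    obtain ⟨s, rfl⟩ := hx
    obtain ⟨t, rfl⟩ := hy
    exact ⟨s + t, by rw [add_smul]⟩
  | smul t x _ hx =>
    obtain ⟨s, rfl⟩ := hx
    exact ⟨t * s, by rw [mul_smul]⟩

/-- The Fock system of `𝒜`. -/
def fockSystem (n m : ℕ) : FockSystem (idxParity n m) (SuperPoly n m) where
  toOscSystem := oscSystem n m
  c_injective := by
    rintro ((a | a) | (a | a)) h
    · exact mulBos_injective _
    · simp [idxParity] at h
    · exact mulBos_injective _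
    · simp [idxParity] at h
  eq_zero_of_degL := fun f h => eq_zero_of_eigenvalue_neg_one Prod.fst (fun _ => inf_le_left) h
  eq_zero_of_degR := fun f h => eq_zero_of_eigenvalue_neg_one Prod.snd (fun _ => inf_le_right) h
  vac := 1
  vac_ne_zero := by
    have : Nontrivial (SuperPoly n m) := (Algebra.TensorProduct.includeLeft_injective (S := ℂ)
      (A := BosPart n) (B := FermPart m) (algebraMap ℂ (FermPart m)).injective).nontrivial
    exact one_ne_zero
  degL_vac := by
    simpa using (mem_degEigenspace.mp (one_mem_degEigenspace (n := n) (m := m))).1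
  degR_vac := by
    simpa using (mem_degEigenspace.mp (one_mem_degEigenspace (n := n) (m := m))).2
  eq_smul_vac := by
    intro f h1 h2
    apply mem_biHom_zero
    rw [biHom_eq, mem_degEigenspace]
    simp [h1, h2]

end SuperHarmonic
end

noncomputable section

/-- The sum of a left-regular element and a commuting nilpotent element is left-regular. -/
lemma Commute.mul_left_injective_add_of_isNilpotent {R : Type*} [Ring R] {a b : R}
    (hab : Commute a b) (ha : ∀ f, a * f = 0 → f = 0) (hb : IsNilpotent b) {f : R}
    (hf : (a + b) * f = 0) : f = 0 := by
  obtain ⟨N, hN⟩ := hb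
  have h1 : a * f = -b * f := by
    rw [add_mul] at hf
    rw [neg_mul]
    exact eq_neg_of_add_eq_zero_left hf
  -- For k large the right side vanishes by nilpotency, and a^k can then be cancelled.
  have h2 : ∀ k, a ^ k * f = (-b) ^ k * f := by
    intro k
    induction k with
    | zero => simp
    | succ k ih =>
      have h3 : a ^ k * -b = -b * a ^ k := (hab.neg_right.pow_left k).eq
      rw [pow_succ, mul_assoc, h1, ← mul_assoc, h3, mul_assoc, ih, ← mul_assoc, ← pow_succ']
  have h3 : ∀ k, a ^ k * f = 0 → f = 0 := by
    intro k
    induction k with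
    | zero => simp
    | succ k ih =>
      intro h
      rw [pow_succ', mul_assoc] at h
      exact ih (ha _ h)
  apply h3 N
  rw [h2, neg_pow, hN, mul_zero, zero_mul]

namespace SuperHarmonic

variable {n m : ℕ}

/-! ### Multiplication by the invariant is injective -/

lemma commute_fermGen_mul_fermGen (p q r s : Ferm m) :
    Commute (fermGen m p * fermGen m q) (fermGen m r * fermGen m s) := by
  have h : ∀ t, Commute (fermGen m p * fermGen m q) (fermGen m t) := by
    intro t
    rw [commute_iff_eq, mul_assoc, fermGen_mul_fermGen q t, mul_neg, ← mul_assoc,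
      fermGen_mul_fermGen p t, neg_mul, neg_neg, mul_assoc]
  exact (h r).mul_right (h s)

lemma fermGen_mul_self (p : Ferm m) : fermGen m p * fermGen m p = 0 :=
  ExteriorAlgebra.ι_sq_zero _

lemma eta_eq (n m : ℕ) : eta n m =
    (∑ i, MvPolynomial.X (Sum.inl i) * MvPolynomial.X (Sum.inr i) : BosPart n) ⊗ₜ[ℂ] 1 +
      1 ⊗ₜ[ℂ] (∑ r, fermGen m (Sum.inl r) * fermGen m (Sum.inr r)) := by
  simp [eta, bosVar, fermVar, TensorProduct.sum_tmul, TensorProduct.tmul_sum]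

/-- The even part ∑ x_i y_i of η is a nonzero polynomial, hence regular on the tensor product by
flatness; the odd part is a sum of commuting elements of square zero, hence nilpotent. -/
lemma mulLeft_eta_injective (hn : 0 < n) : Function.Injective (LinearMap.mulLeft ℂ (eta n m)) := by
  rw [injective_iff_map_eq_zero]
  intro f hf
  rw [LinearMap.mulLeft_apply, eta_eq] at hf
  refine Commute.mul_left_injective_add_of_isNilpotent ?_ ?_ ?_ hf
  · rw [commute_iff_eq, Algebra.TensorProduct.tmul_mul_tmul, Algebra.TensorProduct.tmul_mul_tmul,
      one_mul, one_mul, mul_one, mul_one]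
  · set q : BosPart n := ∑ i, MvPolynomial.X (Sum.inl i) * MvPolynomial.X (Sum.inr i) with hq
    have hq0 : q ≠ 0 := by
      intro h
      have h1 := congrArg (MvPolynomial.eval fun _ => (1 : ℂ)) h
      simp [hq] at h1
      omega
    have h : LinearMap.mulLeft ℂ (q ⊗ₜ[ℂ] (1 : FermPart m) : SuperPoly n m) =
        LinearMap.rTensor (FermPart m) (LinearMap.mulLeft ℂ q) :=
      TensorProduct.ext' fun f w => by simp
    have hinj := Module.Flat.rTensor_preserves_injective_linearMap (M := FermPart m)
      (LinearMap.mulLeft ℂ q) (mul_right_injective₀ hq0)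
    rw [← h, injective_iff_map_eq_zero] at hinj
    exact fun g hg => hinj g hg
  · have h1 : IsNilpotent (∑ r, fermGen m (Sum.inl r) * fermGen m (Sum.inr r)) := by
      refine Commute.isNilpotent_sum (fun r _ => ⟨2, ?_⟩)
        fun r s _ _ => commute_fermGen_mul_fermGen _ _ _ _
      rw [pow_two, mul_assoc, ← mul_assoc (fermGen m (Sum.inr r)),
        fermGen_mul_fermGen (Sum.inr r) (Sum.inl r), neg_mul, mul_neg, mul_assoc,
        fermGen_mul_self, mul_zero, mul_zero, neg_zero]
    obtain ⟨N, hN⟩ := h1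
    exact ⟨N, by rw [Algebra.TensorProduct.tmul_pow, hN, TensorProduct.tmul_zero]⟩

/-! ### The contravariant form -/

/-- The bilinear form on `ℂ[x, y]` for which the monomials are orthogonal and the square of
`x^γ` is `γ!`. -/
def bosForm (n : ℕ) : LinearMap.BilinForm ℂ (BosPart n) :=
  (MvPolynomial.basisMonomials (Bos n) ℂ).constr ℂ fun γ =>
    ((∏ a, (γ a).factorial : ℕ) : ℂ) • MvPolynomial.lcoeff ℂ γ

lemma bosForm_monomial (γ : Bos n →₀ ℕ) (q : BosPart n) :
    bosForm n (MvPolynomial.monomial γ 1) q =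
      ((∏ a, (γ a).factorial : ℕ) : ℂ) * MvPolynomial.coeff γ q := by
  have h : MvPolynomial.monomial γ (1 : ℂ) = MvPolynomial.basisMonomials (Bos n) ℂ γ := by simp
  rw [h, bosForm, Module.Basis.constr_basis]
  simp [MvPolynomial.lcoeff]

lemma bosForm_symm (p q : BosPart n) : bosForm n p q = bosForm n q p := by
  have h : bosForm n = (bosForm n).flip := by
    refine (MvPolynomial.basisMonomials (Bos n) ℂ).ext fun γ => ?_
    refine (MvPolynomial.basisMonomials (Bos n) ℂ).ext fun γ' => ?_
    change bosForm n (MvPolynomial.basisMonomials (Bos n) ℂ γ)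
      (MvPolynomial.basisMonomials (Bos n) ℂ γ') = bosForm n
      (MvPolynomial.basisMonomials (Bos n) ℂ γ') (MvPolynomial.basisMonomials (Bos n) ℂ γ)
    rw [MvPolynomial.coe_basisMonomials]
    simp only [bosForm_monomial, MvPolynomial.coeff_monomial]
    by_cases h : γ = γ'
    · rw [h]
    · simp [h, Ne.symm h]
  exact LinearMap.congr_fun (LinearMap.congr_fun h p) q

/-- The factorial weights are chosen for this: (γ + e_a)! = (γ_a + 1) γ!, and γ_a + 1 is the factor
in the coefficient of a derivative. -/
lemma bosForm_X_mul (a : Bos n) (p q : BosPart n) :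
    bosForm n (MvPolynomial.X a * p) q = bosForm n p (MvPolynomial.pderiv a q) := by
  classical
  induction p using MvPolynomial.induction_on' with
  | add p₁ p₂ h₁ h₂ => simp [mul_add, h₁, h₂]
  | monomial γ t =>
    have h1 : MvPolynomial.monomial γ t = t • MvPolynomial.monomial γ (1 : ℂ) := by
      rw [MvPolynomial.smul_monomial, smul_eq_mul, mul_one]
    have h2 : (MvPolynomial.X a * MvPolynomial.monomial γ (1 : ℂ) : BosPart n) =
        MvPolynomial.monomial (γ + Finsupp.single a 1) 1 := by
      rw [MvPolynomial.X, MvPolynomial.monomial_mul, one_mul, add_comm]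
    have h3 : ∏ b, ((γ + Finsupp.single a 1 : Bos n →₀ ℕ) b).factorial = (γ a + 1) * ∏ b, (γ b).factorial := by
      rw [← Finset.mul_prod_erase _ _ (Finset.mem_univ a),
        ← Finset.mul_prod_erase Finset.univ (fun b => (γ b).factorial) (Finset.mem_univ a),
        ← mul_assoc]
      congr 1
      · simp [Nat.factorial_succ]
      · refine Finset.prod_congr rfl fun b hb => ?_
        simp [(Finset.ne_of_mem_erase hb).symm]
    rw [h1, mul_smul_comm, h2, map_smul, map_smul, LinearMap.smul_apply, LinearMap.smul_apply,
      bosForm_monomial, bosForm_monomial, h3, MvPolynomial.coeff_pderiv]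
    push_cast
    ring_nf

lemma bosForm_pderiv (a : Bos n) (p q : BosPart n) :
    bosForm n (MvPolynomial.pderiv a p) q = bosForm n p (MvPolynomial.X a * q) := by
  rw [bosForm_symm, ← bosForm_X_mul, bosForm_symm]

/-- The signs by which the fermionic derivatives are adjoint to the fermionic variables. -/
def fermSign (m : ℕ) : Ferm m → ℂ := Sum.elim (fun _ => 1) fun _ => -1

lemma fermSign_mul_self (p : Ferm m) : fermSign m p * fermSign m p = 1 := by
  rcases p with r | r <;> simp [fermSign]

/-- Contraction with the linear form dual to a vector. -/
def vectorContract (m : ℕ) : (Ferm m → ℂ) →ₗ[ℂ] Module.End ℂ (FermPart m) :=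
  (CliffordAlgebra.contractLeft (Q := (0 : QuadraticForm ℂ (Ferm m → ℂ)))).comp
    (∑ p, (LinearMap.proj p : (Ferm m → ℂ) →ₗ[ℂ] ℂ).smulRight
      (fermSign m p • (LinearMap.proj p : Module.Dual ℂ (Ferm m → ℂ))))

lemma vectorContract_apply (v : Ferm m → ℂ) (w : FermPart m) :
    vectorContract m v w = ∑ p, (v p * fermSign m p) • fermContract m p w := by
  simp [vectorContract, fermContract, LinearMap.sum_apply, smul_smul]

lemma vectorContract_single (p : Ferm m) (w : FermPart m) :
    vectorContract m (Pi.single p 1) w = fermSign m p • fermContract m p w := by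
  rw [vectorContract_apply, Finset.sum_eq_single_of_mem p (Finset.mem_univ p)]
  · simp
  · intro b _ hb; simp [hb]

lemma vectorContract_vectorContract (v : Ferm m → ℂ) (w : FermPart m) :
    vectorContract m v (vectorContract m v w) = (0 : QuadraticForm ℂ (Ferm m → ℂ)) v • w := by
  rw [zero_apply, zero_smul]
  exact CliffordAlgebra.contractLeft_contractLeft _ _

lemma vectorContract_fermGen_mul (v : Ferm m → ℂ) (q : Ferm m) (w : FermPart m) :
    vectorContract m v (fermGen m q * w) =
      (v q * fermSign m q) • w - fermGen m q * vectorContract m v w := by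
  simp only [vectorContract_apply, fermContract_fermGen_mul, smul_sub, Finset.sum_sub_distrib,
    Finset.mul_sum, mul_smul_comm, smul_ite, smul_zero, Finset.sum_ite_eq', Finset.mem_univ,
    if_true]

/-- The contravariant form on the exterior algebra. -/
def fermForm (m : ℕ) : LinearMap.BilinForm ℂ (FermPart m) :=
  (CliffordAlgebra.foldl (0 : QuadraticForm ℂ (Ferm m → ℂ)) (vectorContract m)
    vectorContract_vectorContract).flip.compr₂
      (ExteriorAlgebra.algebraMapInv (R := ℂ) (M := Ferm m → ℂ)).toLinearMap

lemma fermForm_ι_mul (v : Ferm m → ℂ) (u w : FermPart m) :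
    fermForm m (ExteriorAlgebra.ι ℂ v * u) w = fermForm m u (vectorContract m v w) := by
  simp [fermForm, CliffordAlgebra.foldl_mul]

lemma fermForm_algebraMap (t : ℂ) (w : FermPart m) :
    fermForm m (algebraMap ℂ _ t) w = t * ExteriorAlgebra.algebraMapInv w := by
  simp [fermForm]

lemma fermForm_fermGen_mul (p : Ferm m) (u w : FermPart m) :
    fermForm m (fermGen m p * u) w = fermSign m p * fermForm m u (fermContract m p w) := by
  rw [fermGen, fermForm_ι_mul, vectorContract_single, map_smul, smul_eq_mul]

/-- Only the adjointness of left multiplication is built into the form. This converse follows by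
induction on u, as contraction and multiplication anticommute up to a scalar. -/
lemma fermForm_fermContract (p : Ferm m) (u w : FermPart m) :
    fermForm m (fermContract m p u) w = fermSign m p * fermForm m u (fermGen m p * w) := by
  induction u using CliffordAlgebra.left_induction generalizing w with
  | algebraMap t =>
    have h1 : fermContract m p (algebraMap ℂ _ t) = 0 := CliffordAlgebra.contractLeft_algebraMap _ _ t
    have h2 := fermForm_algebraMap t (fermGen m p * w)
    rw [map_mul ExteriorAlgebra.algebraMapInv, fermGen] at h2
    have h3 : ExteriorAlgebra.algebraMapInv
        (ExteriorAlgebra.ι ℂ (Pi.single p 1 : Ferm m → ℂ)) = 0 := by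
      simp [ExteriorAlgebra.algebraMapInv]
    rw [h3, zero_mul, mul_zero] at h2
    rw [h1, map_zero, LinearMap.zero_apply]
    exact (mul_eq_zero_of_right _ h2).symm
  | add x y hx hy => rw [map_add, map_add, map_add, LinearMap.add_apply, LinearMap.add_apply, hx, hy,
      mul_add]
  | ι_mul x v hx =>
    have h1 : fermContract m p (CliffordAlgebra.ι (0 : QuadraticForm ℂ (Ferm m → ℂ)) v * x) =
        v p • x - ExteriorAlgebra.ι ℂ v * fermContract m p x :=
      CliffordAlgebra.contractLeft_ι_mul _ _ _
    have h2 := fermForm_ι_mul v x (fermGen m p * w)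
    change _ = fermSign m p * fermForm m (ExteriorAlgebra.ι ℂ v * x) (fermGen m p * w)
    rw [h1, h2, map_sub, map_smul, LinearMap.sub_apply, LinearMap.smul_apply, fermForm_ι_mul, hx,
      vectorContract_fermGen_mul, map_sub, map_smul, smul_eq_mul, smul_eq_mul]
    linear_combination (-(v p * fermForm m x w)) * fermSign_mul_self p

/-- The contravariant form on `𝒜`. -/
def superForm (n m : ℕ) : LinearMap.BilinForm ℂ (SuperPoly n m) := (bosForm n).tmul (fermForm m)

lemma superForm_tmul (p q : BosPart n) (u w : FermPart m) :
    superForm n m (p ⊗ₜ u) (q ⊗ₜ w) = fermForm m u w * bosForm n p q := rfl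

lemma superForm_adjoint {A B : Module.End ℂ (SuperPoly n m)} {t : ℂ}
    (h : ∀ p q u w, superForm n m (A (p ⊗ₜ u)) (q ⊗ₜ w) = t * superForm n m (p ⊗ₜ u) (B (q ⊗ₜ w)))
    (f g : SuperPoly n m) : superForm n m (A f) g = t * superForm n m f (B g) := by
  induction f using TensorProduct.induction_on with
  | zero => simp
  | add x y hx hy => simp only [map_add, LinearMap.add_apply, hx, hy, mul_add]
  | tmul p u =>
    induction g using TensorProduct.induction_on with
    | zero => simp
    | add x y hx hy => simp only [map_add, hx, hy, mul_add]
    | tmul q w => exact h p q u w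

lemma superForm_mulBos (a : Bos n) (f g : SuperPoly n m) :
    superForm n m (mulBos n m a f) g = superForm n m f (dBos n m a g) := by
  rw [superForm_adjoint (B := dBos n m a) (t := 1), one_mul]
  intro p q u w
  rw [mulBos_tmul, dBos_tmul, superForm_tmul, superForm_tmul, bosForm_X_mul, one_mul]

lemma superForm_dBos (a : Bos n) (f g : SuperPoly n m) :
    superForm n m (dBos n m a f) g = superForm n m f (mulBos n m a g) := by
  rw [superForm_adjoint (B := mulBos n m a) (t := 1), one_mul]
  intro p q u w
  rw [mulBos_tmul, dBos_tmul, superForm_tmul, superForm_tmul, bosForm_pderiv, one_mul]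

lemma superForm_mulFerm (r : Ferm m) (f g : SuperPoly n m) :
    superForm n m (mulFerm n m r f) g = fermSign m r * superForm n m f (dFerm n m r g) := by
  refine superForm_adjoint (fun p q u w => ?_) f g
  rw [mulFerm_tmul, dFerm_tmul, superForm_tmul, superForm_tmul, fermForm_fermGen_mul, mul_assoc]

lemma superForm_dFerm (r : Ferm m) (f g : SuperPoly n m) :
    superForm n m (dFerm n m r f) g = fermSign m r * superForm n m f (mulFerm n m r g) := by
  refine superForm_adjoint (fun p q u w => ?_) f g
  rw [mulFerm_tmul, dFerm_tmul, superForm_tmul, superForm_tmul, fermForm_fermContract, mul_assoc]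

lemma superForm_one : superForm n m 1 1 = 1 := by
  rw [Algebra.TensorProduct.one_def, superForm_tmul]
  have h1 := fermForm_algebraMap (m := m) 1 1
  rw [(algebraMap ℂ (FermPart m)).map_one, map_one ExteriorAlgebra.algebraMapInv, mul_one] at h1
  have h2 := bosForm_monomial (n := n) 0 1
  rw [show (MvPolynomial.monomial (0 : Bos n →₀ ℕ) (1 : ℂ)) = 1 from rfl] at h2
  rw [h1, h2]
  simp

lemma isContravariant_superForm (n m : ℕ) :
    (fockSystem n m).IsContravariant (superForm n m) where
  c_inl := by
    rintro (a | a) f g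
    · exact superForm_mulBos _ f g
    · exact (superForm_mulFerm (Sum.inl a) f g).trans (one_mul _)
  c_inr := by
    rintro (a | a) f g
    · exact (superForm_mulBos _ f g).trans (by simp [idxParity]; rfl)
    · exact (superForm_mulFerm (Sum.inr a) f g).trans (by simp [idxParity, fermSign]; rfl)
  d_inl := by
    rintro (a | a) f g
    · exact superForm_dBos _ f g
    · exact (superForm_dFerm (Sum.inl a) f g).trans (one_mul _)
  d_inr := by
    rintro (a | a) f g
    · exact (superForm_dBos _ f g).trans (by simp [idxParity]; rfl)
    · exact (superForm_dFerm (Sum.inr a) f g).trans (by simp [idxParity, fermSign]; rfl)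
  vac := by
    change superForm n m 1 1 ≠ 0
    rw [superForm_one]
    exact one_ne_zero

end SuperHarmonic
end

noncomputable section

namespace SuperHarmonic

variable {n m : ℕ}

/-! ### The representation -/

lemma glAction_apply (X : Gl n m) (f : SuperPoly n m) :
    glAction n m X f = ∑ a, ∑ b, X a b • unitAction n m a b f := by
  simp [glAction, LinearMap.sum_apply]

lemma glAction_single (a b : Fin n ⊕ Fin m) :
    glAction n m (Matrix.single a b 1) = unitAction n m a b := by
  refine LinearMap.ext fun f => ?_
  rw [glAction_apply, Finset.sum_eq_single_of_mem a (Finset.mem_univ a),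
    Finset.sum_eq_single_of_mem b (Finset.mem_univ b), Matrix.single_apply_same, one_smul]
  · intro c _ hc
    rw [show (Matrix.single a b (1 : ℂ)) a c = 0 from
      Matrix.single_apply_of_col_ne _ _ hc.symm _, zero_smul]
  · intro c _ hc
    refine Finset.sum_eq_zero fun d _ => ?_
    rw [show (Matrix.single a b (1 : ℂ)) c d = 0 from
      Matrix.single_apply_of_row_ne hc.symm _ _ _, zero_smul]

lemma tmul_mem_parityPart {k : ZMod 2} (p : BosPart n) {w : FermPart m}
    (hw : w ∈ CliffordAlgebra.evenOdd (0 : QuadraticForm ℂ (Ferm m → ℂ)) k) :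
    (p ⊗ₜ[ℂ] w : SuperPoly n m) ∈ parityPart n m k :=
  ⟨p ⊗ₜ[ℂ] (⟨w, hw⟩ : CliffordAlgebra.evenOdd (0 : QuadraticForm ℂ (Ferm m → ℂ)) k), by
    rw [LinearMap.lTensor_tmul]; rfl⟩

lemma apply_mem_parityPart {T : Module.End ℂ (SuperPoly n m)} {j k : ZMod 2}
    (hT : ∀ (p : BosPart n) (w : FermPart m),
      w ∈ CliffordAlgebra.evenOdd (0 : QuadraticForm ℂ (Ferm m → ℂ)) j →
        T (p ⊗ₜ w) ∈ parityPart n m k) {f : SuperPoly n m} (hf : f ∈ parityPart n m j) :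
    T f ∈ parityPart n m k := by
  obtain ⟨g, rfl⟩ := hf
  induction g using TensorProduct.induction_on with
  | zero => simp
  | add x y hx hy => rw [map_add, map_add]; exact Submodule.add_mem _ hx hy
  | tmul p w => rw [LinearMap.lTensor_tmul]; exact hT p w w.2

lemma fermGen_mul_mem_evenOdd (p : Ferm m) {k : ZMod 2} {w : FermPart m}
    (hw : w ∈ CliffordAlgebra.evenOdd (0 : QuadraticForm ℂ (Ferm m → ℂ)) k) :
    fermGen m p * w ∈ CliffordAlgebra.evenOdd (0 : QuadraticForm ℂ (Ferm m → ℂ)) (1 + k) :=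
  CliffordAlgebra.evenOdd_mul_le _ 1 k
    (Submodule.mul_mem_mul (CliffordAlgebra.ι_mem_evenOdd_one _ _) hw)

lemma fermContract_mem_evenOdd (p : Ferm m) {k : ZMod 2} {w : FermPart m}
    (hw : w ∈ CliffordAlgebra.evenOdd (0 : QuadraticForm ℂ (Ferm m → ℂ)) k) :
    fermContract m p w ∈ CliffordAlgebra.evenOdd (0 : QuadraticForm ℂ (Ferm m → ℂ)) (1 + k) := by
  have t : (1 + 1 : ZMod 2) = 0 := by decide
  induction w, hw using CliffordAlgebra.evenOdd_induction with
  | range_ι_pow v hv =>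
    rcases k.eq_zero_or_one_of_two with rfl | rfl
    · rw [ZMod.val_zero, pow_zero] at hv
      obtain ⟨r, rfl⟩ := Submodule.mem_one.mp hv
      have : fermContract m p (algebraMap ℂ _ r) = 0 :=
        CliffordAlgebra.contractLeft_algebraMap _ _ r
      rw [this]
      exact Submodule.zero_mem _
    · rw [ZMod.val_one, pow_one] at hv
      obtain ⟨v, rfl⟩ := hv
      have : fermContract m p (CliffordAlgebra.ι _ v) = algebraMap ℂ _ (v p) :=
        CliffordAlgebra.contractLeft_ι _ _ v
      rw [this, t]
      exact CliffordAlgebra.one_le_evenOdd_zero _ (Submodule.algebraMap_mem _)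
  | add x y hx hy ihx ihy => rw [map_add]; exact Submodule.add_mem _ ihx ihy
  | ι_mul_ι_mul v₁ v₂ x hx ih =>
    have h1 : fermContract m p (CliffordAlgebra.ι _ v₁ * CliffordAlgebra.ι _ v₂ * x) =
        v₁ p • (CliffordAlgebra.ι _ v₂ * x) - CliffordAlgebra.ι _ v₁ *
          (v₂ p • x - CliffordAlgebra.ι _ v₂ * fermContract m p x) := by
      rw [mul_assoc]
      refine (CliffordAlgebra.contractLeft_ι_mul _ _ _).trans ?_
      congr 2
      exact CliffordAlgebra.contractLeft_ι_mul _ _ _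
    have hι : ∀ (v : Ferm m → ℂ) {j : ZMod 2} {y : FermPart m},
        y ∈ CliffordAlgebra.evenOdd (0 : QuadraticForm ℂ (Ferm m → ℂ)) j →
        CliffordAlgebra.ι (0 : QuadraticForm ℂ (Ferm m → ℂ)) v * y ∈
          CliffordAlgebra.evenOdd (0 : QuadraticForm ℂ (Ferm m → ℂ)) (1 + j) := fun v j y hy =>
      CliffordAlgebra.evenOdd_mul_le _ 1 j
        (Submodule.mul_mem_mul (CliffordAlgebra.ι_mem_evenOdd_one _ _) hy)
    rw [h1, mul_sub]
    refine Submodule.sub_mem _ (Submodule.smul_mem _ _ (hι v₂ hx)) (Submodule.sub_mem _ ?_ ?_)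
    · rw [mul_smul_comm]
      exact Submodule.smul_mem _ _ (hι v₁ hx)
    · have h2 := hι v₁ (hι v₂ ih)
      rwa [← add_assoc 1 1, t, zero_add] at h2

lemma creation_mem_parityPart (a : (Fin n ⊕ Fin m) ⊕ (Fin n ⊕ Fin m)) {k : ZMod 2}
    {f : SuperPoly n m} (hf : f ∈ parityPart n m k) :
    creation n m a f ∈ parityPart n m (varParity (idxParity n m) a + k) := by
  refine apply_mem_parityPart (fun p w hw => ?_) hf
  rcases a with (a | a) | (a | a) <;>
    simp only [creation, varParity_inl, varParity_inr, idxParity, mulBos_tmul, mulFerm_tmul,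
      zero_add] <;>
    first
      | exact tmul_mem_parityPart _ hw
      | exact tmul_mem_parityPart _ (fermGen_mul_mem_evenOdd _ hw)

lemma annihilation_mem_parityPart (a : (Fin n ⊕ Fin m) ⊕ (Fin n ⊕ Fin m)) {k : ZMod 2}
    {f : SuperPoly n m} (hf : f ∈ parityPart n m k) :
    annihilation n m a f ∈ parityPart n m (varParity (idxParity n m) a + k) := by
  refine apply_mem_parityPart (fun p w hw => ?_) hf
  rcases a with (a | a) | (a | a) <;>
    simp only [annihilation, varParity_inl, varParity_inr, idxParity, dBos_tmul, dFerm_tmul,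
      zero_add] <;>
    first
      | exact tmul_mem_parityPart _ hw
      | exact tmul_mem_parityPart _ (fermContract_mem_evenOdd _ hw)

lemma unitAction_mem_parityPart (a b : Fin n ⊕ Fin m) {k : ZMod 2} {f : SuperPoly n m}
    (hf : f ∈ parityPart n m k) :
    unitAction n m a b f ∈ parityPart n m (idxParity n m a + idxParity n m b + k) := by
  rw [← oscSystem_unit, OscSystem.unit_apply]
  have h1 := creation_mem_parityPart (Sum.inl a) (annihilation_mem_parityPart (Sum.inl b) hf)
  have h2 := creation_mem_parityPart (Sum.inr b) (annihilation_mem_parityPart (Sum.inr a) hf)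
  simp only [varParity_inl, varParity_inr] at h1 h2
  rw [← add_assoc] at h1 h2
  rw [add_comm (idxParity n m b)] at h2
  exact Submodule.sub_mem _ h1 (Submodule.smul_mem _ _ h2)

lemma superComm_eq {R : Type*} [Ring R] [Algebra ℂ R] (i j : ZMod 2) (X Y : R) :
    superComm i j X Y = X * Y - superSign i j • (Y * X) := by
  rw [superComm, superSign, Algebra.smul_def]
  simp

/-- For a fixed sign both sides are bilinear, so the bracket relation need only be checked on matrix
units of given parities. -/
lemma map_mul_sub_smul_mul_of_mem_span {R V : Type*} [Ring R] [Algebra ℂ R]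
    [AddCommGroup V] [Module ℂ V] (ρ : R →ₗ[ℂ] Module.End ℂ V) (s : ℂ) {S T : Set R}
    (h : ∀ X ∈ S, ∀ Y ∈ T, ρ (X * Y - s • (Y * X)) = ρ X * ρ Y - s • (ρ Y * ρ X)) {X Y : R}
    (hX : X ∈ Submodule.span ℂ S) (hY : Y ∈ Submodule.span ℂ T) :
    ρ (X * Y - s • (Y * X)) = ρ X * ρ Y - s • (ρ Y * ρ X) := by
  induction hX using Submodule.span_induction with
  | mem X hX =>
    induction hY using Submodule.span_induction with
    | mem Y hY => exact h X hX Y hY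
    | zero => simp
    | add Y Z _ _ ihY ihZ =>
      simp only [mul_add, add_mul, map_add, smul_add, add_sub_add_comm, ihY, ihZ]
    | smul t Y _ ih =>
      rw [mul_smul_comm, smul_mul_assoc, smul_comm _ t, ← smul_sub, map_smul, ih, map_smul,
        mul_smul_comm, smul_mul_assoc, smul_comm _ t, ← smul_sub]
  | zero => simp
  | add X Z _ _ ihX ihZ =>
    simp only [mul_add, add_mul, map_add, smul_add, add_sub_add_comm, ihX, ihZ]
  | smul t X _ ih =>
    rw [mul_smul_comm, smul_mul_assoc, smul_comm _ t, ← smul_sub, map_smul, ih, map_smul,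
      mul_smul_comm, smul_mul_assoc, smul_comm _ t, ← smul_sub]

lemma glPart_le_span (i : ZMod 2) : glPart n m i ≤ Submodule.span ℂ
    {X | ∃ a b, idxParity n m a + idxParity n m b = i ∧ X = Matrix.single a b 1} := by
  intro X hX
  rw [Matrix.matrix_eq_sum_single X]
  refine Submodule.sum_mem _ fun a _ => Submodule.sum_mem _ fun b _ => ?_
  by_cases h : X a b = 0
  · rw [h, Matrix.single_zero]
    exact Submodule.zero_mem _
  · have h1 : Matrix.single a b (X a b) = X a b • Matrix.single a b (1 : ℂ) := by
      rw [Matrix.smul_single, smul_eq_mul, mul_one]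
    rw [h1]
    exact Submodule.smul_mem _ _ (Submodule.subset_span ⟨a, b, hX a b h, rfl⟩)

lemma glAction_superComm_single (a b e g : Fin n ⊕ Fin m) :
    glAction n m (Matrix.single a b 1 * Matrix.single e g 1 -
      superSign (idxParity n m a + idxParity n m b) (idxParity n m e + idxParity n m g) •
        (Matrix.single e g 1 * Matrix.single a b 1)) =
      unitAction n m a b * unitAction n m e g -
        superSign (idxParity n m a + idxParity n m b) (idxParity n m e + idxParity n m g) •
          (unitAction n m e g * unitAction n m a b) := by
  have hmul : ∀ a b e g : Fin n ⊕ Fin m, ∀ f : SuperPoly n m,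
      glAction n m (Matrix.single a b 1 * Matrix.single e g 1) f =
        if b = e then (oscSystem n m).unit a g f else 0 := by
    intro a b e g f
    by_cases h : b = e
    · subst h
      rw [Matrix.single_mul_single_same, mul_one, glAction_single, if_pos rfl, oscSystem_unit]
    · rw [Matrix.single_mul_single_of_ne _ _ _ _ h, map_zero, if_neg h, LinearMap.zero_apply]
  refine LinearMap.ext fun f => ?_
  have h := (oscSystem n m).unit_bracket a b e g f
  rw [map_sub, map_smul, LinearMap.sub_apply, LinearMap.smul_apply, hmul, hmul, ← h]
  simp only [oscSystem_unit]
  rfl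

theorem isSuperRepresentation_glAction (n m : ℕ) : IsSuperRepresentation (glAction n m) where
  parity := by
    intro i j X f hX hf
    rw [glAction_apply]
    refine Submodule.sum_mem _ fun a _ => Submodule.sum_mem _ fun b _ => ?_
    by_cases h : X a b = 0
    · rw [h, zero_smul]
      exact Submodule.zero_mem _
    · refine Submodule.smul_mem _ _ ?_
      rw [← hX a b h]
      exact unitAction_mem_parityPart a b hf
  bracket := by
    intro i j X Y hX hY
    rw [superComm_eq, superComm_eq]
    refine map_mul_sub_smul_mul_of_mem_span (glAction n m) _ ?_ (glPart_le_span i hX)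
      (glPart_le_span j hY)
    rintro _ ⟨a, b, rfl, rfl⟩ _ ⟨e, g, rfl, rfl⟩
    rw [glAction_superComm_single, glAction_single, glAction_single]

lemma isGlSubmodule_iff (W : Submodule ℂ (SuperPoly n m)) :
    IsGlSubmodule W ↔ (fockSystem n m).IsUnitStable W := by
  have hunit : ∀ a b, (fockSystem n m).unit a b = unitAction n m a b := oscSystem_unit
  constructor
  · intro h a b f hf
    rw [hunit, ← glAction_single]
    exact h _ f hf
  · intro h X f hf
    rw [glAction_apply]
    refine Submodule.sum_mem _ fun a _ => Submodule.sum_mem _ fun b _ => ?_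
    rw [← hunit]
    exact Submodule.smul_mem _ _ (h a b f hf)

lemma isIrreducibleGl_iff (W : Submodule ℂ (SuperPoly n m)) :
    IsIrreducibleGl W ↔ (fockSystem n m).IsUnitIrreducible W := by
  simp only [IsIrreducibleGl, FockSystem.IsUnitIrreducible, isGlSubmodule_iff]

lemma biHom_eq_homog (k l : ℕ) : biHom n m k l = (fockSystem n m).homog k l := biHom_eq k l

lemma harm_eq_harmonic (k l : ℕ) : harm n m k l = (fockSystem n m).harmonic k l := by
  rw [harm, biHom_eq_homog, ← oscSystem_lap]
  rfl

lemma etaHarm_eq_etHarmonic (i k l : ℕ) :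
    etaHarm n m i k l = (fockSystem n m).etHarmonic i k l := by
  have h : (fockSystem n m).et = LinearMap.mulLeft ℂ (eta n m) := oscSystem_et
  rw [etaHarm, harm_eq_harmonic, FockSystem.etHarmonic, h, LinearMap.pow_mulLeft]

lemma fockSystem_et_injective (hn : 0 < n) : Function.Injective (fockSystem n m).et := by
  have h : (fockSystem n m).et = LinearMap.mulLeft ℂ (eta n m) := oscSystem_et
  rw [h]
  exact mulLeft_eta_injective hn

end SuperHarmonic
end

theorem theorem1 (n m : ℕ) (hn : 0 < n) (hm : 0 < m) (ℓ ℓ' : ℕ) :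
    SuperHarmonic.IsSuperRepresentation (SuperHarmonic.glAction n m) ∧
    (SuperHarmonic.IsGlSubmodule (SuperHarmonic.harm n m ℓ ℓ') ∧
      (SuperHarmonic.harm n m ℓ ℓ' = ⊥ ↔ n = 1 ∧ m < ℓ ∧ m < ℓ') ∧
      (¬ (n = 1 ∧ m < ℓ ∧ m < ℓ') →
        (SuperHarmonic.IsIrreducibleGl (SuperHarmonic.harm n m ℓ ℓ') ↔
          ((ℓ : ℤ) > m + 1 - n ∨ (ℓ' : ℤ) > m + 1 - n ∨ (ℓ : ℤ) + ℓ' ≤ m + 1 - n)))) ∧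
    ((|(ℓ : ℤ) - ℓ'| > m + 1 - n ∨ (ℓ : ℤ) + ℓ' ≤ m + 1 - n) →
      iSupIndep (fun i : Fin (min ℓ ℓ' + 1) =>
          SuperHarmonic.etaHarm n m i (ℓ - i) (ℓ' - i)) ∧
      (⨆ i : Fin (min ℓ ℓ' + 1), SuperHarmonic.etaHarm n m i (ℓ - i) (ℓ' - i)) =
        SuperHarmonic.biHom n m ℓ ℓ' ∧
      (∀ i : Fin (min ℓ ℓ' + 1), ¬ (n = 1 ∧ m < ℓ - i ∧ m < ℓ' - i) →
        SuperHarmonic.IsIrreducibleGl (SuperHarmonic.etaHarm n m i (ℓ - i) (ℓ' - i))) ∧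
      (∀ i : Fin (min ℓ ℓ' + 1), n = 1 ∧ m < ℓ - i ∧ m < ℓ' - i →
        SuperHarmonic.etaHarm n m i (ℓ - i) (ℓ' - i) = ⊥)) := by
  have hB := SuperHarmonic.isContravariant_superForm n m
  have het := SuperHarmonic.fockSystem_et_injective (m := m) hn
  have hirr : ∀ k l : ℕ, ¬ (n = 1 ∧ m < k ∧ m < l) →
      ((SuperHarmonic.fockSystem n m).IsUnitIrreducible
        ((SuperHarmonic.fockSystem n m).harmonic k l) ↔
        ((k : ℤ) > m + 1 - n ∨ (l : ℤ) > m + 1 - n ∨ (k : ℤ) + l ≤ m + 1 - n)) :=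
    fun k l h => hB.isUnitIrreducible_harmonic_iff het hn h
  simp only [SuperHarmonic.harm_eq_harmonic, SuperHarmonic.etaHarm_eq_etHarmonic,
    SuperHarmonic.biHom_eq_homog, SuperHarmonic.isGlSubmodule_iff,
    SuperHarmonic.isIrreducibleGl_iff]
  refine ⟨SuperHarmonic.isSuperRepresentation_glAction n m,
    ⟨FockSystem.isUnitStable_harmonic _ _ _, FockSystem.harmonic_eq_bot_iff _ hn _ _, hirr ℓ ℓ'⟩,
    fun h => ?_⟩
  have hns := FockSystem.isNonsingular_sub h
  refine ⟨FockSystem.iSupIndep_etHarmonic _ hns, FockSystem.iSup_etHarmonic _ hns,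
    fun i hi => FockSystem.IsUnitIrreducible.map_et_pow ((hirr _ _ hi).mpr ?_) het i,
    fun i hi => ?_⟩
  -- The larger of ℓ - i and ℓ' - i is at least |ℓ - ℓ'|, and their sum is at most ℓ + ℓ'; so the
  -- criterion passes to every summand.
  · have := i.2
    rcases h with h | h
    · rcases lt_abs.mp h with h | h <;> omega
    · omega
  · rw [FockSystem.etHarmonic, (FockSystem.harmonic_eq_bot_iff _ hn _ _).mpr hi, Submodule.map_bot]
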